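/- **Setting.** Let $K$ be a non-Archimedean local field of arbitrary characteristic, with ring of integers $\mathcal O_K$, maximal ideal $\pi\mathcal O_K$, residue field $\mathbb F_q$ and normalized absolute value $|\cdot|$ (so $|\pi|=q^{-1}$), and let $dx$ be the Haar measure on $K^n$ with $\int_{\mathcal O_K^n}dx=1$. A bar denotes reduction modulo $\pi$. Let $n\ge 2$ and let $f,g\in\mathcal O_K[x_1,\dots,x_n]\setminus\pi\mathcal O_K[x_1,\dots,x_n]$ be non-constant; put $D_K=\{x\in K^n: f(x)g(x)=0\}$. For $h=\sum_m c_mx^m\ne0$ let $\Gamma(h)$ be its Newton polyhedron, the convex hull of $\bigcup_{c_m\neq 0}(m+\mathbb R_{\ge0}^n)$. For $a\in\mathbb R_{\ge0}^n$ and $\Gamma=\Gamma(h)$ put $d(a,\Gamma)=\min_{x\in\Gamma}\langle a,x\rangle$, $F(a,\Gamma)=\{x\in\Gamma:\langle a,x\rangle=d(a,\Gamma)\}$ and $h_a=\sum_{m\in F(a,\Gamma)}c_mx^m$; put $\sigma(a)=a_1+\dots+a_n$. Let $\mathfrak D$ be the set of primitive vectors in $\mathbb N^n\setminus\{0\}$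 perpendicular to a facet (face of codimension one) of $\Gamma(fg)$. Assume that $f/g$ is non-degenerate over $\mathbb F_q$ with respect to $\Gamma(fg)$: writing $(h_1,h_2)=(f,g)$, for every $k\in\mathbb R_{\ge0}^n$, every non-empty $I\subseteq\{1,2\}$ and every $z\in(\mathbb F_q^\times)^n$ such that $\overline{h_{i,k}}(z)=0\Leftrightarrow i\in I$, the matrix $\big[\partial\overline{h_{i,k}}/\partial x_j(z)\big]_{i\in I,\,1\le j\le n}$ has rank $|I|$. Fix a simplicial polyhedral subdivision $\mathcal F$ of $\mathbb R_{\ge0}^n$ subordinate to $\Gamma(fg)$, that is, a partition of $\mathbb R_{\ge0}^n\setminus\{0\}$ into finitely many cones $\Delta=\{\sum_{i=1}^l\lambda_iw_i:\lambda_i>0\}$, each with linearly independent generators $w_1,\dots,w_l\in\mathfrak D$ and such that for some proper face $\tau$ of $\Gamma(fg)$ one has $F(a,\Gamma(fg))=\tau$ for all $a\in\Delta$. Put $b(\Delta)=\sum_iw_i$ and $b(\{0\})=0$. For $\Delta\in\mathcal F\cup\{\{0\}\}$ let $N_{\Delta,\{f\}}$, $N_{\Delta,\{g\}}$, $N_{\Delta,\{f,g\}}$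 be the numbers of $z\in(\mathbb F_q^\times)^n$ at which, among $\overline{f_{b(\Delta)}}$ and $\overline{g_{b(\Delta)}}$, respectively only the first, only the second, or both vanish. Let $Z(s_1,s_2,f,g)$ be the meromorphic continuation to $\mathbb C^2$ of $\int_{\mathcal O_K^n\setminus D_K}|f(x)|^{s_1}|g(x)|^{s_2}\,dx$ $(\operatorname{Re}s_1,\operatorname{Re}s_2>0)$, and put $Z(s,f/g)=Z(s,-s,f,g)$. Let $e(a)=d(a,\Gamma(g))-d(a,\Gamma(f))$, let $\alpha$ be the minimum of $\sigma(w)/e(w)$ over the $w\in\mathfrak D$ with $e(w)>0$ ($+\infty$ if there are none), let $\beta$ be the maximum of $\sigma(w)/e(w)$ over the $w\in\mathfrak D$ with $e(w)<0$ ($-\infty$ if there are none), and let $\widetilde\alpha=\min\{1,\alpha\}$, $\widetilde\beta=\max\{-1,\beta\}$. **Theorem.** The continuation exists and can be restricted to the line $s_2=-s_1$, so that $Z(s,f/g)$ is a meromorphic function on $\mathbb C$, and: (i) $Z(s,f/g)$ is a rational function of $q^{-s}$, and $$Z(s,f/g)=\sum_{\Delta\in\mathcal F\cup\{\{0\}\}}L_\Delta(s)S_\Delta(s),$$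 where $$L_\Delta(s)=q^{-n}\Big[(q-1)^n-N_{\Delta,\{f\}}\tfrac{1-q^{-s}}{1-q^{-1-s}}-N_{\Delta,\{g\}}\tfrac{1-q^{s}}{1-q^{-1+s}}-N_{\Delta,\{f,g\}}\tfrac{(1-q^{-s})(1-q^{s})}{q(1-q^{-1-s})(1-q^{-1+s})}\Big],$$ $S_{\{0\}}(s)=1$ and, for $\Delta\in\mathcal F$ with generators $w_1,\dots,w_l$, $$S_\Delta(s)=\frac{\sum_tq^{-\sigma(t)+e(t)s}}{\prod_{i=1}^l\big(1-q^{-\sigma(w_i)+e(w_i)s}\big)},$$ with $t$ running through $\mathbb Z^n\cap\{\sum_i\lambda_iw_i:0<\lambda_i\le1\}$. (ii) $Z(s,f/g)$ is holomorphic on the band $\widetilde\beta<\operatorname{Re}(s)<\widetilde\alpha$, and on this band it equals the absolutely convergent integral $\int_{\mathcal O_K^n\setminus D_K}|f(x)/g(x)|^s\,dx$. (iii) Every pole of $Z(s,f/g)$ is of the form $1+\frac{2\pi\sqrt{-1}\,k}{\ln q}$, $-1+\frac{2\pi\sqrt{-1}\,k}{\ln q}$, or $\frac{\sigma(w)}{e(w)}+\frac{2\pi\sqrt{-1}\,k}{e(w)\ln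 q}$, with $k\in\mathbb Z$ and $w\in\mathfrak D$ with $e(w)\neq0$. -/

import Mathlib

open MeasureTheory Set

noncomputable section

namespace NewtonZeta

/-! ### Newton polyhedra in `ℝⁿ` -/

/-- The Newton polyhedron at the origin of a polynomial: the convex hull of the union of the sets
`m + ℝ₊ⁿ`, where `m` runs through the exponents of the monomials occurring in `h`. -/
def newtonPolyhedron {n : ℕ} {R : Type*} [CommRing R] (h : MvPolynomial (Fin n) R) :
    Set (Fin n → ℝ) :=
  convexHull ℝ (⋃ m ∈ h.support, {x : Fin n → ℝ | ∀ j, (m j : ℝ) ≤ x j})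

/-- `d(a, Γ) = min_{x ∈ Γ} ⟨a, x⟩`. For `a` with non-negative coordinates and `Γ` the Newton
polyhedron of a non-zero polynomial the infimum is a minimum. -/
def dist {n : ℕ} (a : Fin n → ℝ) (Γ : Set (Fin n → ℝ)) : ℝ :=
  sInf ((fun x : Fin n → ℝ => ∑ j, a j * x j) '' Γ)

/-- The first meet locus `F(a, Γ)`. -/
def firstMeet {n : ℕ} (a : Fin n → ℝ) (Γ : Set (Fin n → ℝ)) : Set (Fin n → ℝ) :=
  {x | x ∈ Γ ∧ ∑ j, a j * x j = dist a Γ}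

/-- A proper face: a non-empty intersection of `Γ` with a supporting hyperplane. (Replacing the
normal vector `b` by `-b`, one may always take `Γ` to lie in the half-space `⟨b, x⟩ ≥ c`.) -/
def IsProperFace {n : ℕ} (Γ τ : Set (Fin n → ℝ)) : Prop :=
  ∃ (b : Fin n → ℝ) (c : ℝ), b ≠ 0 ∧ (∀ x ∈ Γ, c ≤ ∑ j, b j * x j) ∧
    τ = {x | x ∈ Γ ∧ ∑ j, b j * x j = c} ∧ τ.Nonempty

/-- A facet: a face whose affine hull has codimension one in `ℝⁿ`. -/
def IsFacet {n : ℕ} (Γ τ : Set (Fin n → ℝ)) : Prop :=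
  IsProperFace Γ τ ∧ Module.finrank ℝ (vectorSpan ℝ τ) + 1 = n

/-- A vector of natural numbers as a real vector. -/
def toReal {n : ℕ} (w : Fin n → ℕ) : Fin n → ℝ := fun j => (w j : ℝ)

/-- `𝔇(Γ)`: the primitive vectors in `ℕⁿ ∖ {0}` perpendicular to a facet of `Γ`. -/
def facetNormals {n : ℕ} (Γ : Set (Fin n → ℝ)) : Set (Fin n → ℕ) :=
  {w | w ≠ 0 ∧ Finset.univ.gcd w = 1 ∧ ∃ τ, IsFacet Γ τ ∧
    ∀ x ∈ τ, ∀ y ∈ τ, ∑ j, toReal w j * (x j - y j) = 0}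

/-- `σ(w) = w₁ + ⋯ + wₙ`. -/
def sigma {n : ℕ} (w : Fin n → ℕ) : ℕ := ∑ j, w j

/-- The face function `h_a` of `h`: the sum of the monomials of `h` with exponent in
`F(a, Γ(h))`. -/
def faceFun {n : ℕ} {R : Type*} [CommRing R] (h : MvPolynomial (Fin n) R) (a : Fin n → ℝ) :
    MvPolynomial (Fin n) R :=
  open scoped Classical in
  ∑ m ∈ h.support.filter (fun m => (fun j => (m j : ℝ)) ∈ firstMeet a (newtonPolyhedron h)),
    MvPolynomial.monomial m (h.coeff m)

/-! ### Simplicial subdivisions -/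

/-- The cone strictly spanned by a finite set of vectors; it is `{0}` for the empty set. -/
def openCone {n : ℕ} (W : Finset (Fin n → ℕ)) : Set (Fin n → ℝ) :=
  {x | ∃ c : (Fin n → ℕ) → ℝ, (∀ w ∈ W, 0 < c w) ∧ x = ∑ w ∈ W, c w • toReal w}

/-- The barycenter of the cone strictly spanned by `W`; it is `0` for the empty set. -/
def barycenter {n : ℕ} (W : Finset (Fin n → ℕ)) : Fin n → ℝ := ∑ w ∈ W, toReal w

/-- The class `Δ_τ` of all `a ∈ ℝ₊ⁿ` with first meet locus `τ`. -/
def faceCone {n : ℕ} (Γ τ : Set (Fin n → ℝ)) : Set (Fin n → ℝ) :=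
  {a | (∀ j, 0 ≤ a j) ∧ firstMeet a Γ = τ}

/-- A simplicial polyhedral subdivision of `ℝ₊ⁿ` subordinate to `Γ`: a partition of `ℝ₊ⁿ ∖ {0}`
into finitely many cones, each strictly spanned by linearly independent elements of `𝔇(Γ)` and
contained in a single class `Δ_τ`. Every cone is recorded by its set of generators. -/
structure SimplicialSubdivision {n : ℕ} (Γ : Set (Fin n → ℝ)) where
  cones : Finset (Finset (Fin n → ℕ))
  generators_mem : ∀ W ∈ cones, ∀ w ∈ W, w ∈ facetNormals Γ
  linearIndependent : ∀ W ∈ cones, LinearIndependent ℝ (fun w : W => toReal (w : Fin n → ℕ))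
  subordinate : ∀ W ∈ cones, ∃ τ, IsProperFace Γ τ ∧ openCone W ⊆ faceCone Γ τ
  disjoint : ∀ W ∈ cones, ∀ W' ∈ cones, W ≠ W' → Disjoint (openCone W) (openCone W')
  cover : ⋃ W ∈ cones, openCone W = {x : Fin n → ℝ | (∀ j, 0 ≤ x j) ∧ x ≠ 0}

/-- The set `ℤⁿ ∩ {∑ λ_w w ; 0 < λ_w ≤ 1}`. -/
def fundamentalPoints {n : ℕ} (W : Finset (Fin n → ℕ)) : Set (Fin n → ℤ) :=
  {t | ∃ c : (Fin n → ℕ) → ℝ, (∀ w ∈ W, 0 < c w ∧ c w ≤ 1) ∧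
    (fun j => (t j : ℝ)) = ∑ w ∈ W, c w • toReal w}

theorem fundamentalPoints_finite {n : ℕ} (W : Finset (Fin n → ℕ)) :
    (fundamentalPoints W).Finite := by
  refine (Set.finite_Icc (0 : Fin n → ℤ) (fun j => ∑ w ∈ W, (w j : ℤ))).subset ?_
  rintro t ⟨c, hc, ht⟩
  have key : ∀ j, (t j : ℝ) = ∑ w ∈ W, c w * (w j : ℝ) := fun j => by
    have := congrFun ht j
    simpa [toReal, Finset.sum_apply] using this
  refine ⟨fun j => ?_, fun j => ?_⟩
  · have h : (0 : ℝ) ≤ (t j : ℝ) := by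
      rw [key j]
      exact Finset.sum_nonneg fun w hw => mul_nonneg (hc w hw).1.le (Nat.cast_nonneg _)
    exact_mod_cast h
  · have h : (t j : ℝ) ≤ ∑ w ∈ W, (w j : ℝ) := by
      rw [key j]
      refine Finset.sum_le_sum fun w hw => ?_
      exact mul_le_of_le_one_left (Nat.cast_nonneg _) (hc w hw).2
    exact_mod_cast h

/-! ### Non-degeneracy and local zeta functions over a local field -/

section LocalField

variable {K : Type*} [NontriviallyNormedField K] [IsUltrametricDist K]

open scoped NormedField in
/-- The ring of integers of `K`, that is, the closed unit ball. -/
abbrev RingInt (K : Type*) [NontriviallyNormedField K] [IsUltrametricDist K] : Subring K :=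
  Valued.integer K

/-- The residue field of `K`. -/
abbrev ResField (K : Type*) [NontriviallyNormedField K] [IsUltrametricDist K] : Type _ :=
  IsLocalRing.ResidueField (RingInt K)

/-- The cardinality `q` of the residue field of `K`. -/
def resCard (K : Type*) [NontriviallyNormedField K] [IsUltrametricDist K] : ℕ := Nat.card (ResField K)

/-- Reduction of the coefficients of a polynomial modulo the maximal ideal of the ring of integers. -/
def reduction {n : ℕ} (h : MvPolynomial (Fin n) (RingInt K)) : MvPolynomial (Fin n) (ResField K) :=
  MvPolynomial.map (IsLocalRing.residue (RingInt K)) h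

/-- Non-degeneracy over the residue field of a polynomial mapping `h = (h₁, …, h_r)` with respect
to its Newton polyhedron: for all `k ∈ ℝ₊ⁿ` and all non-empty `I`, the Jacobian matrix of the
reduced face functions `(h_{i,k})_{i ∈ I}` has rank `|I|` at every point of the torus over the
residue field at which exactly the reduced face functions with index in `I` vanish. -/
def NonDegenerate {n r : ℕ} (h : Fin r → MvPolynomial (Fin n) (RingInt K)) : Prop :=
  ∀ k : Fin n → ℝ, (∀ j, 0 ≤ k j) → ∀ I : Finset (Fin r), I.Nonempty →
    ∀ z : Fin n → ResField K, (∀ j, z j ≠ 0) →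
      (∀ i, MvPolynomial.eval z (reduction (faceFun (h i) k)) = 0 ↔ i ∈ I) →
      (Matrix.of fun (i : I) (j : Fin n) =>
        MvPolynomial.eval z
          (MvPolynomial.pderiv j (reduction (faceFun (h (i : Fin r)) k)))).rank = I.card

/-- The set `𝒪ⁿ ∖ D`, where `D ⊆ Kⁿ` is the union of the zero sets of the `hᵢ`. -/
def zetaDomain {n r : ℕ} (h : Fin r → MvPolynomial (Fin n) (RingInt K)) : Set (Fin n → K) :=
  {x | (∀ j, ‖x j‖ ≤ 1) ∧ ∀ i, MvPolynomial.aeval x (h i) ≠ 0}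

/-- The integral `Z(s, h) = ∫_{𝒪ⁿ ∖ D} ∏ᵢ |hᵢ(x)|^{sᵢ} dx`, which converges if `Re sᵢ > 0` for
all `i`. -/
def zetaIntegral {n r : ℕ} [MeasurableSpace K] (μ : Measure (Fin n → K))
    (h : Fin r → MvPolynomial (Fin n) (RingInt K)) (s : Fin r → ℂ) : ℂ :=
  ∫ x in zetaDomain h, ∏ i, ((‖MvPolynomial.aeval x (h i)‖ : ℝ) : ℂ) ^ s i ∂μ

/-- `Z` is the local zeta function `s ↦ Z(s, -s, f, g)` of `f / g`, where `Z(s₁, s₂, f, g)` is the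
meromorphic continuation to `ℂ²` of the zeta integral on `Re s₁ > 0`, `Re s₂ > 0`.
The continuation is written as a quotient `A / B` of entire functions on `ℂ²` whose denominator
does not vanish identically on the line `s₂ = -s₁`, so that it can be restricted to that line. By
the identity theorem the restriction does not depend on the choice of `A` and `B`. A meromorphic
function on `ℂ` is taken in normal form: it has its limit as value wherever it has a removable
singularity, and the value `0` at its poles. So there is at most one such function `Z`. -/
def IsQuotientZeta {n : ℕ} [MeasurableSpace K] (μ : Measure (Fin n → K))
    (f g : MvPolynomial (Fin n) (RingInt K)) (Z : ℂ → ℂ) : Prop :=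
  MeromorphicNFOn Z univ ∧
  ∃ A B : (Fin 2 → ℂ) → ℂ, AnalyticOnNhd ℂ A univ ∧ AnalyticOnNhd ℂ B univ ∧
    (∀ s : Fin 2 → ℂ, (∀ i, 0 < (s i).re) → B s * zetaIntegral μ ![f, g] s = A s) ∧
    (∃ s : ℂ, B ![s, -s] ≠ 0) ∧
    ∀ s : ℂ, B ![s, -s] ≠ 0 → Z s = A ![s, -s] / B ![s, -s]

/-! ### The data attached to `f / g` -/

/-- `N_{Δ,{f}}`: the number of points of the torus over the residue field at which the reduction
of `f_{b(Δ)}` vanishes and that of `g_{b(Δ)}` does not. Note `N_{Δ,{g}}` is `countOne g f W`. -/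
def countOne {n : ℕ} (f g : MvPolynomial (Fin n) (RingInt K)) (W : Finset (Fin n → ℕ)) : ℕ :=
  Nat.card {z : Fin n → ResField K // (∀ j, z j ≠ 0) ∧
    MvPolynomial.eval z (reduction (faceFun f (barycenter W))) = 0 ∧
    MvPolynomial.eval z (reduction (faceFun g (barycenter W))) ≠ 0}

/-- `N_{Δ,{f,g}}`: the number of points of the torus over the residue field at which the
reductions of `f_{b(Δ)}` and `g_{b(Δ)}` both vanish. -/
def countBoth {n : ℕ} (f g : MvPolynomial (Fin n) (RingInt K)) (W : Finset (Fin n → ℕ)) : ℕ :=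
  Nat.card {z : Fin n → ResField K // (∀ j, z j ≠ 0) ∧
    MvPolynomial.eval z (reduction (faceFun f (barycenter W))) = 0 ∧
    MvPolynomial.eval z (reduction (faceFun g (barycenter W))) = 0}

/-- `L_Δ(s, f/g)`, for `Δ` the cone strictly spanned by `W` (and `Δ = {0}` for `W = ∅`). -/
def LFactor {n : ℕ} (f g : MvPolynomial (Fin n) (RingInt K)) (W : Finset (Fin n → ℕ)) (s : ℂ) : ℂ :=
  (resCard K : ℂ) ^ (-(n : ℂ)) *
    (((resCard K : ℂ) - 1) ^ n
      - (countOne f g W : ℂ) *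
          ((1 - (resCard K : ℂ) ^ (-s)) / (1 - (resCard K : ℂ) ^ (-1 - s)))
      - (countOne g f W : ℂ) *
          ((1 - (resCard K : ℂ) ^ s) / (1 - (resCard K : ℂ) ^ (-1 + s)))
      - (countBoth f g W : ℂ) *
          (((1 - (resCard K : ℂ) ^ (-s)) * (1 - (resCard K : ℂ) ^ s)) /
            ((resCard K : ℂ) * (1 - (resCard K : ℂ) ^ (-1 - s)) *
              (1 - (resCard K : ℂ) ^ (-1 + s)))))

/-- `d(a, Γ(g)) - d(a, Γ(f))`. -/
def distDiff {n : ℕ} (f g : MvPolynomial (Fin n) (RingInt K)) (a : Fin n → ℝ) : ℝ :=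
  dist a (newtonPolyhedron g) - dist a (newtonPolyhedron f)

/-- The factor `1 - q^{-σ(w) - (d(w, Γ(f)) - d(w, Γ(g))) s}`. -/
def denomFactor {n : ℕ} (f g : MvPolynomial (Fin n) (RingInt K)) (w : Fin n → ℕ) (s : ℂ) : ℂ :=
  1 - (resCard K : ℂ) ^ (-(sigma w : ℂ) + (distDiff f g (toReal w) : ℂ) * s)

/-- `S_Δ(s)`, for `Δ` the cone strictly spanned by `W`. -/
def SFactor {n : ℕ} (f g : MvPolynomial (Fin n) (RingInt K)) (W : Finset (Fin n → ℕ)) (s : ℂ) : ℂ :=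
  (∑ t ∈ (fundamentalPoints_finite W).toFinset,
    (resCard K : ℂ) ^ (-((∑ j, t j : ℤ) : ℂ) + (distDiff f g (fun j => (t j : ℝ)) : ℂ) * s)) /
    ∏ w ∈ W, denomFactor f g w s

/-- The number `σ(w) / (d(w, Γ(g)) - d(w, Γ(f)))`. -/
def slope {n : ℕ} (f g : MvPolynomial (Fin n) (RingInt K)) (w : Fin n → ℕ) : ℝ :=
  (sigma w : ℝ) / distDiff f g (toReal w)

/-- `α(f/g)`: the minimum of the slopes over `T₊`, and `+∞` if `T₊` is empty. -/
def alpha {n : ℕ} (f g : MvPolynomial (Fin n) (RingInt K)) : EReal :=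
  ⨅ w ∈ {w | w ∈ facetNormals (newtonPolyhedron (f * g)) ∧ 0 < distDiff f g (toReal w)},
    ((slope f g w : ℝ) : EReal)

/-- `β(f/g)`: the maximum of the slopes over `T₋`, and `-∞` if `T₋` is empty. -/
def beta {n : ℕ} (f g : MvPolynomial (Fin n) (RingInt K)) : EReal :=
  ⨆ w ∈ {w | w ∈ facetNormals (newtonPolyhedron (f * g)) ∧ distDiff f g (toReal w) < 0},
    ((slope f g w : ℝ) : EReal)

/-- The open band `max(-1, β) < Re s < min(1, α)`. -/
def band {n : ℕ} (f g : MvPolynomial (Fin n) (RingInt K)) : Set ℂ :=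
  {s | max (-1) (beta f g) < ((s.re : ℝ) : EReal) ∧ ((s.re : ℝ) : EReal) < min 1 (alpha f g)}

/-- The set of candidate poles. Vectors `w` with `d(w, Γ(g)) = d(w, Γ(f))` contribute none. -/
def candidatePoles {n : ℕ} (f g : MvPolynomial (Fin n) (RingInt K)) : Set ℂ :=
  {s | ∃ k : ℤ, s = 1 + 2 * Real.pi * Complex.I * k / Real.log (resCard K)} ∪
  {s | ∃ k : ℤ, s = -1 + 2 * Real.pi * Complex.I * k / Real.log (resCard K)} ∪
  {s | ∃ w ∈ facetNormals (newtonPolyhedron (f * g)), distDiff f g (toReal w) ≠ 0 ∧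
    ∃ k : ℤ, s = (slope f g w : ℂ) +
      2 * Real.pi * Complex.I * k / ((distDiff f g (toReal w) : ℂ) * Real.log (resCard K))}

end LocalField

end NewtonZeta

end

/-!
Cut `𝒪ⁿ ∖ D` into cells on which the valuation vector `k` of `x` and the residues of the angular
components are fixed. On such a cell, with `k` in a cone `Δ`, the reduced face polynomials at the
barycentre of `Δ` govern `f` and `g`: non-degeneracy makes those vanishing at the residue point
independent, so by a multivariate Hensel argument the values of `f` and `g` are equidistributed over
the admissible levels. The cell therefore contributes a factor depending only on `Δ` times the
lattice term `q ^ (-σ(k) - ∑ i, d(k, Γ(hᵢ)) sᵢ)`. Summing the lattice terms over a simplicial cone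
gives a product of geometric series times a finite sum over the half-open fundamental
parallelepiped, and clearing the denominators produces the continuation to `ℂ²`. Restricted to
`s₂ = -s₁`, the common denominator is a product of factors `1 - q ^ (-1 ∓ s)` and
`1 - q ^ (-σ(w) + e(w) s)`, whose zeros are the candidate poles; on the band all the geometric
series still converge absolutely.
-/

noncomputable section

namespace NewtonZeta

section NewtonPolyhedron

variable {n : ℕ} {R : Type*} [CommRing R] {f g h : MvPolynomial (Fin n) R} {a b : Fin n → ℝ}
  {m : Fin n →₀ ℕ}

theorem toReal_nonneg (k : Fin n → ℕ) : 0 ≤ toReal k := fun _ => Nat.cast_nonneg _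

theorem toReal_add (k l : Fin n → ℕ) : toReal (k + l) = toReal k + toReal l :=
  funext fun _ => Nat.cast_add _ _

theorem sum_toReal (k : Fin n → ℕ) : ∑ j, toReal k j = sigma k := by simp [toReal, sigma]

theorem toReal_mem_newtonPolyhedron (hm : m ∈ h.support) : toReal m ∈ newtonPolyhedron h :=
  subset_convexHull ℝ _ (mem_iUnion₂.2 ⟨m, hm, fun _ => le_rfl⟩)

theorem le_dotProduct_of_mem_newtonPolyhedron (ha : 0 ≤ a) {c : ℝ}
    (hc : ∀ m ∈ h.support, c ≤ a ⬝ᵥ toReal m) {x : Fin n → ℝ} (hx : x ∈ newtonPolyhedron h) :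
    c ≤ a ⬝ᵥ x := by
  have hconv : Convex ℝ {x : Fin n → ℝ | c ≤ a ⬝ᵥ x} :=
    convex_halfSpace_ge ⟨dotProduct_add a, fun r x => dotProduct_smul r a x⟩ c
  refine convexHull_min (iUnion₂_subset fun m hm y hy => ?_) hconv hx
  exact (hc m hm).trans (dotProduct_le_dotProduct_of_nonneg_left hy ha)

theorem dist_eq_dotProduct (ha : 0 ≤ a) (hm : m ∈ h.support)
    (hmin : ∀ m' ∈ h.support, a ⬝ᵥ toReal m ≤ a ⬝ᵥ toReal m') :
    dist a (newtonPolyhedron h) = a ⬝ᵥ toReal m := by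
  refine IsLeast.csInf_eq ⟨⟨_, toReal_mem_newtonPolyhedron hm, rfl⟩, ?_⟩
  rintro _ ⟨x, hx, rfl⟩
  exact le_dotProduct_of_mem_newtonPolyhedron ha hmin hx

theorem exists_dist_eq_dotProduct (hh : h ≠ 0) (ha : 0 ≤ a) :
    ∃ m ∈ h.support, dist a (newtonPolyhedron h) = a ⬝ᵥ toReal m := by
  obtain ⟨m, hm, hmin⟩ := Finset.exists_min_image h.support (fun m => a ⬝ᵥ toReal m)
    (MvPolynomial.support_nonempty.2 hh)
  exact ⟨m, hm, dist_eq_dotProduct ha hm hmin⟩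

theorem exists_dist_toReal_eq_natCast (hh : h ≠ 0) (k : Fin n → ℕ) :
    ∃ d : ℕ, dist (toReal k) (newtonPolyhedron h) = d := by
  obtain ⟨m, -, hm⟩ := exists_dist_eq_dotProduct hh (toReal_nonneg k)
  exact ⟨k ⬝ᵥ m, by simp [hm, dotProduct, toReal]⟩

theorem dist_le_dotProduct (ha : 0 ≤ a) (hm : m ∈ h.support) :
    dist a (newtonPolyhedron h) ≤ a ⬝ᵥ toReal m := by
  obtain ⟨m', hm', hmin⟩ := Finset.exists_min_image h.support (fun m => a ⬝ᵥ toReal m) ⟨m, hm⟩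
  exact dist_eq_dotProduct ha hm' hmin ▸ hmin m hm

theorem dist_smul {c : ℝ} (hc : 0 ≤ c) (a : Fin n → ℝ) (Γ : Set (Fin n → ℝ)) :
    dist (c • a) Γ = c * dist a Γ := by
  rw [dist, dist, ← smul_eq_mul, ← Real.sInf_smul_of_nonneg hc, ← image_smul, image_image]
  exact congrArg sInf (image_congr fun x _ => smul_dotProduct c a x)

theorem dist_add_dist_le (hh : h ≠ 0) (ha : 0 ≤ a) (hb : 0 ≤ b) :
    dist a (newtonPolyhedron h) + dist b (newtonPolyhedron h) ≤
      dist (a + b) (newtonPolyhedron h) := by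
  obtain ⟨m, hm, hd⟩ := exists_dist_eq_dotProduct hh (add_nonneg ha hb)
  rw [hd, add_dotProduct]
  exact add_le_add (dist_le_dotProduct ha hm) (dist_le_dotProduct hb hm)

theorem coeff_faceFun (h : MvPolynomial (Fin n) R) (a : Fin n → ℝ) (m : Fin n →₀ ℕ)
    [Decidable (a ⬝ᵥ toReal m = dist a (newtonPolyhedron h))] :
    (faceFun h a).coeff m =
      if a ⬝ᵥ toReal m = dist a (newtonPolyhedron h) then h.coeff m else 0 := by
  classical
  simp only [faceFun, MvPolynomial.coeff_sum, MvPolynomial.coeff_monomial]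
  rw [Finset.sum_ite_eq' _ m]
  by_cases hm : m ∈ h.support
  · refine if_congr ?_ rfl rfl
    rw [Finset.mem_filter, and_iff_right hm]
    exact and_iff_right (toReal_mem_newtonPolyhedron hm)
  · simp [hm, MvPolynomial.notMem_support_iff.1 hm]

theorem mem_support_faceFun : m ∈ (faceFun h a).support ↔
    m ∈ h.support ∧ a ⬝ᵥ toReal m = dist a (newtonPolyhedron h) := by
  classical
  rw [MvPolynomial.mem_support_iff, coeff_faceFun, ite_ne_right_iff, and_comm,
    MvPolynomial.mem_support_iff]

theorem faceFun_ne_zero (hh : h ≠ 0) (ha : 0 ≤ a) : faceFun h a ≠ 0 := by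
  obtain ⟨m, hm, hd⟩ := exists_dist_eq_dotProduct hh ha
  exact MvPolynomial.support_nonempty.1 ⟨m, mem_support_faceFun.2 ⟨hm, hd.symm⟩⟩

theorem coeff_faceFun_mul_faceFun (ha : 0 ≤ a)
    (hm : a ⬝ᵥ toReal m = dist a (newtonPolyhedron f) + dist a (newtonPolyhedron g)) :
    (faceFun f a * faceFun g a).coeff m = (f * g).coeff m := by
  classical
  simp only [MvPolynomial.coeff_mul]
  refine Finset.sum_congr rfl fun ⟨i, j⟩ hij => ?_
  rw [← Finset.HasAntidiagonal.mem_antidiagonal.1 hij, Finsupp.coe_add, toReal_add,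
    dotProduct_add] at hm
  by_cases hi : i ∈ f.support
  · by_cases hj : j ∈ g.support
    · have hai := dist_le_dotProduct ha hi
      have haj := dist_le_dotProduct ha hj
      rw [coeff_faceFun, coeff_faceFun, if_pos (by linarith), if_pos (by linarith)]
    · simp [coeff_faceFun, MvPolynomial.notMem_support_iff.1 hj]
  · simp [coeff_faceFun, MvPolynomial.notMem_support_iff.1 hi]

theorem dist_mul [NoZeroDivisors R] (hf : f ≠ 0) (hg : g ≠ 0) (ha : 0 ≤ a) :
    dist a (newtonPolyhedron (f * g)) =
      dist a (newtonPolyhedron f) + dist a (newtonPolyhedron g) := by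
  classical
  obtain ⟨m, hm⟩ := MvPolynomial.support_nonempty.2
    (mul_ne_zero (faceFun_ne_zero hf ha) (faceFun_ne_zero hg ha))
  have hdot : a ⬝ᵥ toReal m = dist a (newtonPolyhedron f) + dist a (newtonPolyhedron g) := by
    obtain ⟨i, hi, j, hj, rfl⟩ := Finset.mem_add.1 (MvPolynomial.support_mul _ _ hm)
    rw [Finsupp.coe_add, toReal_add, dotProduct_add, (mem_support_faceFun.1 hi).2,
      (mem_support_faceFun.1 hj).2]
  rw [MvPolynomial.mem_support_iff, coeff_faceFun_mul_faceFun ha hdot,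
    ← MvPolynomial.mem_support_iff] at hm
  rw [dist_eq_dotProduct ha hm, hdot]
  intro m' hm'
  obtain ⟨i, hi, j, hj, rfl⟩ := Finset.mem_add.1 (MvPolynomial.support_mul f g hm')
  rw [hdot, Finsupp.coe_add, toReal_add, dotProduct_add]
  exact add_le_add (dist_le_dotProduct ha hi) (dist_le_dotProduct ha hj)

end NewtonPolyhedron

section OpenCone

variable {n : ℕ} {W : Finset (Fin n → ℕ)} {a b : Fin n → ℝ}

theorem barycenter_mem_openCone (W : Finset (Fin n → ℕ)) : barycenter W ∈ openCone W :=
  ⟨fun _ => 1, fun _ _ => one_pos, by simp [barycenter]⟩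

theorem sum_smul_toReal_nonneg {c : (Fin n → ℕ) → ℝ} (hc : ∀ w ∈ W, 0 ≤ c w) :
    0 ≤ ∑ w ∈ W, c w • toReal w :=
  Finset.sum_nonneg fun w hw => smul_nonneg (hc w hw) (toReal_nonneg w)

theorem nonneg_of_mem_openCone (ha : a ∈ openCone W) : 0 ≤ a := by
  obtain ⟨c, hc, rfl⟩ := ha
  exact sum_smul_toReal_nonneg fun w hw => (hc w hw).le

theorem smul_mem_openCone {ε : ℝ} (hε : 0 < ε) (ha : a ∈ openCone W) : ε • a ∈ openCone W := by
  obtain ⟨c, hc, rfl⟩ := ha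
  exact ⟨fun w => ε * c w, fun w hw => mul_pos hε (hc w hw), by simp [Finset.smul_sum, mul_smul]⟩

theorem barycenter_add_smul_mem_openCone {c : (Fin n → ℕ) → ℝ} (hc : ∀ w ∈ W, 0 ≤ c w) {t : ℝ}
    (ht : 0 ≤ t) : barycenter W + t • ∑ w ∈ W, c w • toReal w ∈ openCone W :=
  ⟨fun w => 1 + t * c w, fun w hw => by have := mul_nonneg ht (hc w hw); positivity,
    by simp [barycenter, add_smul, mul_smul, Finset.sum_add_distrib, Finset.smul_sum]⟩

open scoped Topology in
theorem exists_sub_smul_mem_openCone (ha : a ∈ openCone W) (hb : b ∈ openCone W) :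
    ∃ ε : ℝ, 0 < ε ∧ b - ε • a ∈ openCone W := by
  obtain ⟨c, -, rfl⟩ := ha
  obtain ⟨e, he, rfl⟩ := hb
  have hev : ∀ᶠ ε in 𝓝[>] (0 : ℝ), ∀ w ∈ W, 0 < e w - ε * c w := by
    refine (Filter.eventually_all_finset W).2 fun w hw => nhdsWithin_le_nhds ?_
    exact (Continuous.tendsto' (by fun_prop) 0 (e w) (by simp)).eventually_const_lt (he w hw)
  obtain ⟨ε, hε, hpos⟩ := (hev.and self_mem_nhdsWithin).exists.imp fun _ => And.symm
  exact ⟨ε, hε, fun w => e w - ε * c w, hpos,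
    by simp [sub_smul, mul_smul, Finset.smul_sum, Finset.sum_sub_distrib]⟩

end OpenCone

section FaceCone

variable {n : ℕ} {R : Type*} [CommRing R] [NoZeroDivisors R] {f g : MvPolynomial (Fin n) R}
  {W : Finset (Fin n → ℕ)} {τ : Set (Fin n → ℝ)} {a b : Fin n → ℝ} {m : Fin n →₀ ℕ}

-- `d(·, Γ(f)) + d(·, Γ(g)) = d(·, Γ(fg))` is linear on the cone, being given by any point of `τ`,
-- and both summands are superadditive.
theorem dist_add_of_mem_faceCone (hf : f ≠ 0) (hg : g ≠ 0) (hτ : τ.Nonempty)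
    (ha : a ∈ faceCone (newtonPolyhedron (f * g)) τ)
    (hb : b ∈ faceCone (newtonPolyhedron (f * g)) τ)
    (hab : a + b ∈ faceCone (newtonPolyhedron (f * g)) τ) :
    dist (a + b) (newtonPolyhedron f) =
      dist a (newtonPolyhedron f) + dist b (newtonPolyhedron f) := by
  obtain ⟨x, hx⟩ := hτ
  have hdot : ∀ y ∈ faceCone (newtonPolyhedron (f * g)) τ,
      y ⬝ᵥ x = dist y (newtonPolyhedron f) + dist y (newtonPolyhedron g) := by
    rintro y ⟨hy, rfl⟩
    rw [← dist_mul hf hg hy]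
    exact hx.2
  have hsum := hdot _ hab
  rw [add_dotProduct, hdot a ha, hdot b hb] at hsum
  have hle_f := dist_add_dist_le hf ha.1 hb.1
  have hle_g := dist_add_dist_le hg ha.1 hb.1
  linarith

theorem dotProduct_eq_dist_of_mem_openCone (hf : f ≠ 0) (hg : g ≠ 0) (hτ : τ.Nonempty)
    (hW : openCone W ⊆ faceCone (newtonPolyhedron (f * g)) τ) (ha : a ∈ openCone W)
    (hb : b ∈ openCone W) (hm : m ∈ f.support)
    (hbm : b ⬝ᵥ toReal m = dist b (newtonPolyhedron f)) :
    a ⬝ᵥ toReal m = dist a (newtonPolyhedron f) := by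
  obtain ⟨ε, hε, hba⟩ := exists_sub_smul_mem_openCone ha hb
  have hεa := smul_mem_openCone hε ha
  have hadd := dist_add_of_mem_faceCone hf hg hτ (hW hεa) (hW hba)
    (by rw [add_sub_cancel]; exact hW hb)
  rw [add_sub_cancel, ← hbm] at hadd
  have hsplit : ε * a ⬝ᵥ toReal m + (b - ε • a) ⬝ᵥ toReal m = b ⬝ᵥ toReal m := by
    rw [← smul_eq_mul, ← smul_dotProduct, ← add_dotProduct, add_sub_cancel]
  have hle := dist_le_dotProduct (nonneg_of_mem_openCone hba) hm
  rw [dist_smul hε.le] at hadd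
  exact le_antisymm (le_of_mul_le_mul_left (by linarith) hε)
    (dist_le_dotProduct (nonneg_of_mem_openCone ha) hm)

theorem faceFun_eq_of_mem_openCone (hf : f ≠ 0) (hg : g ≠ 0) (hτ : τ.Nonempty)
    (hW : openCone W ⊆ faceCone (newtonPolyhedron (f * g)) τ) (ha : a ∈ openCone W)
    (hb : b ∈ openCone W) : faceFun f a = faceFun f b := by
  classical
  ext m
  simp only [coeff_faceFun]
  by_cases hm : m ∈ f.support
  · exact if_congr ⟨dotProduct_eq_dist_of_mem_openCone hf hg hτ hW hb ha hm,
      dotProduct_eq_dist_of_mem_openCone hf hg hτ hW ha hb hm⟩ rfl rfl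
  · simp [MvPolynomial.notMem_support_iff.1 hm]

theorem nonpos_of_forall_add_mul_nonpos {x y : ℝ} (h : ∀ t : ℝ, 0 ≤ t → x + t * y ≤ 0) :
    y ≤ 0 := by
  by_contra! hy
  have hx : x ≤ 0 := by simpa using h 0 le_rfl
  have := h ((1 - x) / y) (div_nonneg (by linarith) hy.le)
  rw [div_mul_cancel₀ _ hy.ne'] at this
  linarith

-- A monomial of `f` that is minimal at the barycenter `b` is minimal at `b + t • a` for all
-- `t ≥ 0`, hence at `a`.
theorem exists_dist_eq_dotProduct_on_cone (hf : f ≠ 0) (hg : g ≠ 0) (hτ : τ.Nonempty)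
    (hW : openCone W ⊆ faceCone (newtonPolyhedron (f * g)) τ) :
    ∃ m : Fin n →₀ ℕ, ∀ c : (Fin n → ℕ) → ℝ, (∀ w ∈ W, 0 ≤ c w) →
      dist (∑ w ∈ W, c w • toReal w) (newtonPolyhedron f) =
        (∑ w ∈ W, c w • toReal w) ⬝ᵥ toReal m := by
  have hb := barycenter_mem_openCone W
  obtain ⟨m, hm, hd⟩ := exists_dist_eq_dotProduct hf (nonneg_of_mem_openCone hb)
  refine ⟨m, fun c hc => dist_eq_dotProduct (sum_smul_toReal_nonneg hc) hm fun m' hm' => ?_⟩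
  rw [← sub_nonpos]
  refine nonpos_of_forall_add_mul_nonpos
    (x := barycenter W ⬝ᵥ toReal m - barycenter W ⬝ᵥ toReal m') fun t ht => ?_
  have hmem := barycenter_add_smul_mem_openCone hc ht
  have hle := dist_le_dotProduct (nonneg_of_mem_openCone hmem) hm'
  rw [← dotProduct_eq_dist_of_mem_openCone hf hg hτ hW hmem hb hm hd.symm] at hle
  simp only [add_dotProduct, smul_dotProduct, smul_eq_mul] at hle
  linarith

end FaceCone

section ProductSeries

variable {𝕜 β : Type*} [NormedField 𝕜] [CompleteSpace 𝕜]

theorem hasSum_prod_fin (m : ℕ) (f : Fin m → β → 𝕜) (hf : ∀ i, Summable fun a => ‖f i a‖) :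
    (Summable fun a : Fin m → β => ‖∏ i, f i (a i)‖) ∧
      HasSum (fun a : Fin m → β => ∏ i, f i (a i)) (∏ i, ∑' a, f i a) := by
  induction m with
  | zero =>
    simp only [Finset.univ_eq_empty, Finset.prod_empty]
    exact ⟨(hasSum_fintype _).summable, by simp⟩
  | succ m ih =>
    obtain ⟨htail_norm, htail⟩ := ih (fun i => f i.succ) fun i => hf i.succ
    have hnorm := (hf 0).mul_of_nonneg htail_norm (fun _ => norm_nonneg _) fun _ => norm_nonneg _
    simp only [← norm_mul] at hnorm
    have hsum := (hf 0).of_norm.hasSum.mul htail hnorm.of_norm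
    let e : (Fin (m + 1) → β) ≃ β × (Fin m → β) := (Fin.consEquiv fun _ => β).symm
    let F : β × (Fin m → β) → 𝕜 := fun p => f 0 p.1 * ∏ i, f (Fin.succ i) (p.2 i)
    have hF : ∀ a : Fin (m + 1) → β, ∏ i, f i (a i) = F (e a) := fun a => Fin.prod_univ_succ _
    simp only [hF, Fin.prod_univ_succ (fun i => ∑' a, f i a)]
    exact ⟨(Equiv.summable_iff (f := fun p => ‖F p‖) e).2 hnorm,
      (Equiv.hasSum_iff (f := F) e).2 hsum⟩

theorem hasSum_prod_pi {ι : Type*} [Fintype ι] (f : ι → β → 𝕜)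
    (hf : ∀ i, Summable fun a => ‖f i a‖) :
    (Summable fun a : ι → β => ‖∏ i, f i (a i)‖) ∧
      HasSum (fun a : ι → β => ∏ i, f i (a i)) (∏ i, ∑' a, f i a) := by
  let e := (Fintype.equivFin ι).symm
  let F : (Fin (Fintype.card ι) → β) → 𝕜 := fun a => ∏ i, f (e i) (a i)
  obtain ⟨hnorm, hsum⟩ := hasSum_prod_fin _ (fun i => f (e i)) fun i => hf (e i)
  rw [Equiv.prod_comp e fun i => ∑' a, f i a] at hsum
  have hF : ∀ a : ι → β, ∏ i, f i (a i) = F (Equiv.arrowCongr e.symm (Equiv.refl β) a) :=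
    fun a => (Equiv.prod_comp e fun i => f i (a i)).symm
  simp only [hF]
  exact ⟨(Equiv.summable_iff (f := fun a => ‖F a‖) _).2 hnorm, (Equiv.hasSum_iff (f := F) _).2 hsum⟩

end ProductSeries

section ConeSeries

variable {n : ℕ} {W : Finset (Fin n → ℕ)}

theorem exists_combination_iff_subtype {P : ℝ → Prop} {x : Fin n → ℝ} :
    (∃ c : (Fin n → ℕ) → ℝ, (∀ w ∈ W, P (c w)) ∧ x = ∑ w ∈ W, c w • toReal w) ↔
      ∃ c : W → ℝ, (∀ w, P (c w)) ∧ x = ∑ w, c w • toReal (w : Fin n → ℕ) := by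
  classical
  constructor
  · rintro ⟨c, hc, rfl⟩
    exact ⟨fun w => c w, fun w => hc w w.2, (Finset.sum_coe_sort W fun w => c w • toReal w).symm⟩
  · rintro ⟨c, hc, rfl⟩
    refine ⟨fun w => if hw : w ∈ W then c ⟨w, hw⟩ else 0, fun w hw => ?_, ?_⟩
    · simpa only [dif_pos hw] using hc ⟨w, hw⟩
    · rw [← Finset.sum_coe_sort W fun w => (if hw : w ∈ W then c ⟨w, hw⟩ else 0) • toReal w]
      exact Finset.sum_congr rfl fun w _ => by rw [dif_pos w.2]

theorem mem_openCone_iff {x : Fin n → ℝ} : x ∈ openCone W ↔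
    ∃ c : W → ℝ, (∀ w, 0 < c w) ∧ x = ∑ w, c w • toReal (w : Fin n → ℕ) :=
  exists_combination_iff_subtype

theorem mem_fundamentalPoints_iff {t : Fin n → ℤ} : t ∈ fundamentalPoints W ↔
    ∃ c : W → ℝ, (∀ w, 0 < c w ∧ c w ≤ 1) ∧
      (fun j => (t j : ℝ)) = ∑ w, c w • toReal (w : Fin n → ℕ) :=
  exists_combination_iff_subtype (P := fun y => 0 < y ∧ y ≤ 1)

theorem fundamentalPoints_nonneg {t : Fin n → ℤ} (ht : t ∈ fundamentalPoints W) : 0 ≤ t := by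
  obtain ⟨c, hc, h⟩ := ht
  have hsum := sum_smul_toReal_nonneg fun w hw => (hc w hw).1.le
  rw [← h] at hsum
  exact fun j => Int.cast_nonneg_iff.1 (hsum j)

/-- A vector of natural numbers as an integral vector. -/
def toInt (k : Fin n → ℕ) : Fin n → ℤ := fun j => (k j : ℤ)

theorem toInt_injective : Function.Injective (toInt (n := n)) :=
  fun _ _ h => funext fun j => Int.ofNat_inj.1 (congrFun h j)

theorem toReal_eq_sum_of_toInt_eq {k : Fin n → ℕ} {t : Fin n → ℤ} {ν : W → ℕ}
    (h : toInt k = t + ∑ w, ν w • toInt (w : Fin n → ℕ)) {c : W → ℝ}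
    (hc : (fun j => (t j : ℝ)) = ∑ w, c w • toReal (w : Fin n → ℕ)) :
    toReal k = ∑ w, (c w + ν w) • toReal (w : Fin n → ℕ) := by
  simp only [add_smul, Finset.sum_add_distrib, ← hc]
  ext j
  have hj := congrArg (Int.cast (R := ℝ)) (congrFun h j)
  simpa [toInt, toReal, Finset.sum_apply] using hj

/-- Translation of a fundamental point by a natural combination of the generators. For linearly
independent generators this parametrises the lattice points of the open cone. -/
def latticePoint (y : fundamentalPoints W × (W → ℕ)) : Fin n → ℕ :=
  fun j => (y.1.1 j).toNat + ∑ w, y.2 w * (w : Fin n → ℕ) j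

theorem toInt_latticePoint (y : fundamentalPoints W × (W → ℕ)) :
    toInt (latticePoint y) = y.1.1 + ∑ w, y.2 w • toInt (w : Fin n → ℕ) := by
  ext j
  have : 0 ≤ y.1.1 j := fundamentalPoints_nonneg y.1.2 j
  simp [toInt, latticePoint, Finset.sum_apply, this]

theorem toReal_latticePoint_mem_openCone (y : fundamentalPoints W × (W → ℕ)) :
    toReal (latticePoint y) ∈ openCone W := by
  obtain ⟨c, hc, h⟩ := mem_fundamentalPoints_iff.1 y.1.2
  exact mem_openCone_iff.2 ⟨_, fun w => add_pos_of_pos_of_nonneg (hc w).1 (Nat.cast_nonneg _),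
    toReal_eq_sum_of_toInt_eq (toInt_latticePoint y) h⟩

-- The coefficient of `w` lies in `(ν w, ν w + 1]`, so it determines `ν w`.
theorem latticePoint_injective
    (hW : LinearIndependent ℝ (fun w : W => toReal (w : Fin n → ℕ))) :
    Function.Injective (latticePoint (W := W)) := by
  rintro ⟨t, ν⟩ ⟨t', ν'⟩ heq
  obtain ⟨c, hc, h⟩ := mem_fundamentalPoints_iff.1 t.2
  obtain ⟨c', hc', h'⟩ := mem_fundamentalPoints_iff.1 t'.2
  have hcoeff : ∀ w, c w + ν w - (c' w + ν' w) = 0 := by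
    refine Fintype.linearIndependent_iff.1 hW _ ?_
    simp only [sub_smul, Finset.sum_sub_distrib]
    rw [← toReal_eq_sum_of_toInt_eq (toInt_latticePoint (t, ν)) h,
      ← toReal_eq_sum_of_toInt_eq (toInt_latticePoint (t', ν')) h', heq, sub_self]
  have hν : ν = ν' := by
    ext w
    have hlt : (ν w : ℝ) < ν' w + 1 := by linarith [hcoeff w, (hc w).1, (hc' w).2]
    have hlt' : (ν' w : ℝ) < ν w + 1 := by linarith [hcoeff w, (hc w).2, (hc' w).1]
    norm_cast at hlt hlt'
    omega
  subst hν
  have ht := toInt_latticePoint (t, ν)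
  rw [heq, toInt_latticePoint (t', ν)] at ht
  exact Prod.ext (Subtype.ext (add_right_cancel ht).symm) rfl

theorem exists_latticePoint_eq {k : Fin n → ℕ} (hk : toReal k ∈ openCone W) :
    ∃ y : fundamentalPoints W × (W → ℕ), latticePoint y = k := by
  obtain ⟨l, hl, hkl⟩ := mem_openCone_iff.1 hk
  let ν : W → ℕ := fun w => ⌈l w⌉₊ - 1
  have hν : ∀ w, (ν w : ℝ) = ⌈l w⌉₊ - 1 := fun w => by
    rw [Nat.cast_sub (Nat.one_le_ceil_iff.2 (hl w)), Nat.cast_one]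
  let t : Fin n → ℤ := toInt k - ∑ w, ν w • toInt (w : Fin n → ℕ)
  have ht : t ∈ fundamentalPoints W := by
    refine mem_fundamentalPoints_iff.2 ⟨fun w => l w - ν w, fun w => ?_, ?_⟩
    · have hlt := Nat.ceil_lt_add_one (hl w).le
      have hle := Nat.le_ceil (l w)
      constructor <;> linarith [hν w]
    · simp only [sub_smul, Finset.sum_sub_distrib, ← hkl]
      ext j
      simp [t, toInt, toReal, Finset.sum_apply]
  exact ⟨(⟨t, ht⟩, ν), toInt_injective (by rw [toInt_latticePoint]; exact sub_add_cancel _ _)⟩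

theorem latticePoint_bijective
    (hW : LinearIndependent ℝ (fun w : W => toReal (w : Fin n → ℕ))) :
    Function.Bijective (fun y : fundamentalPoints W × (W → ℕ) =>
      (⟨latticePoint y, toReal_latticePoint_mem_openCone y⟩ :
        {k : Fin n → ℕ // toReal k ∈ openCone W})) :=
  ⟨fun _ _ h => latticePoint_injective hW (congrArg Subtype.val h),
    fun ⟨_, hk⟩ => (exists_latticePoint_eq hk).imp fun _ h => Subtype.ext h⟩

theorem addChar_toInt_latticePoint {𝕜 : Type*} [CommMonoid 𝕜] (χ : AddChar (Fin n → ℤ) 𝕜)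
    (y : fundamentalPoints W × (W → ℕ)) :
    χ (toInt (latticePoint y)) = χ y.1 * ∏ w : W, χ (toInt (w : Fin n → ℕ)) ^ y.2 w := by
  have hsum : χ (∑ w, y.2 w • toInt (w : Fin n → ℕ)) = ∏ w, χ (y.2 w • toInt (w : Fin n → ℕ)) :=
    map_prod χ.toMonoidHom (fun w => Multiplicative.ofAdd (y.2 w • toInt (w : Fin n → ℕ))) _
  simp only [toInt_latticePoint, AddChar.map_add_eq_mul, hsum, AddChar.map_nsmul_eq_pow]

theorem hasSum_openCone {𝕜 : Type*} [NormedField 𝕜] [CompleteSpace 𝕜]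
    (hW : LinearIndependent ℝ (fun w : W => toReal (w : Fin n → ℕ)))
    {χ : AddChar (Fin n → ℤ) 𝕜} (hχ : ∀ w ∈ W, ‖χ (toInt w)‖ < 1) :
    (Summable fun k : {k : Fin n → ℕ // toReal k ∈ openCone W} => ‖χ (toInt k)‖) ∧
      HasSum (fun k : {k : Fin n → ℕ // toReal k ∈ openCone W} => χ (toInt k))
        ((∑ t ∈ (fundamentalPoints_finite W).toFinset, χ t) / ∏ w ∈ W, (1 - χ (toInt w))) := by
  have := (fundamentalPoints_finite W).fintype
  have hfund : HasSum (fun t : fundamentalPoints W => χ t)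
      (∑ t ∈ (fundamentalPoints_finite W).toFinset, χ t) := by
    rw [Finset.sum_subtype _ (fun t => (fundamentalPoints_finite W).mem_toFinset) χ]
    exact hasSum_fintype _
  obtain ⟨hgeom_norm, hgeom⟩ :=
    hasSum_prod_pi (fun (w : W) (m : ℕ) => χ (toInt (w : Fin n → ℕ)) ^ m) fun w => by
      simpa only [norm_pow] using summable_geometric_of_lt_one (norm_nonneg _) (hχ w w.2)
  rw [Finset.prod_congr rfl fun w _ => tsum_geometric_of_norm_lt_one (hχ w.1 w.2),
    Finset.prod_coe_sort W fun w => (1 - χ (toInt w))⁻¹, Finset.prod_inv_distrib] at hgeom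
  have hnorm := (Summable.of_finite (f := fun t : fundamentalPoints W => ‖χ t‖)).mul_of_nonneg
    hgeom_norm (fun _ => norm_nonneg _) fun _ => norm_nonneg _
  simp only [← norm_mul] at hnorm
  have hsum := hfund.mul hgeom hnorm.of_norm
  simp only [← addChar_toInt_latticePoint, ← div_eq_mul_inv] at hnorm hsum
  let e := Equiv.ofBijective _ (latticePoint_bijective hW)
  let F : {k : Fin n → ℕ // toReal k ∈ openCone W} → 𝕜 := fun k => χ (toInt k)
  exact ⟨(Equiv.summable_iff (f := fun k => ‖F k‖) e).1 hnorm,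
    (Equiv.hasSum_iff (f := F) e).1 hsum⟩

end ConeSeries

section LocalField

variable {K : Type*} [NontriviallyNormedField K] [IsUltrametricDist K]

/-- `ϖ` is a uniformizer of a local field `K` with finite residue field of `q` elements whose
absolute value is normalized: `|ϖ| = q⁻¹`, and the absolute values on `𝒪 ∖ {0}` are `q⁻ᵏ`. -/
structure IsUniformizer (ϖ : RingInt K) : Prop where
  norm_eq : ‖(ϖ : K)‖ = (resCard K : ℝ)⁻¹
  exists_norm_eq : ∀ x : K, x ≠ 0 → ‖x‖ ≤ 1 → ∃ k : ℕ, ‖x‖ = (resCard K : ℝ)⁻¹ ^ k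
  finite : Finite (ResField K)

theorem mem_ringInt {x : K} : x ∈ RingInt K ↔ ‖x‖ ≤ 1 := Valued.integer.mem_iff

theorem norm_ringInt_le (x : RingInt K) : ‖(x : K)‖ ≤ 1 := Valued.integer.norm_le_one x

theorem residue_eq_zero_iff {x : RingInt K} :
    IsLocalRing.residue (RingInt K) x = 0 ↔ ‖(x : K)‖ < 1 := by
  rw [IsLocalRing.residue_eq_zero_iff, IsLocalRing.mem_maximalIdeal, mem_nonunits_iff,
    Valued.integer.isUnit_iff_norm_eq_one]
  have := norm_ringInt_le x
  constructor
  · exact fun h => lt_of_le_of_ne this h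
  · exact fun h => ne_of_lt h

open scoped NormedField in
theorem exists_isUniformizer [ProperSpace K]
    (hnorm : ∀ ϖ : RingInt K, Irreducible ϖ → ‖(ϖ : K)‖ = (resCard K : ℝ)⁻¹) :
    ∃ ϖ : RingInt K, IsUniformizer ϖ := by
  have hR : (Valued.v : Valuation K NNReal).RankOne :=
    inferInstanceAs (Valuation.RankOne (NormedField.valuation (K := K)))
  have hc : CompactSpace (RingInt K) := by
    have : ((RingInt K : Subring K) : Set K) = Metric.closedBall 0 1 := by
      ext x
      simp [mem_ringInt]
    exact isCompact_iff_compactSpace.1 (this ▸ isCompact_closedBall (0 : K) 1)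
  obtain ⟨-, hD, hfin⟩ := open Valued.integer in
    compactSpace_iff_completeSpace_and_isDiscreteValuationRing_and_finite_residueField.1 hc
  obtain ⟨ϖ, hϖ⟩ := IsDiscreteValuationRing.exists_irreducible (RingInt K)
  refine ⟨ϖ, hnorm ϖ hϖ, fun x hx hx1 => ?_, hfin⟩
  have hx' : (⟨x, mem_ringInt.2 hx1⟩ : RingInt K) ≠ 0 := fun h => hx (congrArg Subtype.val h)
  obtain ⟨k, u, hu⟩ := IsDiscreteValuationRing.eq_unit_mul_pow_irreducible hx' hϖ
  refine ⟨k, ?_⟩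
  have := congrArg (fun y : RingInt K => ‖(y : K)‖) hu
  simpa [hnorm ϖ hϖ] using this

namespace IsUniformizer

variable {ϖ : RingInt K}

theorem one_lt (hϖ : IsUniformizer ϖ) : 1 < resCard K := by
  have := hϖ.finite
  exact Finite.one_lt_card

theorem inv_lt_one (hϖ : IsUniformizer ϖ) : (resCard K : ℝ)⁻¹ < 1 :=
  inv_lt_one_of_one_lt₀ (by exact_mod_cast hϖ.one_lt)

theorem inv_pos (hϖ : IsUniformizer ϖ) : 0 < (resCard K : ℝ)⁻¹ := by
  have := hϖ.one_lt
  positivity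

theorem ne_zero (hϖ : IsUniformizer ϖ) : (ϖ : K) ≠ 0 := by
  rw [← norm_pos_iff, hϖ.norm_eq]
  exact hϖ.inv_pos

theorem norm_lt_one_iff (hϖ : IsUniformizer ϖ) {x : K} : ‖x‖ < 1 ↔ ‖x‖ ≤ (resCard K : ℝ)⁻¹ := by
  constructor
  · intro h
    rcases eq_or_ne x 0 with rfl | hx
    · simp
    obtain ⟨k, hk⟩ := hϖ.exists_norm_eq x hx h.le
    rw [hk] at h ⊢
    have : k ≠ 0 := by
      rintro rfl
      simp at h
    exact pow_le_of_le_one hϖ.inv_pos.le hϖ.inv_lt_one.le this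
  · exact fun h => h.trans_lt hϖ.inv_lt_one

theorem pow_inj (hϖ : IsUniformizer ϖ) {k l : ℕ}
    (h : (resCard K : ℝ)⁻¹ ^ k = (resCard K : ℝ)⁻¹ ^ l) : k = l :=
  pow_right_injective₀ hϖ.inv_pos hϖ.inv_lt_one.ne h

theorem norm_le_pow_succ_iff (hϖ : IsUniformizer ϖ) {x : K} {a : ℕ} :
    ‖x‖ ≤ (resCard K : ℝ)⁻¹ ^ (a + 1) ↔ ‖x‖ < (resCard K : ℝ)⁻¹ ^ a := by
  have h0 : 0 < (resCard K : ℝ)⁻¹ ^ a := pow_pos hϖ.inv_pos a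
  have h : ‖x / (ϖ : K) ^ a‖ = ‖x‖ / (resCard K : ℝ)⁻¹ ^ a := by
    rw [norm_div, norm_pow, hϖ.norm_eq]
  have := hϖ.norm_lt_one_iff (x := x / (ϖ : K) ^ a)
  rw [h, div_lt_one h0, div_le_iff₀ h0] at this
  rw [this, pow_succ']

end IsUniformizer

/-- A representative in the ring of integers of an element of the residue field. -/
def resLift (r : ResField K) : RingInt K :=
  Function.surjInv IsLocalRing.residue_surjective r

theorem residue_resLift (r : ResField K) : IsLocalRing.residue (RingInt K) (resLift r) = r :=
  Function.surjInv_eq IsLocalRing.residue_surjective r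

variable {ϖ : RingInt K}

theorem norm_sub_resLift_le (hϖ : IsUniformizer ϖ) {x : RingInt K} {r : ResField K} :
    ‖(x : K) - (resLift r : K)‖ ≤ (resCard K : ℝ)⁻¹ ↔ IsLocalRing.residue (RingInt K) x = r := by
  rw [← hϖ.norm_lt_one_iff, ← AddSubgroupClass.coe_sub, ← residue_eq_zero_iff, map_sub,
    residue_resLift, sub_eq_zero]

theorem norm_sub_digit_le_iff (hϖ : IsUniformizer ϖ) {x : RingInt K} {r : ResField K} {a : ℕ} :
    ‖(ϖ : K) ^ a * x - (ϖ : K) ^ a * resLift r‖ ≤ (resCard K : ℝ)⁻¹ ^ (a + 1) ↔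
      IsLocalRing.residue (RingInt K) x = r := by
  rw [← mul_sub, norm_mul, norm_pow, hϖ.norm_eq, pow_succ,
    mul_le_mul_iff_right₀ (pow_pos hϖ.inv_pos a), norm_sub_resLift_le hϖ]

theorem exists_eq_pow_mul (hϖ : IsUniformizer ϖ) {x : K} {a : ℕ}
    (hx : ‖x‖ ≤ (resCard K : ℝ)⁻¹ ^ a) : ∃ y : RingInt K, x = (ϖ : K) ^ a * y := by
  refine ⟨⟨x / (ϖ : K) ^ a, mem_ringInt.2 ?_⟩, ?_⟩
  · rw [norm_div, norm_pow, hϖ.norm_eq]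
    exact div_le_one_of_le₀ hx (pow_pos hϖ.inv_pos a).le
  · have := pow_ne_zero a hϖ.ne_zero
    field_simp

theorem norm_pow_mul_eq_iff (hϖ : IsUniformizer ϖ) {x : RingInt K} {a : ℕ} :
    ‖(ϖ : K) ^ a * x‖ = (resCard K : ℝ)⁻¹ ^ a ↔ IsLocalRing.residue (RingInt K) x ≠ 0 := by
  have h0 := pow_pos hϖ.inv_pos a
  rw [norm_mul, norm_pow, hϖ.norm_eq, ne_eq, residue_eq_zero_iff, not_lt, mul_eq_left₀ h0.ne']
  exact ⟨fun h => h.ge, fun h => le_antisymm (norm_ringInt_le x) h⟩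

theorem norm_pow_mul_le (hϖ : IsUniformizer ϖ) (x : RingInt K) (a : ℕ) :
    ‖(ϖ : K) ^ a * x‖ ≤ (resCard K : ℝ)⁻¹ ^ a := by
  rw [norm_mul, norm_pow, hϖ.norm_eq]
  exact mul_le_of_le_one_right (pow_pos hϖ.inv_pos a).le (norm_ringInt_le x)

theorem norm_pow_mul_le_one (hϖ : IsUniformizer ϖ) (x : RingInt K) (a : ℕ) :
    ‖(ϖ : K) ^ a * x‖ ≤ 1 :=
  (norm_pow_mul_le hϖ x a).trans (pow_le_one₀ hϖ.inv_pos.le hϖ.inv_lt_one.le)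

/-- The closed polydisc with center `c` and radii `q ^ (-a i)`. -/
def polyBox {ι : Type*} (c : ι → K) (a : ι → ℕ) : Set (ι → K) :=
  {x | ∀ i, ‖x i - c i‖ ≤ (resCard K : ℝ)⁻¹ ^ a i}

/-- The product of the spheres with center `0` and radii `q ^ (-a i)`. -/
def polySphere {ι : Type*} (a : ι → ℕ) : Set (ι → K) :=
  {x | ∀ i, ‖x i‖ = (resCard K : ℝ)⁻¹ ^ a i}

variable {ι : Type*}

theorem measurableSet_polyBox [Finite ι] [MeasurableSpace K] [BorelSpace K] (c : ι → K)
    (a : ι → ℕ) : MeasurableSet (polyBox c a) := by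
  have : polyBox c a = ⋂ i, (fun x : ι → K => x i) ⁻¹' Metric.closedBall (c i)
      ((resCard K : ℝ)⁻¹ ^ a i) := by
    ext x
    simp [polyBox, dist_eq_norm]
  rw [this]
  exact MeasurableSet.iInter fun i => measurable_pi_apply i measurableSet_closedBall

theorem measurableSet_polySphere [Countable ι] [MeasurableSpace K] [BorelSpace K] (a : ι → ℕ) :
    MeasurableSet (polySphere (K := K) a) := by
  simp only [polySphere, ofPred_forall]
  exact MeasurableSet.iInter fun i => (measurable_pi_apply i).norm (measurableSet_singleton _)

theorem polyBox_zero_eq_iUnion [DecidableEq ι] (hϖ : IsUniformizer ϖ) (a : ι → ℕ) (i : ι) :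
    polyBox (0 : ι → K) a = ⋃ r : ResField K,
      polyBox (Pi.single i ((ϖ : K) ^ a i * resLift r)) (a + Pi.single i 1) := by
  ext x
  simp only [mem_iUnion]
  constructor
  · intro hx
    have hi := hx i
    rw [Pi.zero_apply, sub_zero] at hi
    obtain ⟨y, hy⟩ := exists_eq_pow_mul hϖ hi
    refine ⟨IsLocalRing.residue (RingInt K) y, fun j => ?_⟩
    rcases eq_or_ne j i with rfl | hj
    · simp only [Pi.single_eq_same, Pi.add_apply, hy]
      exact (norm_sub_digit_le_iff hϖ).2 rfl
    · simpa [Pi.single_eq_of_ne hj] using hx j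
  · rintro ⟨r, hr⟩ j
    rcases eq_or_ne j i with rfl | hj
    · have := hr j
      simp only [Pi.single_eq_same, Pi.add_apply] at this
      rw [Pi.zero_apply, sub_zero, ← sub_add_cancel (x j) ((ϖ : K) ^ a j * resLift r)]
      refine (IsUltrametricDist.norm_add_le_max _ _).trans (max_le ?_ (norm_pow_mul_le hϖ _ _))
      exact this.trans (pow_le_pow_of_le_one hϖ.inv_pos.le hϖ.inv_lt_one.le (Nat.le_succ _))
    · simpa [Pi.single_eq_of_ne hj] using hr j

theorem polySphere_eq_iUnion (hϖ : IsUniformizer ϖ) (a : ι → ℕ) :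
    polySphere (K := K) a = ⋃ r : ι → {r : ResField K // r ≠ 0},
      polyBox (fun i => (ϖ : K) ^ a i * resLift (r i : ResField K)) (a + 1) := by
  ext x
  simp only [mem_iUnion]
  constructor
  · intro hx
    choose y hy using fun i => exists_eq_pow_mul hϖ (hx i).le
    refine ⟨fun i => ⟨IsLocalRing.residue (RingInt K) (y i), ?_⟩, fun i => ?_⟩
    · have := hx i
      rw [hy] at this
      exact (norm_pow_mul_eq_iff hϖ).1 this
    · rw [hy]
      exact (norm_sub_digit_le_iff hϖ).2 rfl
  · rintro ⟨r, hr⟩ i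
    have hlt := hr i
    rw [Pi.add_apply, Pi.one_apply, hϖ.norm_le_pow_succ_iff] at hlt
    have hnorm : ‖(ϖ : K) ^ a i * resLift (r i : ResField K)‖ = (resCard K : ℝ)⁻¹ ^ a i := by
      rw [norm_pow_mul_eq_iff hϖ, residue_resLift]
      exact (r i).2
    rw [← hnorm] at hlt ⊢
    rw [← sub_add_cancel (x i) ((ϖ : K) ^ a i * resLift (r i : ResField K)),
      IsUltrametricDist.norm_add_eq_max_of_norm_ne_norm hlt.ne, max_eq_right hlt.le]

theorem disjoint_polyBox {c c' : ι → K} {a : ι → ℕ} {i : ι}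
    (h : (resCard K : ℝ)⁻¹ ^ a i < ‖c i - c' i‖) : Disjoint (polyBox c a) (polyBox c' a) := by
  rw [Set.disjoint_left]
  intro x hx hx'
  refine h.not_ge ?_
  rw [← dist_eq_norm]
  refine (dist_triangle_max (c i) (x i) (c' i)).trans (max_le ?_ ?_)
  · rw [dist_comm, dist_eq_norm]
    exact hx i
  · rw [dist_eq_norm]
    exact hx' i

theorem lt_norm_digit_sub (hϖ : IsUniformizer ϖ) {r r' : ResField K} (h : r ≠ r') (a : ℕ) :
    (resCard K : ℝ)⁻¹ ^ (a + 1) < ‖(ϖ : K) ^ a * resLift r - (ϖ : K) ^ a * resLift r'‖ := by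
  rw [← not_le, norm_sub_digit_le_iff hϖ, residue_resLift]
  exact h

variable [MeasurableSpace K] {ν : Measure (ι → K)}

/-- A finite measure giving equal mass to the translates of every polydisc inside the unit
polydisc. Unlike invariance under translations, this passes to the images of Haar measure under
maps that are affine up to an isometry. -/
structure IsBoxInvariant (ν : Measure (ι → K)) : Prop where
  finite : IsFiniteMeasure ν
  eq : ∀ (c : ι → K) (a : ι → ℕ), (∀ i, ‖c i‖ ≤ 1) → ν.real (polyBox c a) = ν.real (polyBox 0 a)

namespace IsBoxInvariant

variable [BorelSpace K]

theorem measureReal_polyBox_add_single_one [Finite ι] [DecidableEq ι] (hν : IsBoxInvariant ν)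
    (hϖ : IsUniformizer ϖ) (a : ι → ℕ) (i : ι) :
    ν.real (polyBox 0 (a + Pi.single i 1)) = ν.real (polyBox 0 a) * (resCard K : ℝ)⁻¹ := by
  have := hν.finite
  have := hϖ.finite
  have := Fintype.ofFinite (ResField K)
  have hdigit (r : ResField K) (j : ι) :
      ‖(Pi.single i ((ϖ : K) ^ a i * resLift r) : ι → K) j‖ ≤ 1 := by
    rcases eq_or_ne j i with rfl | hj
    · rw [Pi.single_eq_same]
      exact norm_pow_mul_le_one hϖ _ _
    · simp [Pi.single_eq_of_ne hj]
  have hcard : (Nat.card (ResField K) : ℝ) ≠ 0 := by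
    exact_mod_cast (zero_lt_one.trans hϖ.one_lt).ne'
  rw [polyBox_zero_eq_iUnion hϖ a i, measureReal_iUnion_fintype
      (fun r r' hr => disjoint_polyBox (i := i) (by simpa using lt_norm_digit_sub hϖ hr (a i)))
      (fun r => measurableSet_polyBox _ _),
    Finset.sum_congr rfl fun r _ => hν.eq _ _ (hdigit r), Finset.sum_const, Finset.card_univ,
    ← Nat.card_eq_fintype_card, nsmul_eq_mul, resCard]
  field_simp

theorem measureReal_polyBox_add_single [Finite ι] [DecidableEq ι] (hν : IsBoxInvariant ν)
    (hϖ : IsUniformizer ϖ) (a : ι → ℕ) (i : ι) (k : ℕ) :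
    ν.real (polyBox 0 (a + Pi.single i k)) = ν.real (polyBox 0 a) * (resCard K : ℝ)⁻¹ ^ k := by
  induction k with
  | zero => simp
  | succ k ih =>
    rw [Pi.single_add, ← add_assoc, hν.measureReal_polyBox_add_single_one hϖ, ih, pow_succ,
      mul_assoc]

theorem measureReal_polyBox [Fintype ι] (hν : IsBoxInvariant ν) (hϖ : IsUniformizer ϖ) {c : ι → K}
    (hc : ∀ i, ‖c i‖ ≤ 1) (a : ι → ℕ) :
    ν.real (polyBox c a) = ν.real (polyBox 0 0) * ∏ i, (resCard K : ℝ)⁻¹ ^ a i := by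
  classical
  have hsum (s : Finset ι) : ν.real (polyBox 0 (∑ i ∈ s, Pi.single i (a i))) =
      ν.real (polyBox 0 0) * ∏ i ∈ s, (resCard K : ℝ)⁻¹ ^ a i := by
    induction s using Finset.induction_on with
    | empty => simp
    | insert i s hi ih =>
      rw [Finset.sum_insert hi, add_comm, hν.measureReal_polyBox_add_single hϖ, ih,
        Finset.prod_insert hi]
      ring
  rw [hν.eq c a hc, ← hsum, Finset.univ_sum_single]

theorem measureReal_polySphere [Fintype ι] (hν : IsBoxInvariant ν) (hϖ : IsUniformizer ϖ)
    (a : ι → ℕ) :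
    ν.real (polySphere a) = ν.real (polyBox 0 0) *
      ∏ i, (((resCard K : ℝ) - 1) * (resCard K : ℝ)⁻¹ ^ (a i + 1)) := by
  classical
  have := hν.finite
  have := hϖ.finite
  have := Fintype.ofFinite (ResField K)
  have hdisj : Pairwise (Function.onFun Disjoint fun r : ι → {r : ResField K // r ≠ 0} =>
      polyBox (fun i => (ϖ : K) ^ a i * resLift (r i : ResField K)) (a + 1)) := by
    intro r r' hr
    obtain ⟨i, hi⟩ := Function.ne_iff.1 hr
    exact disjoint_polyBox (i := i) (lt_norm_digit_sub hϖ (fun h => hi (Subtype.ext h)) _)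
  have hcard : Fintype.card {r : ResField K // r ≠ 0} = resCard K - 1 := by
    rw [Fintype.card_subtype_compl, Fintype.card_subtype_eq, resCard, Nat.card_eq_fintype_card]
  rw [polySphere_eq_iUnion hϖ,
    measureReal_iUnion_fintype hdisj fun r => measurableSet_polyBox _ _,
    Finset.sum_congr rfl fun r _ =>
      hν.measureReal_polyBox hϖ (fun i => norm_pow_mul_le_one hϖ _ _) _,
    Finset.sum_const, Finset.card_univ, Fintype.card_pi, nsmul_eq_mul]
  simp only [hcard, Finset.prod_mul_distrib, Pi.add_apply, Pi.one_apply]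
  rw [Nat.cast_prod, Nat.cast_sub hϖ.one_lt.le, Nat.cast_one]
  ring

end IsBoxInvariant

end LocalField

section Isometry

open Metric

theorem surjective_of_isometry {X : Type*} [MetricSpace X] [CompactSpace X] {Φ : X → X}
    (hΦ : Isometry Φ) : Function.Surjective Φ := by
  intro y
  by_contra hy
  have hopen : IsOpen (range Φ)ᶜ := (isCompact_range hΦ.continuous).isClosed.isOpen_compl
  obtain ⟨ε, hε, hball⟩ := Metric.isOpen_iff.1 hopen y hy
  have hfar (x : X) : ε ≤ Dist.dist (Φ x) y := not_lt.1 fun h => hball h (mem_range_self x)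
  have hiter (m : ℕ) : Isometry Φ^[m] := by
    induction m with
    | zero => exact isometry_id
    | succ m ih => exact ih.comp hΦ
  have hsep {m k : ℕ} (hmk : m < k) : ε ≤ Dist.dist (Φ^[k] y) (Φ^[m] y) := by
    obtain ⟨l, rfl⟩ := Nat.exists_eq_add_of_lt hmk
    rw [add_assoc, Function.iterate_add_apply, (hiter m).dist_eq, Function.iterate_succ_apply']
    exact hfar _
  obtain ⟨x, φ, hφ, hx⟩ := CompactSpace.tendsto_subseq fun k => Φ^[k] y
  obtain ⟨N, hN⟩ := Metric.cauchySeq_iff'.1 hx.cauchySeq ε hε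
  exact (hN (N + 1) N.le_succ).not_ge (hsep (hφ N.lt_succ_self))

variable {X : Type*}

theorem isTopologicalBasis_closedBall (X : Type*) [PseudoMetricSpace X] [IsUltrametricDist X] :
    TopologicalSpace.IsTopologicalBasis {s : Set X | ∃ x, ∃ r > 0, s = closedBall x r} := by
  refine TopologicalSpace.isTopologicalBasis_of_isOpen_of_nhds ?_ fun x s hx hs => ?_
  · rintro _ ⟨x, r, hr, rfl⟩
    exact IsUltrametricDist.isOpen_closedBall x hr.ne'
  · obtain ⟨r, hr, hrs⟩ := nhds_basis_closedBall.mem_iff.1 (hs.mem_nhds hx)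
    exact ⟨closedBall x r, ⟨x, r, hr, rfl⟩, mem_closedBall_self hr.le, hrs⟩

theorem isPiSystem_closedBall (X : Type*) [PseudoMetricSpace X] [IsUltrametricDist X] :
    IsPiSystem {s : Set X | ∃ x, ∃ r > 0, s = closedBall x r} := by
  rintro _ ⟨x, r, hr, rfl⟩ _ ⟨y, ρ, hρ, rfl⟩ hne
  rcases IsUltrametricDist.closedBall_subset_trichotomy x y r ρ with h | h | h
  · exact ⟨x, r, hr, inter_eq_left.2 h⟩
  · exact ⟨y, ρ, hρ, inter_eq_right.2 h⟩
  · exact absurd h (not_disjoint_iff_nonempty_inter.2 hne)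

theorem measurePreserving_of_isometry [MetricSpace X] [CompactSpace X] [IsUltrametricDist X]
    [MeasurableSpace X] [BorelSpace X] {μ : Measure X} [IsFiniteMeasure μ]
    (hμ : ∀ x y r, μ (closedBall x r) = μ (closedBall y r)) {Φ : X → X} (hΦ : Isometry Φ) :
    MeasurePreserving Φ μ μ := by
  have hmeas : Measurable Φ := hΦ.continuous.measurable
  refine ⟨hmeas, ext_of_generate_finite _ (BorelSpace.measurable_eq.trans
    (isTopologicalBasis_closedBall X).borel_eq_generateFrom) (isPiSystem_closedBall X) ?_ ?_⟩
  · rintro _ ⟨x, r, -, rfl⟩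
    obtain ⟨y, rfl⟩ := surjective_of_isometry hΦ x
    rw [Measure.map_apply hmeas measurableSet_closedBall, hΦ.preimage_closedBall, hμ]
  · rw [Measure.map_apply hmeas MeasurableSet.univ, preimage_univ]

variable {E : Type*} [NormedAddCommGroup E] [IsUltrametricDist E]

theorem comap_val_closedBall [MeasurableSpace E] [BorelSpace E] {μ : Measure E}
    [μ.IsAddLeftInvariant] {r : ℝ} (x : closedBall (0 : E) r) (ρ : ℝ) :
    μ.comap (Subtype.val : closedBall (0 : E) r → E) (closedBall x ρ) =
      μ (closedBall 0 (min r ρ)) := by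
  have hball : closedBall (0 : E) r ∩ closedBall (x : E) ρ = closedBall (x : E) (min r ρ) := by
    refine (congrArg (· ∩ _) (IsUltrametricDist.closedBall_eq_of_mem x.2)).trans ?_
    ext y
    simp
  have htrans : closedBall (0 : E) (min r ρ) =
      (fun y => (x : E) + y) ⁻¹' closedBall (x : E) (min r ρ) := by
    ext y
    simp
  rw [← Subtype.preimage_closedBall,
    (MeasurableEmbedding.subtype_coe measurableSet_closedBall).comap_apply,
    Subtype.image_preimage_coe, hball, htrans, measure_preimage_add]

theorem measure_closedBall_inter_preimage [ProperSpace E] [MeasurableSpace E] [BorelSpace E]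
    {μ : Measure E} [μ.IsAddLeftInvariant] [IsFiniteMeasureOnCompacts μ] {r : ℝ} {Φ : E → E}
    (hmaps : ∀ x, ‖x‖ ≤ r → ‖Φ x‖ ≤ r)
    (hiso : ∀ x y, ‖x‖ ≤ r → ‖y‖ ≤ r → ‖Φ x - Φ y‖ = ‖x - y‖) {S : Set E}
    (hS : MeasurableSet S) :
    μ (closedBall 0 r ∩ Φ ⁻¹' S) = μ (closedBall 0 r ∩ S) := by
  have : CompactSpace (closedBall (0 : E) r) :=
    isCompact_iff_compactSpace.1 (isCompact_closedBall 0 r)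
  have hcomap (T : Set E) : μ.comap (Subtype.val : closedBall (0 : E) r → E)
      (Subtype.val ⁻¹' T) = μ (closedBall 0 r ∩ T) := by
    rw [(MeasurableEmbedding.subtype_coe measurableSet_closedBall).comap_apply,
      Subtype.image_preimage_coe]
  have : IsFiniteMeasure (μ.comap (Subtype.val : closedBall (0 : E) r → E)) := ⟨by
    rw [← preimage_univ, hcomap, inter_univ]
    exact measure_closedBall_lt_top⟩
  let Ψ (x : closedBall (0 : E) r) : closedBall (0 : E) r :=
    ⟨Φ x, mem_closedBall_zero_iff.2 (hmaps x (mem_closedBall_zero_iff.1 x.2))⟩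
  have hΨ : Isometry Ψ := Isometry.of_dist_eq fun x y => by
    rw [Subtype.dist_eq, Subtype.dist_eq, dist_eq_norm, dist_eq_norm]
    exact hiso x y (mem_closedBall_zero_iff.1 x.2) (mem_closedBall_zero_iff.1 y.2)
  have hpres := measurePreserving_of_isometry (μ := μ.comap Subtype.val)
    (fun x y ρ => (comap_val_closedBall x ρ).trans (comap_val_closedBall y ρ).symm) hΨ
  rw [← hcomap, ← hcomap,
    ← hpres.measure_preimage (hS.preimage measurable_subtype_coe).nullMeasurableSet]
  rfl

theorem norm_add_sub_add_eq_of_contracting {g : E → E} {ρ : ℝ} (hρ : ρ < 1) {x y : E}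
    (h : ‖g x - g y‖ ≤ ρ * ‖x - y‖) : ‖x + g x - (y + g y)‖ = ‖x - y‖ := by
  rcases eq_or_ne x y with rfl | hxy
  · simp
  have hlt : ‖g x - g y‖ < ‖x - y‖ :=
    h.trans_lt (mul_lt_of_lt_one_left (norm_pos_iff.2 (sub_ne_zero.2 hxy)) hρ)
  rw [add_sub_add_comm, IsUltrametricDist.norm_add_eq_max_of_norm_ne_norm hlt.ne',
    max_eq_left hlt.le]

end Isometry

section Taylor

open MvPolynomial

theorem norm_sub_le_of_ultrametric {E : Type*} [SeminormedAddCommGroup E] [IsUltrametricDist E]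
    {x y : E} {C : ℝ} (hx : ‖x‖ ≤ C) (hy : ‖y‖ ≤ C) : ‖x - y‖ ≤ C := by
  rw [sub_eq_add_neg]
  exact (IsUltrametricDist.norm_add_le_max _ _).trans (max_le hx ((norm_neg y).trans_le hy))

theorem norm_add_le_of_ultrametric {E : Type*} [SeminormedAddCommGroup E] [IsUltrametricDist E]
    {x y : E} {C : ℝ} (hx : ‖x‖ ≤ C) (hy : ‖y‖ ≤ C) : ‖x + y‖ ≤ C :=
  (IsUltrametricDist.norm_add_le_max _ _).trans (max_le hx hy)

theorem sum_aeval_pderiv_mul_X {σ R A : Type*} [Fintype σ] [CommRing R] [CommRing A] [Algebra R A]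
    (p : MvPolynomial σ R) (i : σ) (z w : σ → A) :
    ∑ j, aeval z (pderiv j (p * X i)) * w j =
      z i * ∑ j, aeval z (pderiv j p) * w j + aeval z p * w i := by
  classical
  simp only [Derivation.leibniz, pderiv_X, smul_eq_mul, map_add, map_mul, aeval_X, add_mul,
    Finset.sum_add_distrib, Finset.mul_sum]
  rw [add_comm]
  congr 1
  · exact Finset.sum_congr rfl fun j _ => by ring
  · rw [Finset.sum_eq_single i (fun j _ hj => by simp [Pi.single_eq_of_ne' hj]) (by simp)]
    simp

variable {K : Type*} [NontriviallyNormedField K] [IsUltrametricDist K] {σ : Type*}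

theorem norm_aeval_le (h : MvPolynomial σ (RingInt K)) {x : σ → K} (hx : ∀ j, ‖x j‖ ≤ 1) :
    ‖aeval x h‖ ≤ 1 := by
  have : x = algebraMap (RingInt K) K ∘ fun j => ⟨x j, mem_ringInt.2 (hx j)⟩ := rfl
  rw [this, aeval_algebraMap_apply]
  exact norm_ringInt_le _

variable [Fintype σ]

theorem norm_sum_mul_le {x : σ → K} (hx : ∀ j, ‖x j‖ ≤ 1) (y : σ → K) :
    ‖∑ j, x j * y j‖ ≤ ‖y‖ := by
  refine IsUltrametricDist.norm_sum_le_of_forall_le_of_nonneg (norm_nonneg y) fun j _ => ?_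
  rw [norm_mul]
  exact (mul_le_of_le_one_left (norm_nonneg _) (hx j)).trans (norm_le_pi_norm y j)

theorem norm_aeval_sub_aeval_le (h : MvPolynomial σ (RingInt K)) {u v : σ → K} (hu : ‖u‖ ≤ 1)
    (hv : ‖v‖ ≤ 1) : ‖aeval u h - aeval v h‖ ≤ ‖u - v‖ := by
  induction h using MvPolynomial.induction_on with
  | C a => simp
  | add p p' hp hp' =>
    rw [map_add, map_add, add_sub_add_comm]
    exact norm_add_le_of_ultrametric hp hp'
  | mul_X p i hp =>
    have hprod : aeval u (p * X i) - aeval v (p * X i) =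
        u i * (aeval u p - aeval v p) + aeval v p * (u - v) i := by
      simp only [map_mul, aeval_X, Pi.sub_apply]
      ring
    rw [hprod]
    refine norm_add_le_of_ultrametric ?_ ?_ <;> rw [norm_mul]
    · exact (mul_le_of_le_one_left (norm_nonneg _) ((norm_le_pi_norm u i).trans hu)).trans hp
    · exact (mul_le_of_le_one_left (norm_nonneg _)
        (norm_aeval_le p fun j => (norm_le_pi_norm v j).trans hv)).trans (norm_le_pi_norm _ i)

theorem norm_aeval_sub_sub_sum_pderiv_le (h : MvPolynomial σ (RingInt K)) {u v z : σ → K} {r : ℝ}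
    (hu : ‖u‖ ≤ 1) (hv : ‖v‖ ≤ 1) (hz : ‖z‖ ≤ 1) (huz : ‖u - z‖ ≤ r) (hvz : ‖v - z‖ ≤ r) :
    ‖aeval u h - aeval v h - ∑ j, aeval z (pderiv j h) * (u - v) j‖ ≤ r * ‖u - v‖ := by
  have hr : 0 ≤ r := (norm_nonneg _).trans huz
  induction h using MvPolynomial.induction_on with
  | C a => simpa using mul_nonneg hr (norm_nonneg _)
  | add p p' hp hp' =>
    simp only [map_add, add_mul, Finset.sum_add_distrib]
    rw [add_sub_add_comm, add_sub_add_comm]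
    exact norm_add_le_of_ultrametric hp hp'
  | mul_X p i hp =>
    have hdecomp : aeval u (p * X i) - aeval v (p * X i) -
        ∑ j, aeval z (pderiv j (p * X i)) * (u - v) j =
      u i * (aeval u p - aeval v p - ∑ j, aeval z (pderiv j p) * (u - v) j) +
        ((u - z) i * ∑ j, aeval z (pderiv j p) * (u - v) j +
          (aeval v p - aeval z p) * (u - v) i) := by
      rw [sum_aeval_pderiv_mul_X]
      simp only [map_mul, aeval_X, Pi.sub_apply]
      ring
    rw [hdecomp]
    refine norm_add_le_of_ultrametric ?_ (norm_add_le_of_ultrametric ?_ ?_) <;> rw [norm_mul]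
    · exact (mul_le_of_le_one_left (norm_nonneg _) ((norm_le_pi_norm u i).trans hu)).trans hp
    · exact mul_le_mul ((norm_le_pi_norm _ i).trans huz)
        (norm_sum_mul_le (fun j => norm_aeval_le _ fun k => (norm_le_pi_norm z k).trans hz) _)
        (norm_nonneg _) hr
    · exact mul_le_mul ((norm_aeval_sub_aeval_le p hv hz).trans hvz) (norm_le_pi_norm _ i)
        (norm_nonneg _) hr

end Taylor

section LocalField

variable {K : Type*} [NontriviallyNormedField K] [IsUltrametricDist K] {n : ℕ}

theorem aeval_coe_eq (h : MvPolynomial (Fin n) (RingInt K)) (z : Fin n → RingInt K) :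
    MvPolynomial.aeval (fun j => (z j : K)) h = (MvPolynomial.eval z h : RingInt K) :=
  MvPolynomial.aeval_algebraMap_apply K z h

theorem residue_eval (h : MvPolynomial (Fin n) (RingInt K)) (z : Fin n → RingInt K) :
    IsLocalRing.residue (RingInt K) (MvPolynomial.eval z h) =
      MvPolynomial.eval (fun j => IsLocalRing.residue (RingInt K) (z j)) (reduction h) := by
  rw [reduction, MvPolynomial.eval_map, MvPolynomial.eval₂_eq_eval_map, MvPolynomial.eval_map]
  exact MvPolynomial.eval₂_comp_left (IsLocalRing.residue (RingInt K)) (RingHom.id _) z h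

section Haar

theorem polyBox_one_eq_closedBall {σ : Type*} [Fintype σ] (c : σ → K) :
    polyBox c 1 = Metric.closedBall c (resCard K : ℝ)⁻¹ := by
  ext x
  simp [polyBox, Metric.mem_closedBall, dist_eq_norm, pi_norm_le_iff_of_nonneg]

theorem polyBox_subset_closedBall {σ : Type*} [Fintype σ] (c : σ → K) (a : σ → ℕ) :
    polyBox c a ⊆ Metric.closedBall c 1 := fun x hx => by
  rw [Metric.mem_closedBall, dist_eq_norm, pi_norm_le_iff_of_nonneg zero_le_one]
  exact fun i => (hx i).trans (pow_le_one₀ (by positivity) (Nat.cast_inv_le_one _))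

theorem polyBox_subset_polyBox_zero_zero {σ : Type*} {c : σ → K} (hc : ∀ i, ‖c i‖ ≤ 1)
    (a : σ → ℕ) : polyBox c a ⊆ polyBox 0 0 := fun x hx i => by
  have hi : ‖x i - c i‖ ≤ 1 := (hx i).trans (pow_le_one₀ (by positivity) (Nat.cast_inv_le_one _))
  simpa using norm_add_le_of_ultrametric hi (hc i)

variable [MeasurableSpace K]

theorem measure_polyBox_lt_top [ProperSpace K] {σ : Type*} [Finite σ] {μ : Measure (σ → K)}
    [IsFiniteMeasureOnCompacts μ] (c : σ → K) (a : σ → ℕ) : μ (polyBox c a) < ⊤ := by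
  have := Fintype.ofFinite σ
  exact (measure_mono (polyBox_subset_closedBall c a)).trans_lt measure_closedBall_lt_top

variable [BorelSpace K]

theorem measure_polyBox_eq {σ : Type*} {μ : Measure (σ → K)} [μ.IsAddLeftInvariant] (c : σ → K)
    (a : σ → ℕ) : μ (polyBox c a) = μ (polyBox 0 a) := by
  have htrans : (fun x => c + x) ⁻¹' polyBox c a = polyBox 0 a := by
    ext x
    simp [polyBox]
  rw [← htrans, measure_preimage_add]

variable [ProperSpace K]

theorem isBoxInvariant_restrict {σ : Type*} [Finite σ] {μ : Measure (σ → K)}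
    [IsFiniteMeasureOnCompacts μ] [μ.IsAddLeftInvariant] :
    IsBoxInvariant (μ.restrict (polyBox 0 0)) where
  finite := isFiniteMeasure_restrict.2 (measure_polyBox_lt_top _ _).ne
  eq c a hc := by
    rw [measureReal_restrict_apply (measurableSet_polyBox _ _),
      measureReal_restrict_apply (measurableSet_polyBox _ _),
      inter_eq_left.2 (polyBox_subset_polyBox_zero_zero hc a),
      inter_eq_left.2 (polyBox_subset_polyBox_zero_zero (by simp) a), measureReal_def,
      measureReal_def, measure_polyBox_eq]

theorem measurable_aeval {σ : Type*} [Countable σ] (F : MvPolynomial σ (RingInt K)) :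
    Measurable fun u : σ → K => MvPolynomial.aeval u F := by
  have : Continuous fun u : σ → K => MvPolynomial.aeval u F := by
    simp only [MvPolynomial.aeval_def, MvPolynomial.eval₂_eq_eval_map]
    exact MvPolynomial.continuous_eval _
  exact this.measurable

variable {σ : Type*} [Fintype σ] {μ : Measure (σ → K)} [μ.IsAddHaarMeasure]

theorem haar_real_polyBox {ϖ : RingInt K} (hϖ : IsUniformizer ϖ)
    (hμ : μ {x | ∀ j, ‖x j‖ ≤ 1} = 1) (c : σ → K) (a : σ → ℕ) :
    μ.real (polyBox c a) = ∏ i, (resCard K : ℝ)⁻¹ ^ a i := by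
  have hunit : μ.real (polyBox 0 0) = 1 := by
    have : polyBox (0 : σ → K) 0 = {x | ∀ j, ‖x j‖ ≤ 1} := by simp [polyBox]
    rw [this, measureReal_def, hμ, ENNReal.toReal_one]
  have hbox := isBoxInvariant_restrict (μ := μ).measureReal_polyBox hϖ (c := 0) (by simp) a
  rw [measureReal_restrict_apply (measurableSet_polyBox _ _),
    measureReal_restrict_apply (measurableSet_polyBox _ _), inter_self, hunit, one_mul,
    inter_eq_left.2 (polyBox_subset_polyBox_zero_zero (by simp) a)] at hbox
  rw [← hbox, measureReal_def, measureReal_def, measure_polyBox_eq]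

end Haar

section Submersion

variable {ι : Type*} [Fintype ι]

theorem exists_rightInverse_of_residue_rank [DecidableEq ι] (A : Matrix ι (Fin n) (RingInt K))
    (hA : (A.map (IsLocalRing.residue (RingInt K))).rank = Fintype.card ι) :
    ∃ B : Matrix (Fin n) ι (RingInt K), A * B = 1 := by
  have hrange : LinearMap.range (A.map (IsLocalRing.residue (RingInt K))).mulVecLin = ⊤ :=
    Submodule.eq_top_of_finrank_eq (by rwa [Module.finrank_fintype_fun_eq_card])
  obtain ⟨B, hB⟩ := Matrix.mulVec_surjective_iff_exists_right_inverse.1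
    (LinearMap.range_eq_top.1 hrange)
  have hlift : (B.map resLift).map (IsLocalRing.residue (RingInt K)) = B := by
    ext i j
    simp [residue_resLift]
  have hdet : IsLocalRing.residue (RingInt K) (A * B.map resLift).det = 1 := by
    rw [RingHom.map_det, RingHom.mapMatrix_apply, Matrix.map_mul, hlift, hB, Matrix.det_one]
  have hunit : IsUnit (A * B.map resLift).det :=
    isUnit_of_map_unit (IsLocalRing.residue (RingInt K)) _ (hdet ▸ isUnit_one)
  exact ⟨B.map resLift * (A * B.map resLift)⁻¹, by
    rw [← Matrix.mul_assoc, Matrix.mul_nonsing_inv _ hunit]⟩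

theorem norm_integral_mulVec_le {κ : Type*} [Fintype κ] (A : Matrix ι κ (RingInt K)) (x : κ → K) :
    ‖(A.map (algebraMap (RingInt K) K)).mulVec x‖ ≤ ‖x‖ :=
  (pi_norm_le_iff_of_nonneg (norm_nonneg x)).2 fun i =>
    norm_sum_mul_le (fun j => norm_ringInt_le (A i j)) x

theorem norm_aeval_sub_sub_jacobian_mulVec_le (F : ι → MvPolynomial (Fin n) (RingInt K))
    (z : Fin n → RingInt K) {ρ : ℝ} (hρ1 : ρ ≤ 1) {x y : Fin n → K} (hx : ‖x‖ ≤ ρ) (hy : ‖y‖ ≤ ρ) :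
    ‖(fun i => MvPolynomial.aeval ((fun j => (z j : K)) + x) (F i)) -
        (fun i => MvPolynomial.aeval ((fun j => (z j : K)) + y) (F i)) -
      ((Matrix.of fun i j => MvPolynomial.eval z (MvPolynomial.pderiv j (F i))).map
        (algebraMap (RingInt K) K)).mulVec (x - y)‖ ≤ ρ * ‖x - y‖ := by
  have hz : ‖fun j => (z j : K)‖ ≤ 1 :=
    (pi_norm_le_iff_of_nonneg zero_le_one).2 fun j => norm_ringInt_le (z j)
  have hρ : 0 ≤ ρ * ‖x - y‖ := mul_nonneg ((norm_nonneg x).trans hx) (norm_nonneg _)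
  refine (pi_norm_le_iff_of_nonneg hρ).2 fun i => ?_
  have htaylor := norm_aeval_sub_sub_sum_pderiv_le (F i) (r := ρ)
    (norm_add_le_of_ultrametric hz (hx.trans hρ1)) (norm_add_le_of_ultrametric hz (hy.trans hρ1))
    hz (by simpa) (by simpa)
  simp only [aeval_coe_eq, add_sub_add_left_eq_sub] at htaylor
  exact htaylor

variable [MeasurableSpace K] [BorelSpace K] {μ : Measure (Fin n → K)} [μ.IsAddHaarMeasure]

theorem measure_closedBall_inter_mulVec_preimage_eq [DecidableEq ι]
    {A : Matrix ι (Fin n) (RingInt K)} {B : Matrix (Fin n) ι (RingInt K)} (hAB : A * B = 1) {ρ : ℝ}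
    {c : ι → K} (hc : ‖c‖ ≤ ρ) (T : Set (ι → K)) :
    μ (Metric.closedBall 0 ρ ∩
        (A.map (algebraMap (RingInt K) K)).mulVec ⁻¹' ((fun y => y - c) ⁻¹' T)) =
      μ (Metric.closedBall 0 ρ ∩ (A.map (algebraMap (RingInt K) K)).mulVec ⁻¹' T) := by
  set A' := A.map (algebraMap (RingInt K) K) with hA'
  set B' := B.map (algebraMap (RingInt K) K) with hB'
  have hAB' : A' * B' = 1 := by
    rw [hA', hB', ← Matrix.map_mul, hAB, Matrix.map_one _ (map_zero _) (map_one _)]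
  have hBc : ‖B'.mulVec c‖ ≤ ρ := (norm_integral_mulVec_le B c).trans hc
  rw [← measure_preimage_add μ (B'.mulVec c)]
  congr 1
  ext x
  refine and_congr ?_ ?_
  · rw [mem_closedBall_zero_iff, mem_closedBall_zero_iff]
    refine ⟨fun h => ?_, norm_add_le_of_ultrametric hBc⟩
    simpa using norm_sub_le_of_ultrametric h hBc
  · simp only [mem_preimage, Matrix.mulVec_add, Matrix.mulVec_mulVec, hAB', Matrix.one_mulVec,
      add_sub_cancel_left]

variable [ProperSpace K]

-- With `A * B = 1`, the map `x ↦ x + B (L x - A x)` is an isometry of the ball, and `A` composed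
-- with it is `L`.
open Metric in
theorem measure_closedBall_inter_preimage_mulVec [DecidableEq ι] {A : Matrix ι (Fin n) (RingInt K)}
    {B : Matrix (Fin n) ι (RingInt K)} (hAB : A * B = 1) {ρ : ℝ} (hρ : 0 ≤ ρ) (hρ1 : ρ < 1)
    {L : (Fin n → K) → ι → K} (hL0 : ‖L 0‖ ≤ ρ)
    (hL : ∀ x y, ‖x‖ ≤ ρ → ‖y‖ ≤ ρ →
      ‖L x - L y - (A.map (algebraMap (RingInt K) K)).mulVec (x - y)‖ ≤ ρ * ‖x - y‖)
    {T : Set (ι → K)} (hT : MeasurableSet T) :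
    μ (closedBall 0 ρ ∩ L ⁻¹' T) =
      μ (closedBall 0 ρ ∩ (A.map (algebraMap (RingInt K) K)).mulVec ⁻¹' T) := by
  set A' := A.map (algebraMap (RingInt K) K) with hA'
  set B' := B.map (algebraMap (RingInt K) K) with hB'
  have hAB' : A' * B' = 1 := by
    rw [hA', hB', ← Matrix.map_mul, hAB, Matrix.map_one _ (map_zero _) (map_one _)]
  let g (x : Fin n → K) : Fin n → K := B'.mulVec (L x - A'.mulVec x)
  have hfactor : L = A'.mulVec ∘ fun x => x + g x := by
    ext1 x
    simp only [g, Function.comp_apply]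
    rw [Matrix.mulVec_add, Matrix.mulVec_mulVec, hAB', Matrix.one_mulVec]
    abel
  have hg (x y : Fin n → K) (hx : ‖x‖ ≤ ρ) (hy : ‖y‖ ≤ ρ) : ‖g x - g y‖ ≤ ρ * ‖x - y‖ := by
    refine le_trans ?_ (hL x y hx hy)
    rw [← Matrix.mulVec_sub, sub_sub_sub_comm, ← Matrix.mulVec_sub]
    exact norm_integral_mulVec_le B _
  have hg0 : ‖g 0‖ ≤ ρ := by
    simp only [g, Matrix.mulVec_zero, sub_zero]
    exact (norm_integral_mulVec_le B _).trans hL0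
  have hmaps (x : Fin n → K) (hx : ‖x‖ ≤ ρ) : ‖x + g x‖ ≤ ρ := by
    have hgx := hg x 0 hx (by simpa using hρ)
    rw [sub_zero] at hgx
    refine norm_add_le_of_ultrametric hx ?_
    rw [← sub_add_cancel (g x) (g 0)]
    exact norm_add_le_of_ultrametric
      (hgx.trans ((mul_le_of_le_one_right hρ (hx.trans hρ1.le)))) hg0
  have hA'm : Measurable A'.mulVec := (Continuous.matrix_mulVec continuous_const
    continuous_id).measurable
  rw [hfactor, preimage_comp]
  exact measure_closedBall_inter_preimage hmaps
    (fun x y hx hy => norm_add_sub_add_eq_of_contracting hρ1 (hg x y hx hy)) (hA'm hT)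

theorem map_restrict_polyBox_apply {ι : Type*} [Finite ι] {ϖ : RingInt K} (hϖ : IsUniformizer ϖ)
    (F : ι → MvPolynomial (Fin n) (RingInt K)) (z : Fin n → K) (c : ι → K) (a : ι → ℕ) :
    ((μ.restrict (polyBox z 1)).map fun u i => (ϖ : K)⁻¹ * MvPolynomial.aeval u (F i))
        (polyBox c a) =
      μ (Metric.closedBall 0 (resCard K : ℝ)⁻¹ ∩
        (fun x i => MvPolynomial.aeval (z + x) (F i)) ⁻¹' polyBox ((ϖ : K) • c) (a + 1)) := by
  have hmeas : Measurable fun (u : Fin n → K) (i : ι) => (ϖ : K)⁻¹ * MvPolynomial.aeval u (F i) :=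
    measurable_pi_lambda _ fun i => (measurable_aeval (F i)).const_mul _
  rw [Measure.map_apply hmeas (measurableSet_polyBox _ _),
    Measure.restrict_apply (hmeas (measurableSet_polyBox _ _)), ← measure_preimage_add μ z,
    polyBox_one_eq_closedBall]
  congr 1
  ext x
  rw [mem_preimage, mem_inter_iff, and_comm]
  refine and_congr (by simp) (forall_congr' fun i => ?_)
  have hscale : MvPolynomial.aeval (z + x) (F i) - ((ϖ : K) • c) i =
      ϖ * ((ϖ : K)⁻¹ * MvPolynomial.aeval (z + x) (F i) - c i) := by
    have := hϖ.ne_zero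
    rw [Pi.smul_apply, smul_eq_mul]
    field_simp
  rw [hscale, norm_mul, hϖ.norm_eq, Pi.add_apply, Pi.one_apply, pow_succ',
    mul_le_mul_iff_right₀ hϖ.inv_pos]

theorem isBoxInvariant_map_of_rank {ϖ : RingInt K} (hϖ : IsUniformizer ϖ)
    (F : ι → MvPolynomial (Fin n) (RingInt K)) (z : Fin n → RingInt K)
    (hF : ∀ i, IsLocalRing.residue (RingInt K) (MvPolynomial.eval z (F i)) = 0)
    (hrank : (Matrix.of fun (i : ι) (j : Fin n) => IsLocalRing.residue (RingInt K)
      (MvPolynomial.eval z (MvPolynomial.pderiv j (F i)))).rank = Fintype.card ι) :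
    IsBoxInvariant ((μ.restrict (polyBox (fun j => (z j : K)) 1)).map
      fun u i => (ϖ : K)⁻¹ * MvPolynomial.aeval u (F i)) := by
  classical
  have := isFiniteMeasure_restrict.2 (measure_polyBox_lt_top (μ := μ) (fun j => (z j : K)) 1).ne
  obtain ⟨B, hAB⟩ := exists_rightInverse_of_residue_rank
    (Matrix.of fun i j => MvPolynomial.eval z (MvPolynomial.pderiv j (F i))) hrank
  have hF0 : ‖fun i => MvPolynomial.aeval ((fun j => (z j : K)) + 0) (F i)‖ ≤ (resCard K : ℝ)⁻¹ :=
    (pi_norm_le_iff_of_nonneg hϖ.inv_pos.le).2 fun i => by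
      rw [add_zero, aeval_coe_eq]
      exact hϖ.norm_lt_one_iff.1 (residue_eq_zero_iff.1 (hF i))
  have hlinear (c : ι → K) (a : ι → ℕ) :=
    (map_restrict_polyBox_apply (μ := μ) hϖ F (fun j => (z j : K)) c a).trans <|
      measure_closedBall_inter_preimage_mulVec hAB hϖ.inv_pos.le hϖ.inv_lt_one hF0
        (fun x y hx hy => norm_aeval_sub_sub_jacobian_mulVec_le F z hϖ.inv_lt_one.le hx hy)
        (measurableSet_polyBox _ _)
  refine ⟨inferInstance, fun c a hc => ?_⟩
  have hϖc : ‖(ϖ : K) • c‖ ≤ (resCard K : ℝ)⁻¹ := by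
    rw [norm_smul, hϖ.norm_eq]
    exact mul_le_of_le_one_right hϖ.inv_pos.le ((pi_norm_le_iff_of_nonneg zero_le_one).2 hc)
  have htrans : (fun y => y - (ϖ : K) • c) ⁻¹' polyBox 0 (a + 1) =
      polyBox ((ϖ : K) • c) (a + 1) := by
    ext y
    simp [polyBox]
  rw [measureReal_def, measureReal_def, hlinear, hlinear, smul_zero, ← htrans,
    measure_closedBall_inter_mulVec_preimage_eq hAB hϖc]

end Submersion

variable {r : ℕ} {ϖ : RingInt K}

section Rescaling

/-- `F` and `d` describe the polynomial `f(ϖ ^ k x)` as `ϖ ^ d F(x)`, where `d = d(k, Γ(f))` and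
`F` reduces to the reduction of the face function `f_k`. -/
structure IsRescaling (ϖ : RingInt K) (f : MvPolynomial (Fin n) (RingInt K)) (k : Fin n → ℕ)
    (F : MvPolynomial (Fin n) (RingInt K)) (d : ℕ) : Prop where
  dist_eq : dist (toReal k) (newtonPolyhedron f) = d
  aeval_eq : ∀ u : Fin n → K, MvPolynomial.aeval (fun j => (ϖ : K) ^ k j * u j) f =
    (ϖ : K) ^ d * MvPolynomial.aeval u F
  reduction_eq : reduction F = reduction (faceFun f (toReal k))

theorem toReal_dotProduct_toReal (k m : Fin n → ℕ) : toReal k ⬝ᵥ toReal m = (k ⬝ᵥ m : ℕ) := by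
  simp [dotProduct, toReal]

theorem aeval_pow_mul (f : MvPolynomial (Fin n) (RingInt K)) (k : Fin n → ℕ) (u : Fin n → K) :
    MvPolynomial.aeval (fun j => (ϖ : K) ^ k j * u j) f =
      ∑ m ∈ f.support,
        (f.coeff m : RingInt K) * ((ϖ : K) ^ (k ⬝ᵥ m) * ∏ j, u j ^ m j) := by
  rw [MvPolynomial.aeval_def, MvPolynomial.eval₂_eq']
  simp only [mul_pow, ← pow_mul, Finset.prod_mul_distrib, Finset.prod_pow_eq_pow_sum]
  rfl

theorem exists_isRescaling (hϖ : IsUniformizer ϖ) {f : MvPolynomial (Fin n) (RingInt K)}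
    (hf : f ≠ 0) (k : Fin n → ℕ) : ∃ F d, IsRescaling ϖ f k F d := by
  classical
  obtain ⟨d, hd⟩ := exists_dist_toReal_eq_natCast hf k
  have hle (m : Fin n →₀ ℕ) (hm : m ∈ f.support) : d ≤ k ⬝ᵥ m := by
    have := dist_le_dotProduct (toReal_nonneg k) hm
    rw [hd, toReal_dotProduct_toReal] at this
    exact_mod_cast this
  refine ⟨∑ m ∈ f.support, MvPolynomial.monomial m (f.coeff m * ϖ ^ (k ⬝ᵥ m - d)), d, hd,
    fun u => ?_, ?_⟩
  · rw [aeval_pow_mul, map_sum, Finset.mul_sum]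
    refine Finset.sum_congr rfl fun m hm => ?_
    rw [MvPolynomial.aeval_monomial, Finsupp.prod_fintype _ _ fun _ => pow_zero _, map_mul,
      map_pow, ← Nat.add_sub_of_le (hle m hm), pow_add, Nat.add_sub_cancel_left]
    change ((f.coeff m : RingInt K) : K) * (_ * (ϖ : K) ^ _ * _) =
      _ * (((f.coeff m : RingInt K) : K) * (ϖ : K) ^ _ * _)
    ring
  · have hres : IsLocalRing.residue (RingInt K) ϖ = 0 := by
      rw [residue_eq_zero_iff, hϖ.norm_eq]
      exact hϖ.inv_lt_one
    ext m
    rw [reduction, reduction, MvPolynomial.coeff_map, MvPolynomial.coeff_map, coeff_faceFun,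
      MvPolynomial.coeff_sum]
    simp only [MvPolynomial.coeff_monomial, Finset.sum_ite_eq']
    by_cases hm : m ∈ f.support
    · rw [if_pos hm, hd, toReal_dotProduct_toReal, map_mul, map_pow, hres]
      simp only [Nat.cast_inj]
      rcases (hle m hm).eq_or_lt with heq | hlt
      · rw [if_pos heq.symm, ← heq, Nat.sub_self, pow_zero, mul_one]
      · rw [if_neg hlt.ne', zero_pow (Nat.sub_pos_of_lt hlt).ne', mul_zero, map_zero]
    · rw [if_neg hm, MvPolynomial.notMem_support_iff.1 hm, ite_self]

variable {σ : Type*}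

/-- Multiplication of the `j`-th coordinate by `ϖ ^ (-k j)`: this carries the points whose
coordinates have norms `q ^ (-k j)` to the torus of units. -/
def unscale (ϖ : K) (k : σ → ℕ) (x : σ → K) : σ → K := fun j => (ϖ ^ k j)⁻¹ * x j

theorem pow_mul_unscale (hϖ : IsUniformizer ϖ) (k : σ → ℕ) (x : σ → K) :
    (fun j => (ϖ : K) ^ k j * unscale (ϖ : K) k x j) = x :=
  funext fun j => mul_inv_cancel_left₀ (pow_ne_zero (k j) hϖ.ne_zero) (x j)

theorem preimage_unscale_polyBox (hϖ : IsUniformizer ϖ) (k : σ → ℕ) :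
    unscale (ϖ : K) k ⁻¹' polyBox 0 0 = polyBox 0 k := by
  ext x
  refine forall_congr' fun j => ?_
  have := pow_pos hϖ.inv_pos (k j)
  simp only [unscale, Pi.zero_apply, sub_zero, pow_zero]
  rw [norm_mul, norm_inv, norm_pow, hϖ.norm_eq, inv_mul_le_iff₀ this, mul_one]

theorem haar_real_preimage_unscale [Fintype σ] [ProperSpace K] [MeasurableSpace K] [BorelSpace K]
    {μ : Measure (σ → K)} [μ.IsAddHaarMeasure] (hϖ : IsUniformizer ϖ)
    (hμ : μ {x | ∀ j, ‖x j‖ ≤ 1} = 1) (k : σ → ℕ) {Y : Set (σ → K)} (hY : MeasurableSet Y) :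
    μ.real (unscale (ϖ : K) k ⁻¹' Y) = (∏ j, (resCard K : ℝ)⁻¹ ^ k j) * μ.real Y := by
  let e : (σ → K) ≃L[K] (σ → K) := ContinuousLinearEquiv.piCongrRight fun j =>
    ContinuousLinearEquiv.unitsEquivAut K (Units.mk0 ((ϖ : K) ^ k j) (pow_ne_zero _ hϖ.ne_zero))⁻¹
  have he : (e : (σ → K) → σ → K) = unscale (ϖ : K) k := by
    ext x j
    simp [e, unscale, mul_comm]
  have := e.isAddHaarMeasure_map μ
  obtain ⟨c, hc⟩ : ∃ c : NNReal, μ.map e = c • μ := ⟨_, Measure.isAddLeftInvariant_eq_smul _ μ⟩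
  have hscale (Y : Set (σ → K)) (hY : MeasurableSet Y) :
      μ.real (unscale (ϖ : K) k ⁻¹' Y) = c * μ.real Y := by
    rw [← he, ← map_measureReal_apply e.continuous.measurable hY, hc, measureReal_nnreal_smul_apply]
  have hunit := hscale (polyBox 0 0) (measurableSet_polyBox _ _)
  rw [preimage_unscale_polyBox hϖ, haar_real_polyBox hϖ hμ, haar_real_polyBox hϖ hμ] at hunit
  rw [hscale Y hY, hunit]
  simp

end Rescaling

section LevelSet

/-- The proportion of a residue class on which a polynomial has norm `q ^ (-a)`, according to
whether its reduction vanishes there (and then is a submersion) or not. -/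
def levelWeight (K : Type*) [NontriviallyNormedField K] [IsUltrametricDist K] (p : Prop)
    (a : ℕ) : ℝ :=
  open scoped Classical in
  if p then (if a = 0 then 0 else ((resCard K : ℝ) - 1) * (resCard K : ℝ)⁻¹ ^ a)
  else (if a = 0 then 1 else 0)

theorem levelWeight_of_pos {p : Prop} {a : ℕ} (hp : p) (ha : a ≠ 0) :
    levelWeight K p a = ((resCard K : ℝ) - 1) * (resCard K : ℝ)⁻¹ ^ a := by
  rw [levelWeight, if_pos hp, if_neg ha]

theorem levelWeight_of_neg {p : Prop} (hp : ¬p) : levelWeight K p 0 = 1 := by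
  rw [levelWeight, if_neg hp, if_pos rfl]

theorem levelWeight_eq_zero {p : Prop} {a : ℕ} (hpa : ¬(p ↔ a ≠ 0)) : levelWeight K p a = 0 := by
  rw [levelWeight]
  split_ifs <;> simp_all

/-- The part of the residue class of `z` on which the `F i` have norm `q ^ (-a i)`. -/
def levelSet (F : Fin r → MvPolynomial (Fin n) (RingInt K)) (z : Fin n → ResField K)
    (a : Fin r → ℕ) : Set (Fin n → K) :=
  {u | u ∈ polyBox (fun j => (resLift (z j) : K)) 1 ∧
    ∀ i, ‖MvPolynomial.aeval u (F i)‖ = (resCard K : ℝ)⁻¹ ^ a i}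

variable {F : Fin r → MvPolynomial (Fin n) (RingInt K)} {z : Fin n → ResField K} {u : Fin n → K}
  {a : Fin r → ℕ}

theorem norm_le_one_of_mem_polyBox {σ : Type*} {z : σ → ResField K} {u : σ → K}
    (hu : u ∈ polyBox (fun j => (resLift (z j) : K)) 1) (j : σ) : ‖u j‖ ≤ 1 := by
  simpa using polyBox_subset_polyBox_zero_zero (fun j => norm_ringInt_le (resLift (z j))) _ hu j

theorem norm_aeval_le_inv_iff (hϖ : IsUniformizer ϖ) (f : MvPolynomial (Fin n) (RingInt K))
    (hu : u ∈ polyBox (fun j => (resLift (z j) : K)) 1) :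
    ‖MvPolynomial.aeval u f‖ ≤ (resCard K : ℝ)⁻¹ ↔ MvPolynomial.eval z (reduction f) = 0 := by
  lift u to Fin n → RingInt K using fun j => mem_ringInt.2 (norm_le_one_of_mem_polyBox hu j)
  have hz : (fun j => IsLocalRing.residue (RingInt K) (u j)) = z :=
    funext fun j => (norm_sub_resLift_le hϖ).1 (by simpa using hu j)
  rw [aeval_coe_eq, ← hϖ.norm_lt_one_iff, ← residue_eq_zero_iff, residue_eval, hz]

theorem eval_reduction_eq_zero_iff_of_mem_levelSet (hϖ : IsUniformizer ϖ)
    (hu : u ∈ levelSet F z a) (i : Fin r) :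
    MvPolynomial.eval z (reduction (F i)) = 0 ↔ a i ≠ 0 := by
  rw [← norm_aeval_le_inv_iff hϖ (F i) hu.1, hu.2 i]
  refine ⟨fun hle ha => hϖ.inv_lt_one.not_ge (by simpa [ha] using hle), fun ha => ?_⟩
  exact pow_le_of_le_one hϖ.inv_pos.le hϖ.inv_lt_one.le ha

theorem levelSet_eq_inter_preimage_polySphere (hϖ : IsUniformizer ϖ) {I : Finset (Fin r)}
    (hI : ∀ i, i ∈ I ↔ a i ≠ 0)
    (hF : ∀ i, MvPolynomial.eval z (reduction (F i)) = 0 ↔ i ∈ I) :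
    levelSet F z a = polyBox (fun j => (resLift (z j) : K)) 1 ∩
      (fun u (i : I) => (ϖ : K)⁻¹ * MvPolynomial.aeval u (F i)) ⁻¹'
        polySphere fun i => a i - 1 := by
  ext u
  refine and_congr_right fun hu => ?_
  have hscale (i : Fin r) (hi : i ∈ I) :
      ‖(ϖ : K)⁻¹ * MvPolynomial.aeval u (F i)‖ = (resCard K : ℝ)⁻¹ ^ (a i - 1) ↔
        ‖MvPolynomial.aeval u (F i)‖ = (resCard K : ℝ)⁻¹ ^ a i := by
    rw [norm_mul, norm_inv, hϖ.norm_eq, inv_mul_eq_iff_eq_mul₀ hϖ.inv_pos.ne', mul_comm,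
      pow_sub_one_mul ((hI i).1 hi)]
  refine ⟨fun h i => (hscale i i.2).2 (h i), fun h i => ?_⟩
  by_cases hi : i ∈ I
  · exact (hscale i hi).1 (h ⟨i, hi⟩)
  · have hge := mt (norm_aeval_le_inv_iff hϖ (F i) hu).1 (mt (hF i).1 hi)
    rw [← hϖ.norm_lt_one_iff, not_lt] at hge
    rw [of_not_not (mt (hI i).2 hi), pow_zero]
    exact (norm_aeval_le _ (norm_le_one_of_mem_polyBox hu)).antisymm hge

theorem polyBox_subset_preimage_polyBox (hϖ : IsUniformizer ϖ) {ι : Type*}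
    {G : ι → MvPolynomial (Fin n) (RingInt K)}
    (hG : ∀ i, MvPolynomial.eval z (reduction (G i)) = 0) :
    polyBox (fun j => (resLift (z j) : K)) 1 ⊆
      (fun u i => (ϖ : K)⁻¹ * MvPolynomial.aeval u (G i)) ⁻¹' polyBox 0 0 := fun u hu i => by
  simp only [Pi.zero_apply, sub_zero, pow_zero]
  rw [norm_mul, norm_inv, hϖ.norm_eq]
  exact inv_mul_le_one_of_le₀ ((norm_aeval_le_inv_iff hϖ (G i) hu).2 (hG i)) hϖ.inv_pos.le

variable [ProperSpace K] [MeasurableSpace K] [BorelSpace K]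

theorem measurableSet_levelSet (F : Fin r → MvPolynomial (Fin n) (RingInt K))
    (z : Fin n → ResField K) (a : Fin r → ℕ) : MeasurableSet (levelSet F z a) := by
  have hlevel : MeasurableSet (⋂ i, {u : Fin n → K |
      ‖MvPolynomial.aeval u (F i)‖ = (resCard K : ℝ)⁻¹ ^ a i}) :=
    MeasurableSet.iInter fun i => (measurable_aeval (F i)).norm (measurableSet_singleton _)
  rw [← ofPred_forall] at hlevel
  exact (measurableSet_polyBox _ _).inter hlevel

variable {μ : Measure (Fin n → K)} [μ.IsAddHaarMeasure]

theorem isBoxInvariant_map_of_reduction_rank (hϖ : IsUniformizer ϖ) {ι : Type*} [Fintype ι]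
    {G : ι → MvPolynomial (Fin n) (RingInt K)}
    (hG : ∀ i, MvPolynomial.eval z (reduction (G i)) = 0)
    (hrank : (Matrix.of fun (i : ι) (j : Fin n) =>
      MvPolynomial.eval z (MvPolynomial.pderiv j (reduction (G i)))).rank = Fintype.card ι) :
    IsBoxInvariant ((μ.restrict (polyBox (fun j => (resLift (z j) : K)) 1)).map
      fun u i => (ϖ : K)⁻¹ * MvPolynomial.aeval u (G i)) := by
  have hz : (fun j => IsLocalRing.residue (RingInt K) (resLift (z j))) = z :=
    funext fun j => residue_resLift (z j)
  refine isBoxInvariant_map_of_rank hϖ G _ (fun i => by rw [residue_eval, hz, hG]) ?_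
  rw [← hrank]
  congr 1
  ext i j
  rw [Matrix.of_apply, Matrix.of_apply, residue_eval, hz, reduction, reduction,
    MvPolynomial.pderiv_map]

-- Near `z` the vanishing reductions form a submersion, so the corresponding polynomials are
-- equidistributed modulo `ϖ ^ N`; the remaining ones are units.
theorem haar_real_levelSet_of_rank (hϖ : IsUniformizer ϖ) (hμ : μ {x | ∀ j, ‖x j‖ ≤ 1} = 1)
    {I : Finset (Fin r)} (hI : ∀ i, i ∈ I ↔ a i ≠ 0)
    (hF : ∀ i, MvPolynomial.eval z (reduction (F i)) = 0 ↔ i ∈ I)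
    (hrank : (Matrix.of fun (i : I) (j : Fin n) => MvPolynomial.eval z
      (MvPolynomial.pderiv j (reduction (F i)))).rank = I.card) :
    μ.real (levelSet F z a) = (resCard K : ℝ)⁻¹ ^ n *
      ∏ i ∈ I, ((resCard K : ℝ) - 1) * (resCard K : ℝ)⁻¹ ^ a i := by
  have hmeas : Measurable fun (u : Fin n → K) (i : I) => (ϖ : K)⁻¹ * MvPolynomial.aeval u (F i) :=
    measurable_pi_lambda _ fun i => (measurable_aeval (F i)).const_mul _
  have hF' (i : I) : MvPolynomial.eval z (reduction (F i)) = 0 := (hF i).2 i.2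
  rw [← Fintype.card_coe] at hrank
  have hinv := isBoxInvariant_map_of_reduction_rank (μ := μ) hϖ hF' hrank
  have hsphere := hinv.measureReal_polySphere hϖ fun i => a i - 1
  rw [map_measureReal_apply hmeas (measurableSet_polySphere _),
    map_measureReal_apply hmeas (measurableSet_polyBox _ _),
    measureReal_restrict_apply (hmeas (measurableSet_polySphere _)),
    measureReal_restrict_apply (hmeas (measurableSet_polyBox _ _)),
    inter_eq_right.2 (polyBox_subset_preimage_polyBox hϖ hF'), inter_comm,
    ← levelSet_eq_inter_preimage_polySphere hϖ hI hF, haar_real_polyBox hϖ hμ] at hsphere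
  rw [hsphere, ← Finset.prod_coe_sort I]
  congr 1
  · simp
  · exact Finset.prod_congr rfl fun i _ => by
      rw [Nat.sub_add_cancel (Nat.one_le_iff_ne_zero.2 ((hI i).1 i.2))]

theorem haar_real_levelSet (hϖ : IsUniformizer ϖ) (hμ : μ {x | ∀ j, ‖x j‖ ≤ 1} = 1)
    (F : Fin r → MvPolynomial (Fin n) (RingInt K)) (z : Fin n → ResField K)
    (hrank : ∀ I : Finset (Fin r), I.Nonempty →
      (∀ i, MvPolynomial.eval z (reduction (F i)) = 0 ↔ i ∈ I) →
      (Matrix.of fun (i : I) (j : Fin n) =>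
        MvPolynomial.eval z (MvPolynomial.pderiv j (reduction (F i)))).rank = I.card)
    (a : Fin r → ℕ) :
    μ.real (levelSet F z a) = (resCard K : ℝ)⁻¹ ^ n *
      ∏ i, levelWeight K (MvPolynomial.eval z (reduction (F i)) = 0) (a i) := by
  classical
  by_cases hF : ∀ i, MvPolynomial.eval z (reduction (F i)) = 0 ↔ a i ≠ 0
  · obtain ⟨I, hI⟩ : ∃ I : Finset (Fin r), ∀ i, i ∈ I ↔ a i ≠ 0 :=
      ⟨Finset.univ.filter (a · ≠ 0), by simp⟩
    have hFI (i : Fin r) : MvPolynomial.eval z (reduction (F i)) = 0 ↔ i ∈ I :=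
      (hF i).trans (hI i).symm
    rw [haar_real_levelSet_of_rank hϖ hμ hI hFI]
    · congr 1
      rw [← Finset.prod_subset I.subset_univ fun i _ hi => ?_]
      · exact Finset.prod_congr rfl fun i hi =>
          (levelWeight_of_pos ((hFI i).2 hi) ((hI i).1 hi)).symm
      · rw [of_not_not (mt (hI i).2 hi), levelWeight_of_neg (mt (hFI i).1 hi)]
    · rcases I.eq_empty_or_nonempty with rfl | hne
      · exact Nat.eq_zero_of_le_zero (Matrix.rank_le_card_height _)
      · exact hrank I hne hFI
  · obtain ⟨i, hi⟩ := not_forall.1 hF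
    have hempty : levelSet F z a = ∅ := eq_empty_of_forall_notMem fun u hu =>
      hi (eval_reduction_eq_zero_iff_of_mem_levelSet hϖ hu i)
    rw [hempty, measureReal_empty, Finset.prod_eq_zero (Finset.mem_univ i) (levelWeight_eq_zero hi),
      mul_zero]

end LevelSet

section LevelSum

namespace IsUniformizer

theorem natCast_ne_zero (hϖ : IsUniformizer ϖ) : (resCard K : ℂ) ≠ 0 := by
  exact_mod_cast (zero_lt_one.trans hϖ.one_lt).ne'

theorem inv_pow_cpow (hϖ : IsUniformizer ϖ) (m : ℕ) (s : ℂ) :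
    (((resCard K : ℝ)⁻¹ ^ m : ℝ) : ℂ) ^ s = (resCard K : ℂ) ^ (-(m : ℂ) * s) := by
  have hpos := pow_pos hϖ.inv_pos m
  rw [Complex.cpow_def_of_ne_zero (by exact_mod_cast hpos.ne'),
    Complex.cpow_def_of_ne_zero hϖ.natCast_ne_zero, ← Complex.ofReal_log hpos.le, Real.log_pow,
    Real.log_inv, ← Complex.natCast_log]
  push_cast
  ring_nf

theorem norm_cpow (hϖ : IsUniformizer ϖ) (w : ℂ) :
    ‖(resCard K : ℂ) ^ w‖ = (resCard K : ℝ) ^ w.re :=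
  Complex.norm_natCast_cpow_of_pos (zero_lt_one.trans hϖ.one_lt) w

theorem norm_cpow_lt_one (hϖ : IsUniformizer ϖ) {w : ℂ} (hw : w.re < 0) :
    ‖(resCard K : ℂ) ^ w‖ < 1 := by
  rw [hϖ.norm_cpow]
  exact Real.rpow_lt_one_of_one_lt_of_neg (by exact_mod_cast hϖ.one_lt) hw

theorem norm_cpow_neg_one_sub_lt_one (hϖ : IsUniformizer ϖ) {s : ℂ} (hs : -1 < s.re) :
    ‖(resCard K : ℂ) ^ (-1 - s)‖ < 1 :=
  hϖ.norm_cpow_lt_one (by simpa [neg_lt_iff_pos_add] using hs)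

theorem one_sub_cpow_ne_zero (hϖ : IsUniformizer ϖ) {w : ℂ} (hw : w.re < 0) :
    1 - (resCard K : ℂ) ^ w ≠ 0 := fun heq => by
  have hlt := hϖ.norm_cpow_lt_one hw
  rw [← sub_eq_zero.1 heq, norm_one] at hlt
  exact hlt.false

theorem inv_pow_mul_cpow (hϖ : IsUniformizer ϖ) (a : ℕ) (s : ℂ) :
    ((resCard K : ℝ)⁻¹ ^ a : ℂ) * (resCard K : ℂ) ^ (-(a : ℂ) * s) =
      ((resCard K : ℂ) ^ (-1 - s)) ^ a := by
  rw [← Complex.cpow_nat_mul, show (a : ℂ) * (-1 - s) = -(a : ℂ) + -(a : ℂ) * s by ring,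
    Complex.cpow_add _ _ hϖ.natCast_ne_zero, Complex.cpow_neg, Complex.cpow_natCast]
  simp

end IsUniformizer

/-- The integral of `|F| ^ s` over the part of a residue class on which `|F| = q ^ (-a)`, relative
to the volume of the class; `p` says whether the reduction of `F` vanishes there. -/
def levelTerm (K : Type*) [NontriviallyNormedField K] [IsUltrametricDist K] (p : Prop) (s : ℂ)
    (a : ℕ) : ℂ :=
  (levelWeight K p a : ℂ) * (resCard K : ℂ) ^ (-(a : ℂ) * s)

/-- The sum of the `levelTerm`s: the mean of `|F| ^ s` over a residue class. -/
def levelSum (K : Type*) [NontriviallyNormedField K] [IsUltrametricDist K] (p : Prop) (s : ℂ) :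
    ℂ :=
  open scoped Classical in
  if p then ((resCard K : ℂ) - 1) * (resCard K : ℂ) ^ (-1 - s) /
    (1 - (resCard K : ℂ) ^ (-1 - s)) else 1

theorem abs_levelWeight_le (hϖ : IsUniformizer ϖ) (p : Prop) (a : ℕ) :
    |levelWeight K p a| ≤ (resCard K : ℝ) * (resCard K : ℝ)⁻¹ ^ a := by
  have hq : (1 : ℝ) < resCard K := by exact_mod_cast hϖ.one_lt
  have hpos := pow_pos hϖ.inv_pos a
  rw [levelWeight]
  split_ifs with hp ha ha
  · rw [abs_zero]
    positivity
  · rw [abs_of_nonneg (mul_nonneg (by linarith) hpos.le)]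
    exact mul_le_mul_of_nonneg_right (by linarith) hpos.le
  · simpa [ha] using hq.le
  · rw [abs_zero]
    positivity

theorem norm_levelTerm_le (hϖ : IsUniformizer ϖ) (p : Prop) (s : ℂ) (a : ℕ) :
    ‖levelTerm K p s a‖ ≤ (resCard K : ℝ) * ‖(resCard K : ℂ) ^ (-1 - s)‖ ^ a := by
  rw [levelTerm, ← norm_pow, ← hϖ.inv_pow_mul_cpow, norm_mul, norm_mul, Complex.norm_real,
    Real.norm_eq_abs, ← mul_assoc]
  refine mul_le_mul_of_nonneg_right ((abs_levelWeight_le hϖ p a).trans_eq ?_) (norm_nonneg _)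
  rw [norm_pow, Complex.norm_real, Real.norm_of_nonneg hϖ.inv_pos.le]

theorem summable_norm_levelTerm_bound (hϖ : IsUniformizer ϖ) {s : ℂ} (hs : -1 < s.re) :
    Summable fun a : ℕ => (resCard K : ℝ) * ‖(resCard K : ℂ) ^ (-1 - s)‖ ^ a :=
  (summable_geometric_of_lt_one (norm_nonneg _)
    (hϖ.norm_cpow_neg_one_sub_lt_one hs)).mul_left _

theorem hasSum_levelTerm (hϖ : IsUniformizer ϖ) (p : Prop) {s : ℂ} (hs : -1 < s.re) :
    HasSum (levelTerm K p s) (levelSum K p s) := by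
  by_cases hp : p
  · have hgeom := (hasSum_geometric_of_norm_lt_one (hϖ.norm_cpow_neg_one_sub_lt_one hs)).mul_left
      (((resCard K : ℂ) - 1) * (resCard K : ℂ) ^ (-1 - s))
    have hsucc (a : ℕ) : levelTerm K p s (a + 1) =
        ((resCard K : ℂ) - 1) * (resCard K : ℂ) ^ (-1 - s) *
          ((resCard K : ℂ) ^ (-1 - s)) ^ a := by
      rw [levelTerm, levelWeight_of_pos hp (Nat.add_one_ne_zero a), mul_assoc, ← pow_succ',
        ← hϖ.inv_pow_mul_cpow]
      push_cast
      ring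
    have hzero : levelTerm K p s 0 = 0 := by simp [levelTerm, levelWeight, hp]
    rw [levelSum, if_pos hp, div_eq_mul_inv]
    refine (hasSum_nat_add_iff' 1).1 ?_
    simpa only [hsucc, Finset.sum_range_one, hzero, sub_zero] using hgeom
  · have hzero (a : ℕ) (ha : a ≠ 0) : levelTerm K p s a = 0 := by
      rw [levelTerm, levelWeight_eq_zero (by simp [hp, ha]), Complex.ofReal_zero, zero_mul]
    have hone : levelTerm K p s 0 = 1 := by simp [levelTerm, levelWeight_of_neg hp]
    rw [levelSum, if_neg hp, ← hone]
    exact hasSum_single 0 hzero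

end LevelSum

section Cells

/-- The points of the torus over the residue field. -/
abbrev ResTorus (K : Type*) [NontriviallyNormedField K] [IsUltrametricDist K] (n : ℕ) : Type _ :=
  {z : Fin n → ResField K // ∀ j, z j ≠ 0}

/-- The indices of the cells below: the valuations of the coordinates, their angular components,
and the valuations of the values of the `r` rescaled polynomials. -/
abbrev CellIndex (K : Type*) [NontriviallyNormedField K] [IsUltrametricDist K] (n r : ℕ) : Type _ :=
  (Fin n → ℕ) × ResTorus K n × (Fin r → ℕ)

/-- The piece of `Kⁿ` on which `|x j| = q ^ (-k j)`, the angular components are `z`, and the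
norms of the rescaled polynomials are `q ^ (-a i)`. -/
def cell (ϖ : RingInt K) (F : Fin r → (Fin n → ℕ) → MvPolynomial (Fin n) (RingInt K))
    (y : CellIndex K n r) : Set (Fin n → K) :=
  unscale (ϖ : K) y.1 ⁻¹' levelSet (fun i => F i y.1) y.2.1 y.2.2

variable {h : Fin r → MvPolynomial (Fin n) (RingInt K)}
  {F : Fin r → (Fin n → ℕ) → MvPolynomial (Fin n) (RingInt K)} {d : Fin r → (Fin n → ℕ) → ℕ}
  {y : CellIndex K n r} {x : Fin n → K}

theorem residue_eq_of_mem_polyBox (hϖ : IsUniformizer ϖ) {z : Fin n → ResField K}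
    {u : Fin n → RingInt K}
    (hu : (fun j => (u j : K)) ∈ polyBox (fun j => (resLift (z j) : K)) 1) (j : Fin n) :
    IsLocalRing.residue (RingInt K) (u j) = z j :=
  (norm_sub_resLift_le hϖ).1 (by simpa using hu j)

theorem norm_eq_one_of_mem_polyBox (hϖ : IsUniformizer ϖ) {z : Fin n → ResField K}
    (hx : x ∈ polyBox (fun j => (resLift (z j) : K)) 1) {j : Fin n} (hz : z j ≠ 0) :
    ‖x j‖ = 1 := by
  lift x to Fin n → RingInt K using fun j => mem_ringInt.2 (norm_le_one_of_mem_polyBox hx j)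
  rw [← residue_eq_of_mem_polyBox hϖ hx, Ne, residue_eq_zero_iff, not_lt] at hz
  exact (norm_ringInt_le _).antisymm hz

theorem norm_apply_of_mem_cell (hϖ : IsUniformizer ϖ) (hx : x ∈ cell ϖ F y) (j : Fin n) :
    ‖x j‖ = (resCard K : ℝ)⁻¹ ^ y.1 j := by
  rw [← congrFun (pow_mul_unscale hϖ y.1 x) j, norm_mul,
    norm_eq_one_of_mem_polyBox hϖ hx.1 (y.2.1.2 j), norm_pow, hϖ.norm_eq, mul_one]

theorem norm_aeval_of_mem_cell (hϖ : IsUniformizer ϖ)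
    (hF : ∀ i k, IsRescaling ϖ (h i) k (F i k) (d i k)) (hx : x ∈ cell ϖ F y) (i : Fin r) :
    ‖MvPolynomial.aeval x (h i)‖ = (resCard K : ℝ)⁻¹ ^ (d i y.1 + y.2.2 i) := by
  rw [← pow_mul_unscale hϖ y.1 x, (hF i y.1).aeval_eq, norm_mul, norm_pow, hϖ.norm_eq, hx.2 i,
    pow_add]

theorem cell_subset_zetaDomain (hϖ : IsUniformizer ϖ)
    (hF : ∀ i k, IsRescaling ϖ (h i) k (F i k) (d i k)) (y : CellIndex K n r) :
    cell ϖ F y ⊆ zetaDomain h := fun x hx => by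
  refine ⟨fun j => ?_, fun i => norm_pos_iff.1 ?_⟩
  · rw [norm_apply_of_mem_cell hϖ hx]
    exact pow_le_one₀ hϖ.inv_pos.le hϖ.inv_lt_one.le
  · rw [norm_aeval_of_mem_cell hϖ hF hx]
    exact pow_pos hϖ.inv_pos _

theorem eq_of_mem_polyBox (hϖ : IsUniformizer ϖ) {z z' : Fin n → ResField K}
    (hx : x ∈ polyBox (fun j => (resLift (z j) : K)) 1)
    (hx' : x ∈ polyBox (fun j => (resLift (z' j) : K)) 1) : z = z' := by
  lift x to Fin n → RingInt K using fun j => mem_ringInt.2 (norm_le_one_of_mem_polyBox hx j)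
  ext j
  rw [← residue_eq_of_mem_polyBox hϖ hx, residue_eq_of_mem_polyBox hϖ hx']

theorem pairwise_disjoint_cell (hϖ : IsUniformizer ϖ)
    (hF : ∀ i k, IsRescaling ϖ (h i) k (F i k) (d i k)) :
    Pairwise (Function.onFun Disjoint (cell (n := n) ϖ F)) := by
  rintro ⟨k, z, a⟩ ⟨k', z', a'⟩ hne
  refine Set.disjoint_left.2 fun x hx hx' => hne ?_
  obtain rfl : k = k' := funext fun j => hϖ.pow_inj <|
    (norm_apply_of_mem_cell hϖ hx j).symm.trans (norm_apply_of_mem_cell hϖ hx' j)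
  obtain rfl : a = a' := funext fun i => Nat.add_left_cancel <| hϖ.pow_inj <|
    (norm_aeval_of_mem_cell hϖ hF hx i).symm.trans (norm_aeval_of_mem_cell hϖ hF hx' i)
  obtain rfl : z = z' := Subtype.ext (eq_of_mem_polyBox hϖ hx.1 hx'.1)
  rfl

theorem exists_mem_cell (hϖ : IsUniformizer ϖ)
    (hF : ∀ i k, IsRescaling ϖ (h i) k (F i k) (d i k)) (hx : x ∈ zetaDomain h)
    (hx0 : ∀ j, x j ≠ 0) : ∃ y, x ∈ cell ϖ F y := by
  choose k hk using fun j => hϖ.exists_norm_eq (x j) (hx0 j) (hx.1 j)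
  choose u hu using fun j => exists_eq_pow_mul hϖ (hk j).le
  have hunscale : unscale (ϖ : K) k x = fun j => (u j : K) := funext fun j => by
    rw [unscale, hu j, inv_mul_cancel_left₀ (pow_ne_zero (k j) hϖ.ne_zero)]
  have hz (j : Fin n) : IsLocalRing.residue (RingInt K) (u j) ≠ 0 := by
    rw [← norm_pow_mul_eq_iff hϖ (a := k j), ← hu j]
    exact hk j
  have hne (i : Fin r) : MvPolynomial.aeval (unscale (ϖ : K) k x) (F i k) ≠ 0 := fun hi => by
    refine hx.2 i ?_
    rw [← pow_mul_unscale hϖ k x, (hF i k).aeval_eq, hi, mul_zero]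
  choose a ha using fun i => hϖ.exists_norm_eq _ (hne i) (norm_aeval_le _ fun j => by
    rw [hunscale]
    exact norm_ringInt_le _)
  refine ⟨(k, ⟨_, hz⟩, a), fun j => ?_, ha⟩
  simp only [hunscale, Pi.one_apply, pow_one]
  exact (norm_sub_resLift_le hϖ).2 rfl

variable [ProperSpace K] [MeasurableSpace K] {μ : Measure (Fin n → K)}

theorem measure_cell_lt_top [IsFiniteMeasureOnCompacts μ] (hϖ : IsUniformizer ϖ)
    (hF : ∀ i k, IsRescaling ϖ (h i) k (F i k) (d i k)) (y : CellIndex K n r) :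
    μ (cell ϖ F y) < ⊤ :=
  (measure_mono fun x hx => by
    simpa [polyBox] using (cell_subset_zetaDomain hϖ hF y hx).1).trans_lt
    (measure_polyBox_lt_top 0 0)

variable [BorelSpace K]

theorem measurableSet_cell (F : Fin r → (Fin n → ℕ) → MvPolynomial (Fin n) (RingInt K))
    (y : CellIndex K n r) : MeasurableSet (cell ϖ F y) :=
  measurableSet_preimage
    (measurable_pi_lambda _ fun j => (measurable_pi_apply j).const_mul _)
    (measurableSet_levelSet _ _ _)

variable [μ.IsAddHaarMeasure]

theorem haar_coordinate_hyperplane (hϖ : IsUniformizer ϖ) (hμ : μ {x | ∀ j, ‖x j‖ ≤ 1} = 1)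
    (j : Fin n) : μ {x | (∀ j, ‖x j‖ ≤ 1) ∧ x j = 0} = 0 := by
  have hsub (N : ℕ) : {x : Fin n → K | (∀ j, ‖x j‖ ≤ 1) ∧ x j = 0} ⊆
      polyBox 0 (Pi.single j N) := fun x hx i => by
    rcases eq_or_ne i j with rfl | hi
    · simp [hx.2]
    · simpa [Pi.single_eq_of_ne hi] using hx.1 i
  have hfin (N : ℕ) : μ (polyBox 0 (Pi.single j N)) ≠ ⊤ := (measure_polyBox_lt_top _ _).ne
  have hle (N : ℕ) : μ.real {x | (∀ j, ‖x j‖ ≤ 1) ∧ x j = 0} ≤ (resCard K : ℝ)⁻¹ ^ N := by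
    refine (measureReal_mono (hsub N) (hfin N)).trans_eq ?_
    rw [haar_real_polyBox hϖ hμ, Finset.prod_pow_eq_pow_sum, Finset.sum_pi_single']
    simp
  refine (measureReal_eq_zero_iff (measure_ne_top_of_subset (hsub 0) (hfin 0))).1 ?_
  exact (ge_of_tendsto' (tendsto_pow_atTop_nhds_zero_of_lt_one hϖ.inv_pos.le
    hϖ.inv_lt_one) hle).antisymm measureReal_nonneg

theorem iUnion_cell_ae_eq (hϖ : IsUniformizer ϖ) (hμ : μ {x | ∀ j, ‖x j‖ ≤ 1} = 1)
    (hF : ∀ i k, IsRescaling ϖ (h i) k (F i k) (d i k)) :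
    (⋃ y, cell ϖ F y : Set (Fin n → K)) =ᵐ[μ] zetaDomain h := by
  refine Filter.EventuallyLE.antisymm
    (LE.le.eventuallyLE (iUnion_subset (cell_subset_zetaDomain hϖ hF))) ?_
  refine ae_le_set.2 (measure_mono_null (t := ⋃ j, {x | (∀ j, ‖x j‖ ≤ 1) ∧ x j = 0}) ?_
    (measure_iUnion_null fun j => haar_coordinate_hyperplane hϖ hμ j))
  rintro x ⟨hx, hx'⟩
  by_contra hcon
  refine hx' (mem_iUnion.2 (exists_mem_cell hϖ hF hx fun j hj => hcon ?_))
  exact mem_iUnion.2 ⟨j, hx.1, hj⟩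

end Cells

end LocalField

theorem integrableOn_and_hasSum_of_partition {ι X E : Type*} [Countable ι] [MeasurableSpace X]
    [NormedAddCommGroup E] [NormedSpace ℝ E] [CompleteSpace E] {μ : Measure X} {S : ι → Set X}
    {D : Set X} {G : X → E} {c : ι → E} (hS : ∀ y, MeasurableSet (S y))
    (hdisj : Pairwise (Function.onFun Disjoint S)) (hD : ⋃ y, S y =ᵐ[μ] D)
    (hfin : ∀ y, μ (S y) ≠ ⊤) (hG : ∀ y, ∀ x ∈ S y, G x = c y)
    (hsum : Summable fun y => ‖μ.real (S y) • c y‖) :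
    IntegrableOn G D μ ∧ HasSum (fun y => μ.real (S y) • c y) (∫ x in D, G x ∂μ) := by
  have hint (y : ι) : IntegrableOn G (S y) μ :=
    (integrableOn_congr_fun (hG y) (hS y)).2 (integrableOn_const (hfin y))
  have hvalue (y : ι) : ∫ x in S y, G x ∂μ = μ.real (S y) • c y := by
    rw [setIntegral_congr_fun (hS y) (hG y), setIntegral_const]
  have hnorm (y : ι) : ∫ x in S y, ‖G x‖ ∂μ = ‖μ.real (S y) • c y‖ := by
    rw [setIntegral_congr_fun (hS y) fun x hx => congrArg norm (hG y x hx), setIntegral_const,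
      norm_smul, Real.norm_of_nonneg measureReal_nonneg, smul_eq_mul]
  have hunion : IntegrableOn G (⋃ y, S y) μ :=
    integrableOn_iUnion_of_summable_integral_norm hint (by simpa only [hnorm] using hsum)
  refine ⟨hunion.congr_set_ae hD.symm, ?_⟩
  rw [← setIntegral_congr_set hD]
  simpa only [hvalue] using hasSum_integral_iUnion hS hdisj hunion

theorem hasSum_of_fibers {κ Z A R : Type*} [Fintype Z] [NormedRing R] [CompleteSpace R] {e : κ → R}
    {T : κ → Z → A → R} {t : κ → Z → R} {V : R}
    (hs : Summable fun y : κ × Z × A => e y.1 * T y.1 y.2.1 y.2.2)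
    (hT : ∀ k z, HasSum (T k z) (t k z)) (hV : HasSum (fun k => e k * ∑ z, t k z) V) :
    HasSum (fun y : κ × Z × A => e y.1 * T y.1 y.2.1 y.2.2) V := by
  have hfiber (k : κ) : HasSum (fun y : Z × A => e k * T k y.1 y.2) (e k * ∑ z, t k z) := by
    have htsum := (hs.prod_factor k).hasSum
    have hsum := htsum.prod_fiberwise fun z => (hT k z).mul_left (e k)
    rw [Finset.mul_sum, ← hsum.unique (hasSum_fintype _)]
    exact htsum
  rw [← (hs.hasSum.prod_fiberwise hfiber).unique hV]
  exact hs.hasSum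

section LocalField

variable {K : Type*} [NontriviallyNormedField K] [IsUltrametricDist K] {n r : ℕ} {ϖ : RingInt K}
  {h : Fin r → MvPolynomial (Fin n) (RingInt K)} {s : Fin r → ℂ}

section CellTerm

/-- The term `q ^ (-σ(a) - ∑ d(a, Γ(hᵢ)) sᵢ)` attached to a vector `a`, used at lattice points. -/
def latticeTerm (h : Fin r → MvPolynomial (Fin n) (RingInt K)) (s : Fin r → ℂ)
    (a : Fin n → ℝ) : ℂ :=
  (resCard K : ℂ) ^
    (-((∑ j, a j : ℝ) : ℂ) - ∑ i, (dist a (newtonPolyhedron (h i)) : ℂ) * s i)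

/-- The integral over the torus of units attached to the direction `a`. -/
def torusFactor [Fintype (ResTorus K n)] (h : Fin r → MvPolynomial (Fin n) (RingInt K))
    (a : Fin n → ℝ) (s : Fin r → ℂ) : ℂ :=
  ∑ z : ResTorus K n, (resCard K : ℂ)⁻¹ ^ n * ∏ i, levelSum K
    (MvPolynomial.eval z.1 (reduction (faceFun (h i) a)) = 0) (s i)

/-- The value of the zeta integral over a cell. -/
def cellTerm (h : Fin r → MvPolynomial (Fin n) (RingInt K)) (s : Fin r → ℂ)
    (y : CellIndex K n r) : ℂ :=
  latticeTerm h s (toReal y.1) * ((resCard K : ℂ)⁻¹ ^ n * ∏ i, levelTerm K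
    (MvPolynomial.eval y.2.1.1 (reduction (faceFun (h i) (toReal y.1))) = 0) (s i) (y.2.2 i))

theorem summable_norm_cellTerm (hϖ : IsUniformizer ϖ) (hs : ∀ i, -1 < (s i).re)
    (he : Summable fun k : Fin n → ℕ => ‖latticeTerm h s (toReal k)‖) :
    Summable fun y => ‖cellTerm (n := n) h s y‖ := by
  have := hϖ.finite
  have hlevel := (hasSum_prod_pi (fun (i : Fin r) (a : ℕ) =>
    (resCard K : ℝ) * ‖(resCard K : ℂ) ^ (-1 - s i)‖ ^ a) fun i =>
      (summable_norm_levelTerm_bound hϖ (hs i)).norm).1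
  have htorus : Summable fun _ : ResTorus K n => (1 : ℝ) := Summable.of_finite
  have hbound := he.mul_of_nonneg (htorus.mul_of_nonneg hlevel (fun _ => zero_le_one)
    fun _ => norm_nonneg _) (fun _ => norm_nonneg _)
    fun _ => mul_nonneg zero_le_one (norm_nonneg _)
  refine Summable.of_nonneg_of_le (fun _ => norm_nonneg _) (fun y => ?_) hbound
  rw [cellTerm, norm_mul, norm_mul]
  refine mul_le_mul_of_nonneg_left (mul_le_mul ?_ ?_ (norm_nonneg _) zero_le_one) (norm_nonneg _)
  · rw [norm_pow, norm_inv, Complex.norm_natCast]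
    exact pow_le_one₀ hϖ.inv_pos.le hϖ.inv_lt_one.le
  · rw [norm_prod, Real.norm_of_nonneg (Finset.prod_nonneg fun i _ => by positivity)]
    exact Finset.prod_le_prod (fun _ _ => norm_nonneg _) fun i _ => norm_levelTerm_le hϖ _ _ _

theorem hasSum_cellTerm [Fintype (ResTorus K n)] (hϖ : IsUniformizer ϖ) (hs : ∀ i, -1 < (s i).re)
    (he : Summable fun k : Fin n → ℕ => ‖latticeTerm h s (toReal k)‖) {V : ℂ}
    (hV : HasSum (fun k : Fin n → ℕ => latticeTerm h s (toReal k) * torusFactor h (toReal k) s)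
      V) : HasSum (cellTerm (n := n) h s) V := by
  refine hasSum_of_fibers (e := fun k : Fin n → ℕ => latticeTerm h s (toReal k))
    (T := fun k (z : ResTorus K n) (a : Fin r → ℕ) => (resCard K : ℂ)⁻¹ ^ n * ∏ i, levelTerm K
      (MvPolynomial.eval z.1 (reduction (faceFun (h i) (toReal k))) = 0) (s i) (a i))
    (summable_norm_cellTerm (n := n) hϖ hs he).of_norm (fun k z => HasSum.mul_left _ ?_) hV
  have hsum (p : Fin r → Prop) : HasSum (fun a : Fin r → ℕ => ∏ i, levelTerm K (p i) (s i) (a i))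
      (∏ i, levelSum K (p i) (s i)) := by
    have hprod := (hasSum_prod_pi (fun i => levelTerm K (p i) (s i)) fun i =>
      Summable.of_nonneg_of_le (fun _ => norm_nonneg _) (norm_levelTerm_le hϖ (p i) (s i))
        (summable_norm_levelTerm_bound hϖ (hs i))).2
    rwa [Finset.prod_congr rfl fun i _ => (hasSum_levelTerm hϖ (p i) (hs i)).tsum_eq] at hprod
  exact hsum _

end CellTerm

section Integral

variable {F : Fin r → (Fin n → ℕ) → MvPolynomial (Fin n) (RingInt K)} {d : Fin r → (Fin n → ℕ) → ℕ}

theorem NonDegenerate.ne_zero (hnd : NonDegenerate h) (i : Fin r) : h i ≠ 0 := by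
  classical
  intro hi
  let p (i : Fin r) := MvPolynomial.eval (1 : Fin n → ResField K) (reduction (faceFun (h i) 0))
  have hface : faceFun (h i) 0 = 0 := by simp [hi, faceFun]
  have hp : p i = 0 := by simp [p, hface, reduction]
  have hmem : i ∈ Finset.univ.filter (p · = 0) := by simp [hp]
  have hrank := hnd 0 (fun _ => le_rfl) _ ⟨i, hmem⟩ 1 (fun _ => one_ne_zero) (by simp [p])
  rw [Matrix.rank_eq_finrank_span_row, ← Fintype.card_coe, eq_comm] at hrank
  exact (linearIndependent_iff_card_eq_finrank_span.2 hrank).ne_zero ⟨i, hmem⟩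
    (funext fun j => by simp [Matrix.row, hface, reduction])

theorem latticeTerm_toReal (hϖ : IsUniformizer ϖ)
    (hF : ∀ i k, IsRescaling ϖ (h i) k (F i k) (d i k)) (s : Fin r → ℂ) (k : Fin n → ℕ) :
    latticeTerm h s (toReal k) =
      (resCard K : ℂ)⁻¹ ^ sigma k * ∏ i, (resCard K : ℂ) ^ (-(d i k : ℂ) * s i) := by
  have hprod : (resCard K : ℂ) ^ (∑ i, -(d i k : ℂ) * s i) =
      ∏ i, (resCard K : ℂ) ^ (-(d i k : ℂ) * s i) := by
    simp only [Complex.cpow_def_of_ne_zero hϖ.natCast_ne_zero, Finset.mul_sum, ← Complex.exp_sum]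
  rw [latticeTerm, sum_toReal, sub_eq_add_neg, Complex.cpow_add _ _ hϖ.natCast_ne_zero,
    ← Finset.sum_neg_distrib, ← hprod, Complex.ofReal_natCast, Complex.cpow_neg,
    Complex.cpow_natCast, inv_pow]
  simp only [(hF _ k).dist_eq, Complex.ofReal_natCast, neg_mul]

variable [ProperSpace K] [MeasurableSpace K] [BorelSpace K]
  {μ : Measure (Fin n → K)} [μ.IsAddHaarMeasure]

theorem haar_real_cell (hϖ : IsUniformizer ϖ) (hμ : μ {x | ∀ j, ‖x j‖ ≤ 1} = 1)
    (hnd : NonDegenerate h) (hF : ∀ i k, IsRescaling ϖ (h i) k (F i k) (d i k))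
    (y : CellIndex K n r) :
    μ.real (cell ϖ F y) = (resCard K : ℝ)⁻¹ ^ sigma y.1 * ((resCard K : ℝ)⁻¹ ^ n *
      ∏ i, levelWeight K (MvPolynomial.eval y.2.1.1
        (reduction (faceFun (h i) (toReal y.1))) = 0) (y.2.2 i)) := by
  obtain ⟨k, z, a⟩ := y
  rw [cell, haar_real_preimage_unscale hϖ hμ k (measurableSet_levelSet _ _ _),
    haar_real_levelSet hϖ hμ, Finset.prod_pow_eq_pow_sum]
  · simp only [(hF _ k).reduction_eq]
    rfl
  · simp only [(hF _ k).reduction_eq]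
    exact fun I hI hmem => hnd (toReal k) (toReal_nonneg k) I hI z.1 z.2 hmem

theorem haar_real_cell_mul_prod (hϖ : IsUniformizer ϖ) (hμ : μ {x | ∀ j, ‖x j‖ ≤ 1} = 1)
    (hnd : NonDegenerate h) (hF : ∀ i k, IsRescaling ϖ (h i) k (F i k) (d i k))
    (y : CellIndex K n r) :
    μ.real (cell ϖ F y) •
      ∏ i, (resCard K : ℂ) ^ (-((d i y.1 + y.2.2 i : ℕ) : ℂ) * s i) = cellTerm h s y := by
  have hsplit (i : Fin r) : (resCard K : ℂ) ^ (-((d i y.1 + y.2.2 i : ℕ) : ℂ) * s i) =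
      (resCard K : ℂ) ^ (-(d i y.1 : ℂ) * s i) * (resCard K : ℂ) ^ (-(y.2.2 i : ℂ) * s i) := by
    rw [← Complex.cpow_add _ _ hϖ.natCast_ne_zero]
    congr 1
    push_cast
    ring
  simp only [Complex.real_smul, haar_real_cell hϖ hμ hnd hF, cellTerm, latticeTerm_toReal hϖ hF,
    levelTerm, hsplit, Finset.prod_mul_distrib]
  push_cast
  ring

theorem integral_zetaDomain_eq_of_hasSum [Fintype (ResTorus K n)] (hϖ : IsUniformizer ϖ)
    (hμ : μ {x | ∀ j, ‖x j‖ ≤ 1} = 1) (hnd : NonDegenerate h) (hs : ∀ i, -1 < (s i).re)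
    (he : Summable fun k : Fin n → ℕ => ‖latticeTerm h s (toReal k)‖) {V : ℂ}
    (hV : HasSum (fun k : Fin n → ℕ => latticeTerm h s (toReal k) * torusFactor h (toReal k) s)
      V) :
    IntegrableOn (fun x : Fin n → K => ∏ i, ((‖MvPolynomial.aeval x (h i)‖ : ℝ) : ℂ) ^ s i)
      (zetaDomain h) μ ∧ zetaIntegral μ h s = V := by
  have := hϖ.finite
  choose F d hF using fun i k => exists_isRescaling hϖ (hnd.ne_zero i) k
  have hvalue (y : CellIndex K n r) (x : Fin n → K) (hx : x ∈ cell ϖ F y) :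
      ∏ i, ((‖MvPolynomial.aeval x (h i)‖ : ℝ) : ℂ) ^ s i =
        ∏ i, (resCard K : ℂ) ^ (-((d i y.1 + y.2.2 i : ℕ) : ℂ) * s i) :=
    Finset.prod_congr rfl fun i _ => by rw [norm_aeval_of_mem_cell hϖ hF hx, hϖ.inv_pow_cpow]
  obtain ⟨hint, hsum⟩ := integrableOn_and_hasSum_of_partition (measurableSet_cell F)
    (pairwise_disjoint_cell hϖ hF) (iUnion_cell_ae_eq (μ := μ) hϖ hμ hF)
    (fun y => (measure_cell_lt_top hϖ hF y).ne) hvalue (by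
      simpa only [haar_real_cell_mul_prod hϖ hμ hnd hF] using summable_norm_cellTerm hϖ hs he)
  simp only [haar_real_cell_mul_prod hϖ hμ hnd hF] at hsum
  exact ⟨hint, hsum.unique (hasSum_cellTerm hϖ hs he hV)⟩

end Integral

section Cone

variable {W : Finset (Fin n → ℕ)}

/-- The numerator of the generating series of a cone: the sum of `latticeTerm` over the lattice
points of its half-open fundamental parallelepiped. -/
def coneNum (h : Fin r → MvPolynomial (Fin n) (RingInt K)) (s : Fin r → ℂ)
    (W : Finset (Fin n → ℕ)) : ℂ :=
  ∑ t ∈ (fundamentalPoints_finite W).toFinset, latticeTerm h s fun j => (t j : ℝ)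

/-- A simplicial cone subordinate to the Newton polyhedra of the `hᵢ`: the functions `d(·, Γ(hᵢ))`
are linear on the closed cone generated by `W`, and the face functions are constant on the open
cone. -/
structure IsSubordinate (h : Fin r → MvPolynomial (Fin n) (RingInt K))
    (W : Finset (Fin n → ℕ)) : Prop where
  linearIndependent : LinearIndependent ℝ (fun w : W => toReal (w : Fin n → ℕ))
  exists_dist_eq : ∀ i, ∃ m : Fin n →₀ ℕ, ∀ c : (Fin n → ℕ) → ℝ, (∀ w ∈ W, 0 ≤ c w) →
    dist (∑ w ∈ W, c w • toReal w) (newtonPolyhedron (h i)) =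
      (∑ w ∈ W, c w • toReal w) ⬝ᵥ toReal m
  faceFun_eq : ∀ i, ∀ a ∈ openCone W, faceFun (h i) a = faceFun (h i) (barycenter W)

theorem isSubordinate_empty (hh : ∀ i, h i ≠ 0) : IsSubordinate h ∅ where
  linearIndependent := linearIndependent_empty_type
  exists_dist_eq i := by
    obtain ⟨m, -, hm⟩ := exists_dist_eq_dotProduct (a := 0) (hh i) le_rfl
    exact ⟨m, fun c _ => by simpa using hm⟩
  faceFun_eq i a ha := by
    obtain ⟨c, -, rfl⟩ := ha
    simp [barycenter]

theorem IsSubordinate.exists_addChar (hW : IsSubordinate h W) (hϖ : IsUniformizer ϖ)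
    (s : Fin r → ℂ) :
    ∃ χ : AddChar (Fin n → ℤ) ℂ, ∀ (t : Fin n → ℤ) (c : (Fin n → ℕ) → ℝ), (∀ w ∈ W, 0 ≤ c w) →
      (fun j => (t j : ℝ)) = ∑ w ∈ W, c w • toReal w →
        latticeTerm h s (fun j => (t j : ℝ)) = χ t := by
  choose m hm using hW.exists_dist_eq
  let ψ (t : Fin n → ℤ) : ℂ :=
    -((∑ j, t j : ℤ) : ℂ) - ∑ i, (∑ j, (t j : ℂ) * (m i j : ℂ)) * s i
  have hψ (t u : Fin n → ℤ) : ψ (t + u) = ψ t + ψ u := by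
    simp only [ψ, Pi.add_apply, Int.cast_sum, Int.cast_add, Finset.sum_add_distrib, add_mul]
    ring
  refine ⟨⟨fun t => (resCard K : ℂ) ^ ψ t, by simp [ψ], fun t u => ?_⟩, fun t c hc ht => ?_⟩
  · rw [hψ, Complex.cpow_add _ _ hϖ.natCast_ne_zero]
  · have hdist (i : Fin r) : (dist (fun j => (t j : ℝ)) (newtonPolyhedron (h i)) : ℂ) =
        ∑ j, (t j : ℂ) * (m i j : ℂ) := by
      rw [ht, hm i c hc, ← ht]
      simp [dotProduct, toReal]
    simp only [latticeTerm, hdist, AddChar.coe_mk, ψ]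
    push_cast
    rfl

theorem IsSubordinate.hasSum_latticeTerm (hW : IsSubordinate h W) (hϖ : IsUniformizer ϖ)
    (hlt : ∀ w ∈ W, ‖latticeTerm h s (toReal w)‖ < 1) :
    (Summable fun k : {k : Fin n → ℕ // toReal k ∈ openCone W} =>
        ‖latticeTerm h s (toReal k.1)‖) ∧
      HasSum (fun k : {k : Fin n → ℕ // toReal k ∈ openCone W} => latticeTerm h s (toReal k.1))
        (coneNum h s W / ∏ w ∈ W, (1 - latticeTerm h s (toReal w))) := by
  classical
  obtain ⟨χ, hχ⟩ := hW.exists_addChar hϖ s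
  have htoInt (k : Fin n → ℕ) : (fun j => ((toInt k j : ℤ) : ℝ)) = toReal k := by
    ext j
    simp [toInt, toReal]
  have hgen (w) (hw : w ∈ W) : latticeTerm h s (toReal w) = χ (toInt w) := by
    rw [← htoInt]
    refine hχ _ (Pi.single w 1) (fun w' _ => by rw [Pi.single_apply]; positivity) ?_
    simp [htoInt, Pi.single_apply, ite_smul, hw]
  have hcone (k : {k : Fin n → ℕ // toReal k ∈ openCone W}) :
      latticeTerm h s (toReal k.1) = χ (toInt k.1) := by
    obtain ⟨c, hc, hk⟩ := k.2
    rw [← htoInt]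
    exact hχ _ c (fun w hw => (hc w hw).le) ((htoInt _).trans hk)
  have hnum : coneNum h s W = ∑ t ∈ (fundamentalPoints_finite W).toFinset, χ t :=
    Finset.sum_congr rfl fun t ht => by
      obtain ⟨c, hc, hct⟩ := (fundamentalPoints_finite W).mem_toFinset.1 ht
      exact hχ t c (fun w hw => (hc w hw).1.le) hct
  rw [hnum, Finset.prod_congr rfl fun w hw => congrArg (1 - ·) (hgen w hw)]
  simp only [hcone]
  exact hasSum_openCone hW.linearIndependent fun w hw => hgen w hw ▸ hlt w hw

end Cone

section ConePartition

variable {𝒲 : Finset (Finset (Fin n → ℕ))}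

/-- A finite family of cones containing every lattice point of the orthant exactly once. -/
structure IsConePartition (𝒲 : Finset (Finset (Fin n → ℕ))) : Prop where
  disjoint : ∀ W ∈ 𝒲, ∀ W' ∈ 𝒲, W ≠ W' → Disjoint (openCone W) (openCone W')
  exists_mem : ∀ k : Fin n → ℕ, ∃ W ∈ 𝒲, toReal k ∈ openCone W

theorem IsConePartition.hasSum {E : Type*} [NormedAddCommGroup E] (h𝒲 : IsConePartition 𝒲)
    {G : (Fin n → ℕ) → E} {V : Finset (Fin n → ℕ) → E}
    (hG : ∀ W ∈ 𝒲, HasSum (fun k : {k : Fin n → ℕ // toReal k ∈ openCone W} => G k) (V W)) :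
    HasSum G (∑ W ∈ 𝒲, V W) := by
  let S (W : Finset (Fin n → ℕ)) : Set (Fin n → ℕ) := {k | toReal k ∈ openCone W}
  have hsum : HasSum (fun k => ∑ W ∈ 𝒲, (S W).indicator G k) (∑ W ∈ 𝒲, V W) :=
    hasSum_sum fun W hW => hasSum_subtype_iff_indicator.1 (hG W hW)
  convert hsum using 2 with k
  obtain ⟨W, hW, hk⟩ := h𝒲.exists_mem k
  rw [Finset.sum_eq_single_of_mem W hW fun W' hW' hne => ?_]
  · exact (indicator_of_mem (s := S W) hk G).symm
  · exact indicator_of_notMem (s := S W')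
      (fun hk' => (h𝒲.disjoint W' hW' W hW hne).le_bot ⟨hk', hk⟩) G

variable [ProperSpace K] [MeasurableSpace K] [BorelSpace K]
  {μ : Measure (Fin n → K)} [μ.IsAddHaarMeasure]

theorem integral_zetaDomain_eq_sum [Fintype (ResTorus K n)] (hϖ : IsUniformizer ϖ)
    (hμ : μ {x | ∀ j, ‖x j‖ ≤ 1} = 1) (hnd : NonDegenerate h) (h𝒲 : IsConePartition 𝒲)
    (hsub : ∀ W ∈ 𝒲, IsSubordinate h W) (hs : ∀ i, -1 < (s i).re)
    (hlt : ∀ W ∈ 𝒲, ∀ w ∈ W, ‖latticeTerm h s (toReal w)‖ < 1) :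
    IntegrableOn (fun x : Fin n → K => ∏ i, ((‖MvPolynomial.aeval x (h i)‖ : ℝ) : ℂ) ^ s i)
        (zetaDomain h) μ ∧
      zetaIntegral μ h s = ∑ W ∈ 𝒲, torusFactor h (barycenter W) s *
        (coneNum h s W / ∏ w ∈ W, (1 - latticeTerm h s (toReal w))) := by
  have hcone (W) (hW : W ∈ 𝒲) := (hsub W hW).hasSum_latticeTerm hϖ (hlt W hW)
  refine integral_zetaDomain_eq_of_hasSum hϖ hμ hnd hs
    (h𝒲.hasSum (G := fun k => ‖latticeTerm h s (toReal k)‖) fun W hW =>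
      (hcone W hW).1.hasSum).summable
    (h𝒲.hasSum (V := fun W => torusFactor h (barycenter W) s *
      (coneNum h s W / ∏ w ∈ W, (1 - latticeTerm h s (toReal w)))) fun W hW => ?_)
  have hface (k : {k : Fin n → ℕ // toReal k ∈ openCone W}) :
      torusFactor h (toReal k.1) s = torusFactor h (barycenter W) s := by
    simp only [torusFactor, (hsub W hW).faceFun_eq _ _ k.2]
  simp only [hface, mul_comm _ (torusFactor h (barycenter W) s)]
  exact (hcone W hW).2.mul_left _

end ConePartition

end LocalField

theorem toMeromorphicNFOn_univ_eventuallyEq {𝕜 E : Type*} [NontriviallyNormedField 𝕜]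
    [CompleteSpace 𝕜] [NormedAddCommGroup E] [NormedSpace 𝕜 E] {φ : 𝕜 → E} {s : 𝕜}
    (hφ : MeromorphicOn φ univ) (hs : AnalyticAt 𝕜 φ s) :
    toMeromorphicNFOn φ univ =ᶠ[nhds s] φ := by
  have heq := toMeromorphicNFOn_eq_toMeromorphicNFAt_on_nhds hφ (mem_univ s)
  rwa [toMeromorphicNFAt_eq_self.2 hs.meromorphicNFAt] at heq

section LocalField

variable {K : Type*} [NontriviallyNormedField K] [IsUltrametricDist K] {n r : ℕ} {ϖ : RingInt K}
  {h : Fin r → MvPolynomial (Fin n) (RingInt K)} {𝒲 : Finset (Finset (Fin n → ℕ))} {s : Fin r → ℂ}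

section Denominator

/-- `levelSum` multiplied by its denominator. -/
def levelNum (K : Type*) [NontriviallyNormedField K] [IsUltrametricDist K] (p : Prop) (s : ℂ) :
    ℂ :=
  open scoped Classical in
  if p then ((resCard K : ℂ) - 1) * (resCard K : ℂ) ^ (-1 - s) else 1 - (resCard K : ℂ) ^ (-1 - s)

/-- `torusFactor` multiplied by its denominator. -/
def torusNum [Fintype (ResTorus K n)] (h : Fin r → MvPolynomial (Fin n) (RingInt K))
    (a : Fin n → ℝ) (s : Fin r → ℂ) : ℂ :=
  ∑ z : ResTorus K n, (resCard K : ℂ)⁻¹ ^ n * ∏ i, levelNum K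
    (MvPolynomial.eval z.1 (reduction (faceFun (h i) a)) = 0) (s i)

/-- A common denominator of the contributions of the cones in `𝒲` to the zeta function. -/
def zetaDen (h : Fin r → MvPolynomial (Fin n) (RingInt K)) (𝒲 : Finset (Finset (Fin n → ℕ)))
    (s : Fin r → ℂ) : ℂ :=
  (∏ i, (1 - (resCard K : ℂ) ^ (-1 - s i))) *
    ∏ w ∈ 𝒲.biUnion id, (1 - latticeTerm h s (toReal w))

/-- The zeta function multiplied by its common denominator `zetaDen`. -/
def zetaNum [Fintype (ResTorus K n)] (h : Fin r → MvPolynomial (Fin n) (RingInt K))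
    (𝒲 : Finset (Finset (Fin n → ℕ))) (s : Fin r → ℂ) : ℂ :=
  ∑ W ∈ 𝒲, torusNum h (barycenter W) s *
    (coneNum h s W * ∏ w ∈ 𝒲.biUnion id \ W, (1 - latticeTerm h s (toReal w)))

theorem prod_mul_torusFactor [Fintype (ResTorus K n)] (a : Fin n → ℝ)
    (hs : ∀ i, 1 - (resCard K : ℂ) ^ (-1 - s i) ≠ 0) :
    (∏ i, (1 - (resCard K : ℂ) ^ (-1 - s i))) * torusFactor h a s = torusNum h a s := by
  have hlevel (i : Fin r) (p : Prop) :
      (1 - (resCard K : ℂ) ^ (-1 - s i)) * levelSum K p (s i) = levelNum K p (s i) := by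
    rw [levelSum, levelNum]
    split_ifs
    · rw [mul_div_cancel₀ _ (hs i)]
    · rw [mul_one]
  simp only [torusFactor, torusNum, Finset.mul_sum, mul_left_comm _ (_ ^ n),
    ← Finset.prod_mul_distrib, hlevel]

theorem zetaDen_ne_zero_iff :
    zetaDen h 𝒲 s ≠ 0 ↔ (∀ i, 1 - (resCard K : ℂ) ^ (-1 - s i) ≠ 0) ∧
      ∀ W ∈ 𝒲, ∀ w ∈ W, 1 - latticeTerm h s (toReal w) ≠ 0 := by
  simp only [zetaDen, mul_ne_zero_iff, Finset.prod_ne_zero_iff, Finset.mem_univ, true_imp_iff,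
    Finset.mem_biUnion, id, forall_exists_index, and_imp]
  exact and_congr_right fun _ => forall_comm.trans (forall_congr' fun _ => forall_comm)

theorem zetaDen_mul_sum [Fintype (ResTorus K n)] (hs : zetaDen h 𝒲 s ≠ 0) :
    zetaDen h 𝒲 s * ∑ W ∈ 𝒲, torusFactor h (barycenter W) s *
      (coneNum h s W / ∏ w ∈ W, (1 - latticeTerm h s (toReal w))) = zetaNum h 𝒲 s := by
  obtain ⟨hunit, hgen⟩ := zetaDen_ne_zero_iff.1 hs
  rw [Finset.mul_sum, zetaNum]
  refine Finset.sum_congr rfl fun W hW => ?_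
  have hprod : ∏ w ∈ W, (1 - latticeTerm h s (toReal w)) ≠ 0 :=
    Finset.prod_ne_zero_iff.2 (hgen W hW)
  rw [zetaDen, ← prod_mul_torusFactor _ hunit,
    ← Finset.prod_sdiff (Finset.subset_biUnion_of_mem id hW), id]
  field_simp

theorem zetaDen_ne_zero_of_norm_lt_one (hϖ : IsUniformizer ϖ) (hs : ∀ i, -1 < (s i).re)
    (hlt : ∀ W ∈ 𝒲, ∀ w ∈ W, ‖latticeTerm h s (toReal w)‖ < 1) : zetaDen h 𝒲 s ≠ 0 :=
  zetaDen_ne_zero_iff.2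
    ⟨fun i => hϖ.one_sub_cpow_ne_zero (by simpa [neg_lt_iff_pos_add] using hs i),
      fun W hW w hw heq => by simpa [← sub_eq_zero.1 heq] using hlt W hW w hw⟩

theorem zetaDen_mul_zetaIntegral [ProperSpace K] [MeasurableSpace K] [BorelSpace K]
    {μ : Measure (Fin n → K)} [μ.IsAddHaarMeasure] [Fintype (ResTorus K n)] (hϖ : IsUniformizer ϖ)
    (hμ : μ {x | ∀ j, ‖x j‖ ≤ 1} = 1) (hnd : NonDegenerate h) (h𝒲 : IsConePartition 𝒲)
    (hsub : ∀ W ∈ 𝒲, IsSubordinate h W) (hs : ∀ i, -1 < (s i).re)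
    (hlt : ∀ W ∈ 𝒲, ∀ w ∈ W, ‖latticeTerm h s (toReal w)‖ < 1) :
    zetaDen h 𝒲 s * zetaIntegral μ h s = zetaNum h 𝒲 s := by
  rw [(integral_zetaDomain_eq_sum hϖ hμ hnd h𝒲 hsub hs hlt).2,
    zetaDen_mul_sum (zetaDen_ne_zero_of_norm_lt_one hϖ hs hlt)]

end Denominator

section Analytic

theorem IsUniformizer.analyticAt_cpow {E : Type*} [NormedAddCommGroup E] [NormedSpace ℂ E]
    (hϖ : IsUniformizer ϖ) {φ : E → ℂ} {x : E} (hφ : AnalyticAt ℂ φ x) :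
    AnalyticAt ℂ (fun y => (resCard K : ℂ) ^ φ y) x :=
  analyticAt_const.cpow hφ (Complex.natCast_mem_slitPlane.2 (zero_lt_one.trans hϖ.one_lt).ne')

theorem analyticAt_apply (i : Fin r) (s : Fin r → ℂ) :
    AnalyticAt ℂ (fun s : Fin r → ℂ => s i) s :=
  (ContinuousLinearMap.proj (R := ℂ) (φ := fun _ : Fin r => ℂ) i).analyticAt s

theorem analyticAt_cpow_neg_one_sub (hϖ : IsUniformizer ϖ) (i : Fin r) (s : Fin r → ℂ) :
    AnalyticAt ℂ (fun s : Fin r → ℂ => (resCard K : ℂ) ^ (-1 - s i)) s :=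
  hϖ.analyticAt_cpow (analyticAt_const.sub (analyticAt_apply i s))

theorem analyticAt_latticeTerm (hϖ : IsUniformizer ϖ) (a : Fin n → ℝ) (s : Fin r → ℂ) :
    AnalyticAt ℂ (fun s => latticeTerm h s a) s :=
  hϖ.analyticAt_cpow (analyticAt_const.sub (Finset.univ.analyticAt_fun_sum fun i _ =>
    analyticAt_const.mul (analyticAt_apply i s)))

theorem analyticAt_zetaDen (hϖ : IsUniformizer ϖ) (𝒲 : Finset (Finset (Fin n → ℕ)))
    (s : Fin r → ℂ) : AnalyticAt ℂ (zetaDen h 𝒲) s :=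
  (Finset.univ.analyticAt_fun_prod fun i _ =>
    analyticAt_const.sub (analyticAt_cpow_neg_one_sub hϖ i s)).mul
  ((𝒲.biUnion id).analyticAt_fun_prod fun w _ =>
    analyticAt_const.sub (analyticAt_latticeTerm hϖ (toReal w) s))

theorem analyticAt_zetaNum [Fintype (ResTorus K n)] (hϖ : IsUniformizer ϖ)
    (𝒲 : Finset (Finset (Fin n → ℕ))) (s : Fin r → ℂ) : AnalyticAt ℂ (zetaNum h 𝒲) s := by
  refine 𝒲.analyticAt_fun_sum fun W _ => AnalyticAt.mul ?_ (AnalyticAt.mul ?_ ?_)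
  · refine Finset.univ.analyticAt_fun_sum fun z _ => analyticAt_const.mul
      (Finset.univ.analyticAt_fun_prod fun i _ => ?_)
    simp only [levelNum]
    split_ifs
    · exact analyticAt_const.mul (analyticAt_cpow_neg_one_sub hϖ i s)
    · exact analyticAt_const.sub (analyticAt_cpow_neg_one_sub hϖ i s)
  · exact Finset.analyticAt_fun_sum _ fun t _ => analyticAt_latticeTerm hϖ _ s
  · exact Finset.analyticAt_fun_prod _ fun w _ =>
      analyticAt_const.sub (analyticAt_latticeTerm hϖ (toReal w) s)

theorem analyticAt_antidiagonal (s : ℂ) : AnalyticAt ℂ (fun s : ℂ => ![s, -s]) s :=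
  .pi <| Fin.forall_fin_two.2 ⟨analyticAt_id, analyticAt_id.neg⟩

end Analytic

section Laurent

/-- The algebra of Laurent polynomials in `q ^ (-s)`. -/
def laurent (K : Type*) [NontriviallyNormedField K] [IsUltrametricDist K] :
    Subalgebra ℂ (ℂ → ℂ) where
  carrier := {φ | ∃ (P : Polynomial ℂ) (N : ℕ), ∀ s, φ s * ((resCard K : ℂ) ^ (-s)) ^ N =
    P.eval ((resCard K : ℂ) ^ (-s))}
  algebraMap_mem' c := ⟨Polynomial.C c, 0, by simp⟩
  add_mem' := by
    rintro φ ψ ⟨P, N, hP⟩ ⟨Q, M, hQ⟩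
    refine ⟨P * Polynomial.X ^ M + Q * Polynomial.X ^ N, N + M, fun s => ?_⟩
    simp only [Polynomial.eval_add, Polynomial.eval_mul, Polynomial.eval_pow, Polynomial.eval_X,
      ← hP, ← hQ, Pi.add_apply]
    ring
  mul_mem' := by
    rintro φ ψ ⟨P, N, hP⟩ ⟨Q, M, hQ⟩
    refine ⟨P * Q, N + M, fun s => ?_⟩
    simp only [Polynomial.eval_mul, ← hP, ← hQ, Pi.mul_apply]
    ring

theorem exists_polynomial_div_eq {A B : ℂ → ℂ} (hϖ : IsUniformizer ϖ) (hA : A ∈ laurent K)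
    (hB : B ∈ laurent K) (hne : ∃ s, B s ≠ 0) :
    ∃ P Q : Polynomial ℂ, Q ≠ 0 ∧ ∀ s, Q.eval ((resCard K : ℂ) ^ (-s)) ≠ 0 →
      B s ≠ 0 ∧ A s / B s =
        P.eval ((resCard K : ℂ) ^ (-s)) / Q.eval ((resCard K : ℂ) ^ (-s)) := by
  obtain ⟨P, N, hP⟩ := hA
  obtain ⟨Q, M, hQ⟩ := hB
  have hT (s : ℂ) : (resCard K : ℂ) ^ (-s) ≠ 0 := by
    simp [Complex.cpow_eq_zero_iff, hϖ.natCast_ne_zero]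
  have heval (s : ℂ) : (Q * Polynomial.X ^ N).eval ((resCard K : ℂ) ^ (-s)) =
      B s * ((resCard K : ℂ) ^ (-s)) ^ (M + N) := by
    rw [Polynomial.eval_mul, Polynomial.eval_pow, Polynomial.eval_X, ← hQ, mul_assoc, pow_add]
  refine ⟨P * Polynomial.X ^ M, Q * Polynomial.X ^ N, fun hzero => ?_, fun s hs => ?_⟩
  · obtain ⟨s, hs⟩ := hne
    have := heval s
    rw [hzero, Polynomial.eval_zero] at this
    exact mul_ne_zero hs (pow_ne_zero _ (hT s)) this.symm
  · rw [heval] at hs ⊢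
    have hB := left_ne_zero_of_mul hs
    rw [Polynomial.eval_mul, Polynomial.eval_pow, Polynomial.eval_X, ← hP, div_eq_div_iff hB hs]
    exact ⟨hB, by ring⟩

theorem IsUniformizer.cpow_mem_laurent (hϖ : IsUniformizer ϖ) (c : ℂ) (N : ℤ) :
    (fun s => (resCard K : ℂ) ^ (c + N * s)) ∈ laurent K := by
  refine ⟨Polynomial.C ((resCard K : ℂ) ^ c) * Polynomial.X ^ (-N).toNat, N.toNat, fun s => ?_⟩
  have hN : (N : ℂ) = (N.toNat : ℂ) - ((-N).toNat : ℂ) := by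
    exact_mod_cast (Int.toNat_sub_toNat_neg N).symm
  simp only [Polynomial.eval_mul, Polynomial.eval_C, Polynomial.eval_pow, Polynomial.eval_X,
    ← Complex.cpow_nat_mul, ← Complex.cpow_add _ _ hϖ.natCast_ne_zero, hN]
  congr 1
  ring

variable {f g : MvPolynomial (Fin n) (RingInt K)}

theorem latticeTerm_antidiagonal (f g : MvPolynomial (Fin n) (RingInt K)) (s : ℂ)
    (a : Fin n → ℝ) : latticeTerm ![f, g] ![s, -s] a =
      (resCard K : ℂ) ^ (-((∑ j, a j : ℝ) : ℂ) + (distDiff f g a : ℂ) * s) := by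
  rw [latticeTerm, distDiff, Fin.sum_univ_two]
  congr 1
  simp only [Matrix.cons_val_zero, Matrix.cons_val_one]
  push_cast
  ring

theorem latticeTerm_mem_laurent (hϖ : IsUniformizer ϖ) (hf : f ≠ 0) (hg : g ≠ 0)
    (k : Fin n → ℕ) : (fun s => latticeTerm ![f, g] ![s, -s] (toReal k)) ∈ laurent K := by
  obtain ⟨a, ha⟩ := exists_dist_toReal_eq_natCast hg k
  obtain ⟨b, hb⟩ := exists_dist_toReal_eq_natCast hf k
  simpa [latticeTerm_antidiagonal, sum_toReal, distDiff, ha, hb] using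
    hϖ.cpow_mem_laurent (-(sigma k : ℂ)) (a - b)

theorem prod_one_sub_latticeTerm_mem_laurent (hϖ : IsUniformizer ϖ) (hf : f ≠ 0) (hg : g ≠ 0)
    (T : Finset (Fin n → ℕ)) :
    (fun s => ∏ w ∈ T, (1 - latticeTerm ![f, g] ![s, -s] (toReal w))) ∈ laurent K := by
  rw [← Finset.prod_fn]
  exact prod_mem fun w _ => sub_mem (one_mem _) (latticeTerm_mem_laurent hϖ hf hg w)

theorem coneNum_mem_laurent (hϖ : IsUniformizer ϖ) (hf : f ≠ 0) (hg : g ≠ 0)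
    (W : Finset (Fin n → ℕ)) : (fun s => coneNum ![f, g] ![s, -s] W) ∈ laurent K := by
  simp only [coneNum]
  rw [← Finset.sum_fn]
  refine sum_mem fun t ht => ?_
  have ht0 := fundamentalPoints_nonneg ((fundamentalPoints_finite W).mem_toFinset.1 ht)
  have htoReal : (fun j => (t j : ℝ)) = toReal fun j => (t j).toNat := by
    ext j
    rw [toReal]
    exact_mod_cast (Int.toNat_of_nonneg (ht0 j)).symm
  rw [htoReal]
  exact latticeTerm_mem_laurent hϖ hf hg _

theorem cpow_neg_one_sub_mem_laurent (hϖ : IsUniformizer ϖ) (i : Fin 2) :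
    (fun s => (resCard K : ℂ) ^ (-1 - ![s, -s] i)) ∈ laurent K := by
  fin_cases i
  · simpa [sub_eq_add_neg] using hϖ.cpow_mem_laurent (-1) (-1)
  · simpa using hϖ.cpow_mem_laurent (-1) 1

theorem torusNum_mem_laurent [Fintype (ResTorus K n)] (hϖ : IsUniformizer ϖ) (a : Fin n → ℝ) :
    (fun s => torusNum ![f, g] a ![s, -s]) ∈ laurent K := by
  have hlevel (i : Fin 2) (p : Prop) : (fun s => levelNum K p (![s, -s] i)) ∈ laurent K := by
    simp only [levelNum]
    split_ifs
    · exact mul_mem (algebraMap_mem _ ((resCard K : ℂ) - 1)) (cpow_neg_one_sub_mem_laurent hϖ i)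
    · exact sub_mem (one_mem _) (cpow_neg_one_sub_mem_laurent hϖ i)
  simp only [torusNum]
  rw [← Finset.sum_fn]
  refine sum_mem fun z _ => mul_mem (algebraMap_mem _ ((resCard K : ℂ)⁻¹ ^ n)) ?_
  rw [← Finset.prod_fn]
  exact prod_mem fun i _ => hlevel i _

theorem zetaDen_mem_laurent (hϖ : IsUniformizer ϖ) (hf : f ≠ 0) (hg : g ≠ 0)
    (𝒲 : Finset (Finset (Fin n → ℕ))) : (fun s => zetaDen ![f, g] 𝒲 ![s, -s]) ∈ laurent K := by
  refine mul_mem ?_ (prod_one_sub_latticeTerm_mem_laurent hϖ hf hg _)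
  rw [← Finset.prod_fn]
  exact prod_mem fun i _ => sub_mem (one_mem _) (cpow_neg_one_sub_mem_laurent hϖ i)

theorem zetaNum_mem_laurent [Fintype (ResTorus K n)] (hϖ : IsUniformizer ϖ) (hf : f ≠ 0)
    (hg : g ≠ 0) (𝒲 : Finset (Finset (Fin n → ℕ))) :
    (fun s => zetaNum ![f, g] 𝒲 ![s, -s]) ∈ laurent K := by
  simp only [zetaNum]
  rw [← Finset.sum_fn]
  exact sum_mem fun W _ => mul_mem (torusNum_mem_laurent hϖ _) (mul_mem
    (coneNum_mem_laurent hϖ hf hg W) (prod_one_sub_latticeTerm_mem_laurent hϖ hf hg _))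

end Laurent

end LocalField

section LocalField

variable {K : Type*} [NontriviallyNormedField K] [IsUltrametricDist K] {n r : ℕ} {ϖ : RingInt K}
  {f g : MvPolynomial (Fin n) (RingInt K)} {s : ℂ}

section Formula

theorem natCard_torus_subtype [Fintype (ResTorus K n)] (P : (Fin n → ResField K) → Prop)
    [DecidablePred fun z : ResTorus K n => P z.1] :
    Nat.card {z : Fin n → ResField K // (∀ j, z j ≠ 0) ∧ P z} =
      (Finset.univ.filter fun z : ResTorus K n => P z.1).card := by
  rw [← Fintype.card_subtype, ← Nat.card_eq_fintype_card]
  exact Nat.card_congr (Equiv.subtypeSubtypeEquivSubtypeInter _ P).symm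

theorem card_resTorus [Fintype (ResTorus K n)] (hϖ : IsUniformizer ϖ) :
    (Fintype.card (ResTorus K n) : ℂ) = ((resCard K : ℂ) - 1) ^ n := by
  classical
  have := hϖ.finite
  have := Fintype.ofFinite (ResField K)
  have hcard : Nat.card {z : ResField K // z ≠ 0} = resCard K - 1 := by
    rw [Nat.card_eq_fintype_card, Fintype.card_subtype_compl, Fintype.card_subtype_eq, resCard,
      Nat.card_eq_fintype_card]
  have htorus : Nat.card (ResTorus K n) = ∏ _ : Fin n, Nat.card {z : ResField K // z ≠ 0} :=
    (Nat.card_congr (Equiv.subtypePiEquivPi (p := fun _ z => z ≠ 0))).trans Nat.card_pi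
  rw [← Nat.card_eq_fintype_card, htorus, Finset.prod_const, hcard, Finset.card_univ,
    Fintype.card_fin, Nat.cast_pow, Nat.cast_sub hϖ.one_lt.le, Nat.cast_one]

theorem IsUniformizer.cpow_neg_one_add (hϖ : IsUniformizer ϖ) (s : ℂ) :
    (resCard K : ℂ) ^ (-1 + s) = (resCard K : ℂ) ^ s / resCard K := by
  rw [Complex.cpow_add _ _ hϖ.natCast_ne_zero, Complex.cpow_neg_one, inv_mul_eq_div]

theorem levelSum_of_true (hϖ : IsUniformizer ϖ) {p : Prop} (hp : p)
    (hs : 1 - (resCard K : ℂ) ^ (-1 - s) ≠ 0) :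
    levelSum K p s = 1 - (1 - (resCard K : ℂ) ^ (-s)) / (1 - (resCard K : ℂ) ^ (-1 - s)) := by
  have hq := hϖ.natCast_ne_zero
  rw [levelSum, if_pos hp, eq_sub_iff_add_eq, ← add_div, div_eq_one_iff_eq hs, sub_eq_add_neg (-1),
    hϖ.cpow_neg_one_add]
  field_simp
  ring

theorem one_sub_mul_one_sub_eq (hϖ : IsUniformizer ϖ)
    (hneg : 1 - (resCard K : ℂ) ^ (-1 - s) ≠ 0) (hpos : 1 - (resCard K : ℂ) ^ (-1 + s) ≠ 0) :
    (1 - (1 - (resCard K : ℂ) ^ (-s)) / (1 - (resCard K : ℂ) ^ (-1 - s))) *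
      (1 - (1 - (resCard K : ℂ) ^ s) / (1 - (resCard K : ℂ) ^ (-1 + s))) =
    1 - ((1 - (resCard K : ℂ) ^ (-s)) * (1 - (resCard K : ℂ) ^ s)) / ((resCard K : ℂ) *
      (1 - (resCard K : ℂ) ^ (-1 - s)) * (1 - (resCard K : ℂ) ^ (-1 + s))) := by
  have hq := hϖ.natCast_ne_zero
  have hinv : (resCard K : ℂ) ^ (-s) * (resCard K : ℂ) ^ s = 1 := by
    rw [← Complex.cpow_add _ _ hq, neg_add_cancel, Complex.cpow_zero]
  simp only [sub_eq_add_neg (-1 : ℂ), hϖ.cpow_neg_one_add, one_sub_div hq] at hneg hpos ⊢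
  generalize (resCard K : ℂ) ^ (-s) = T at *
  generalize (resCard K : ℂ) ^ s = T' at *
  have hT := (div_ne_zero_iff.1 hneg).1
  have hT' := (div_ne_zero_iff.1 hpos).1
  field_simp
  linear_combination ((resCard K : ℂ) ^ 2 - resCard K) * hinv

open scoped Classical in
theorem levelSum_mul_levelSum_neg (hϖ : IsUniformizer ϖ) (p p' : Prop)
    (hneg : 1 - (resCard K : ℂ) ^ (-1 - s) ≠ 0) (hpos : 1 - (resCard K : ℂ) ^ (-1 + s) ≠ 0) :
    levelSum K p s * levelSum K p' (-s) = 1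
      - (if p ∧ ¬p' then (1 - (resCard K : ℂ) ^ (-s)) / (1 - (resCard K : ℂ) ^ (-1 - s)) else 0)
      - (if p' ∧ ¬p then (1 - (resCard K : ℂ) ^ s) / (1 - (resCard K : ℂ) ^ (-1 + s)) else 0)
      - (if p ∧ p' then ((1 - (resCard K : ℂ) ^ (-s)) * (1 - (resCard K : ℂ) ^ s)) /
          ((resCard K : ℂ) * (1 - (resCard K : ℂ) ^ (-1 - s)) * (1 - (resCard K : ℂ) ^ (-1 + s)))
        else 0) := by
  have hlevel (hp : p) := levelSum_of_true hϖ hp hneg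
  have hlevel' (hp' : p') : levelSum K p' (-s) =
      1 - (1 - (resCard K : ℂ) ^ s) / (1 - (resCard K : ℂ) ^ (-1 + s)) := by
    simpa using levelSum_of_true hϖ hp' (s := -s) (by simpa using hpos)
  by_cases hp : p <;> by_cases hp' : p'
  · rw [hlevel hp, hlevel' hp', one_sub_mul_one_sub_eq hϖ hneg hpos]
    simp [hp, hp']
  · rw [hlevel hp, levelSum, if_neg hp']
    simp [hp, hp']
  · rw [hlevel' hp', levelSum, if_neg hp]
    simp [hp, hp']
  · simp [levelSum, hp, hp']

theorem torusFactor_eq_LFactor [Fintype (ResTorus K n)] (hϖ : IsUniformizer ϖ)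
    (W : Finset (Fin n → ℕ)) (hneg : 1 - (resCard K : ℂ) ^ (-1 - s) ≠ 0)
    (hpos : 1 - (resCard K : ℂ) ^ (-1 + s) ≠ 0) :
    torusFactor ![f, g] (barycenter W) ![s, -s] = LFactor f g W s := by
  classical
  rw [torusFactor, ← Finset.mul_sum, LFactor, Complex.cpow_neg, Complex.cpow_natCast, inv_pow]
  congr 1
  simp only [Fin.prod_univ_two, Matrix.cons_val_zero, Matrix.cons_val_one,
    levelSum_mul_levelSum_neg hϖ _ _ hneg hpos, Finset.sum_sub_distrib, ← Finset.sum_filter,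
    Finset.sum_const, nsmul_eq_mul, mul_one, Finset.card_univ, card_resTorus hϖ, countOne,
    countBoth, natCard_torus_subtype, ne_eq]

theorem denomFactor_eq (w : Fin n → ℕ) (s : ℂ) :
    denomFactor f g w s = 1 - latticeTerm ![f, g] ![s, -s] (toReal w) := by
  rw [denomFactor, latticeTerm_antidiagonal, sum_toReal, Complex.ofReal_natCast]

theorem coneNum_div_eq_SFactor (W : Finset (Fin n → ℕ)) (s : ℂ) :
    coneNum ![f, g] ![s, -s] W / ∏ w ∈ W, (1 - latticeTerm ![f, g] ![s, -s] (toReal w)) =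
      SFactor f g W s := by
  simp only [SFactor, coneNum, denomFactor_eq, latticeTerm_antidiagonal, Int.cast_sum,
    Complex.ofReal_sum, Complex.ofReal_intCast]

theorem coneNum_empty {h : Fin r → MvPolynomial (Fin n) (RingInt K)} (hh : ∀ i, h i ≠ 0)
    (s : Fin r → ℂ) : coneNum h s ∅ = 1 := by
  have hdist (i : Fin r) : dist 0 (newtonPolyhedron (h i)) = 0 := by
    obtain ⟨m, -, hm⟩ := exists_dist_eq_dotProduct (hh i) le_rfl
    rw [hm, zero_dotProduct]
  have hpoints : (fundamentalPoints_finite (∅ : Finset (Fin n → ℕ))).toFinset = {0} := by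
    ext t
    simp [fundamentalPoints, funext_iff]
  have hzero : (fun j => (((0 : Fin n → ℤ) j : ℤ) : ℝ)) = 0 := by ext; simp
  rw [coneNum, hpoints, Finset.sum_singleton, hzero, latticeTerm]
  simp [hdist]

end Formula

section Subdivision

theorem zero_mem_openCone_empty : (0 : Fin n → ℝ) ∈ openCone (∅ : Finset (Fin n → ℕ)) :=
  ⟨0, by simp⟩

theorem nonneg_and_ne_zero_of_mem_openCone {Γ : Set (Fin n → ℝ)} (F : SimplicialSubdivision Γ)
    {W : Finset (Fin n → ℕ)} (hW : W ∈ F.cones) {x : Fin n → ℝ} (hx : x ∈ openCone W) :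
    (∀ j, 0 ≤ x j) ∧ x ≠ 0 := by
  have hmem : x ∈ ⋃ W ∈ F.cones, openCone W := mem_iUnion₂.2 ⟨W, hW, hx⟩
  rwa [F.cover] at hmem

theorem empty_notMem_cones {Γ : Set (Fin n → ℝ)} (F : SimplicialSubdivision Γ) : ∅ ∉ F.cones :=
  fun hmem => (nonneg_and_ne_zero_of_mem_openCone F hmem zero_mem_openCone_empty).2 rfl

theorem isConePartition_insert_empty {Γ : Set (Fin n → ℝ)} (F : SimplicialSubdivision Γ) :
    IsConePartition (insert ∅ F.cones) where
  disjoint := by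
    have hempty (W) (hW : W ∈ F.cones) : Disjoint (openCone ∅) (openCone W) := by
      refine Set.disjoint_left.2 ?_
      rintro _ ⟨c, -, rfl⟩ hx
      exact (nonneg_and_ne_zero_of_mem_openCone F hW hx).2 Finset.sum_empty
    simp only [Finset.forall_mem_insert]
    exact ⟨⟨fun hne => (hne rfl).elim, fun W hW _ => hempty W hW⟩,
      fun W hW => ⟨fun _ => (hempty W hW).symm, F.disjoint W hW⟩⟩
  exists_mem k := by
    by_cases hk : toReal k = 0
    · exact ⟨∅, Finset.mem_insert_self _ _, hk ▸ zero_mem_openCone_empty⟩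
    · have hmem : toReal k ∈ ⋃ W ∈ F.cones, openCone W := F.cover ▸ ⟨toReal_nonneg k, hk⟩
      obtain ⟨W, hW, hkW⟩ := mem_iUnion₂.1 hmem
      exact ⟨W, Finset.mem_insert_of_mem hW, hkW⟩

theorem isSubordinate_of_mem_insert_empty (hf : f ≠ 0) (hg : g ≠ 0)
    (F : SimplicialSubdivision (newtonPolyhedron (f * g))) :
    ∀ W ∈ insert ∅ F.cones, IsSubordinate ![f, g] W := by
  rw [Finset.forall_mem_insert]
  refine ⟨isSubordinate_empty (Fin.forall_fin_two.2 ⟨hf, hg⟩), fun W hW => ?_⟩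
  obtain ⟨τ, ⟨-, -, -, -, -, hτ⟩, hWτ⟩ := F.subordinate W hW
  have hWτ' : openCone W ⊆ faceCone (newtonPolyhedron (g * f)) τ := by rwa [mul_comm]
  exact ⟨F.linearIndependent W hW, Fin.forall_fin_two.2
    ⟨exists_dist_eq_dotProduct_on_cone hf hg hτ hWτ,
      exists_dist_eq_dotProduct_on_cone hg hf hτ hWτ'⟩,
    Fin.forall_fin_two.2
      ⟨fun a ha => faceFun_eq_of_mem_openCone hf hg hτ hWτ ha (barycenter_mem_openCone W),
        fun a ha => faceFun_eq_of_mem_openCone hg hf hτ hWτ' ha (barycenter_mem_openCone W)⟩⟩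

theorem mem_facetNormals_of_mem_insert_empty {Γ : Set (Fin n → ℝ)} (F : SimplicialSubdivision Γ) :
    ∀ W ∈ insert ∅ F.cones, ∀ w ∈ W, w ∈ facetNormals Γ := by
  simpa using F.generators_mem

theorem sigma_pos {w : Fin n → ℕ} (hw : w ≠ 0) : 0 < sigma w := by
  obtain ⟨j, hj⟩ := Function.ne_iff.1 hw
  exact Finset.sum_pos' (fun _ _ => Nat.zero_le _) ⟨j, Finset.mem_univ j, Nat.pos_of_ne_zero hj⟩

theorem norm_latticeTerm_lt_one (hϖ : IsUniformizer ϖ)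
    {h : Fin r → MvPolynomial (Fin n) (RingInt K)} (hh : ∀ i, h i ≠ 0) {w : Fin n → ℕ}
    (hw : w ≠ 0) {s : Fin r → ℂ} (hs : ∀ i, 0 ≤ (s i).re) : ‖latticeTerm h s (toReal w)‖ < 1 := by
  refine hϖ.norm_cpow_lt_one ?_
  choose d hd using fun i => exists_dist_toReal_eq_natCast (hh i) w
  have hsum : 0 ≤ ∑ i, d i * (s i).re :=
    Finset.sum_nonneg fun i _ => mul_nonneg (Nat.cast_nonneg _) (hs i)
  have hsigma : (0 : ℝ) < sigma w := by exact_mod_cast sigma_pos hw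
  simp only [sum_toReal, hd, Complex.sub_re, Complex.neg_re, Complex.ofReal_re, Complex.re_sum,
    Complex.re_ofReal_mul]
  linarith

theorem distDiff_mul_re_lt_sigma {w : Fin n → ℕ}
    (hw : w ∈ facetNormals (newtonPolyhedron (f * g))) (hs : s ∈ band f g) :
    distDiff f g (toReal w) * s.re < sigma w := by
  rcases lt_trichotomy (distDiff f g (toReal w)) 0 with hlt | heq | hgt
  · have hbeta : ((slope f g w : ℝ) : EReal) ≤ beta f g :=
      le_iSup₂ (f := fun w _ => ((slope f g w : ℝ) : EReal)) w ⟨hw, hlt⟩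
    have hslope : slope f g w < s.re := by
      exact_mod_cast hbeta.trans_lt ((le_max_right _ _).trans_lt hs.1)
    rwa [slope, div_lt_iff_of_neg hlt, mul_comm] at hslope
  · rw [heq, zero_mul]
    exact_mod_cast sigma_pos hw.1
  · have halpha : alpha f g ≤ ((slope f g w : ℝ) : EReal) :=
      iInf₂_le (f := fun w _ => ((slope f g w : ℝ) : EReal)) w ⟨hw, hgt⟩
    have hslope : s.re < slope f g w := by
      exact_mod_cast (hs.2.trans_le (min_le_right _ _)).trans_le halpha
    rwa [slope, lt_div_iff₀ hgt, mul_comm] at hslope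

theorem norm_latticeTerm_antidiagonal_lt_one (hϖ : IsUniformizer ϖ) {w : Fin n → ℕ}
    (hw : w ∈ facetNormals (newtonPolyhedron (f * g))) (hs : s ∈ band f g) :
    ‖latticeTerm ![f, g] ![s, -s] (toReal w)‖ < 1 := by
  rw [latticeTerm_antidiagonal]
  refine hϖ.norm_cpow_lt_one ?_
  simpa [sum_toReal] using distDiff_mul_re_lt_sigma hw hs

theorem neg_one_lt_re_of_mem_band (hs : s ∈ band f g) : -1 < s.re := by
  have hlt : ((-1 : ℝ) : EReal) < s.re := by simpa using (le_max_left _ _).trans_lt hs.1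
  exact_mod_cast hlt

theorem re_lt_one_of_mem_band (hs : s ∈ band f g) : s.re < 1 := by
  exact_mod_cast hs.2.trans_le (min_le_left _ _)

end Subdivision

section Poles

theorem IsUniformizer.exists_int_eq_of_cpow_eq_one (hϖ : IsUniformizer ϖ) {a b : ℂ} (hb : b ≠ 0)
    (hs : (resCard K : ℂ) ^ (-a + b * s) = 1) :
    ∃ k : ℤ, s = a / b + 2 * Real.pi * Complex.I * k / (b * Real.log (resCard K)) := by
  have hlog : (Real.log (resCard K) : ℂ) ≠ 0 := by
    exact_mod_cast (Real.log_pos (by exact_mod_cast hϖ.one_lt)).ne'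
  rw [Complex.cpow_def_of_ne_zero hϖ.natCast_ne_zero, ← Complex.natCast_log] at hs
  obtain ⟨k, hk⟩ := Complex.exp_eq_one_iff.1 hs
  refine ⟨k, ?_⟩
  field_simp
  linear_combination hk

theorem mem_candidatePoles (hϖ : IsUniformizer ϖ) {𝒲 : Finset (Finset (Fin n → ℕ))}
    (h𝒲 : ∀ W ∈ 𝒲, ∀ w ∈ W, w ∈ facetNormals (newtonPolyhedron (f * g)))
    (hs : zetaDen ![f, g] 𝒲 ![s, -s] = 0) : s ∈ candidatePoles f g := by
  by_contra hmem
  simp only [candidatePoles, mem_union, not_or] at hmem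
  obtain ⟨⟨hpos, hneg⟩, hgen⟩ := hmem
  refine zetaDen_ne_zero_iff.2 ⟨Fin.forall_fin_two.2 ⟨fun hzero => hneg ?_, fun hzero => hpos ?_⟩,
    fun W hW w hw hzero => ?_⟩ hs
  · obtain ⟨k, hk⟩ := hϖ.exists_int_eq_of_cpow_eq_one (a := 1) (b := -1) (s := s) (by simp)
      (by simpa [sub_eq_add_neg] using (sub_eq_zero.1 hzero).symm)
    exact ⟨-k, by rw [hk]; push_cast; ring⟩
  · obtain ⟨k, hk⟩ := hϖ.exists_int_eq_of_cpow_eq_one (a := 1) (b := 1) (s := s) one_ne_zero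
      (by simpa using (sub_eq_zero.1 hzero).symm)
    exact ⟨k, by simpa using hk⟩
  · rw [latticeTerm_antidiagonal, sum_toReal, Complex.ofReal_natCast] at hzero
    by_cases hdiff : distDiff f g (toReal w) = 0
    · refine hϖ.one_sub_cpow_ne_zero ?_ hzero
      simpa [hdiff] using sigma_pos (h𝒲 W hW w hw).1
    · obtain ⟨k, hk⟩ := hϖ.exists_int_eq_of_cpow_eq_one (by exact_mod_cast hdiff)
        (sub_eq_zero.1 hzero).symm
      exact hgen ⟨w, h𝒲 W hW w hw, hdiff, k, by simpa [slope] using hk⟩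

end Poles

variable {𝒲 : Finset (Finset (Fin n → ℕ))}

section Antidiagonal

theorem prod_norm_cpow_antidiagonal (f g : MvPolynomial (Fin n) (RingInt K)) (s : ℂ)
    (x : Fin n → K) :
    ∏ i, ((‖MvPolynomial.aeval x (![f, g] i)‖ : ℝ) : ℂ) ^ (![s, -s] i) =
      ((‖MvPolynomial.aeval x f / MvPolynomial.aeval x g‖ : ℝ) : ℂ) ^ s := by
  have harg : Complex.arg (‖MvPolynomial.aeval x g‖ : ℝ) ≠ Real.pi := by
    rw [Complex.arg_ofReal_of_nonneg (norm_nonneg _)]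
    exact Real.pi_pos.ne
  rw [Fin.prod_univ_two, norm_div, div_eq_mul_inv, Complex.ofReal_mul,
    Complex.mul_cpow_ofReal_nonneg (norm_nonneg _) (inv_nonneg.2 (norm_nonneg _)),
    Complex.ofReal_inv, Complex.inv_cpow _ _ harg, ← Complex.cpow_neg]
  rfl

theorem neg_one_lt_re_antidiagonal_of_mem_band (hs : s ∈ band f g) (i : Fin 2) :
    -1 < (![s, -s] i).re := by
  fin_cases i
  · exact neg_one_lt_re_of_mem_band hs
  · simpa using re_lt_one_of_mem_band hs

theorem zetaDen_antidiagonal_ne_zero (hϖ : IsUniformizer ϖ)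
    (hgen : ∀ W ∈ 𝒲, ∀ w ∈ W, w ∈ facetNormals (newtonPolyhedron (f * g))) (hs : s ∈ band f g) :
    zetaDen ![f, g] 𝒲 ![s, -s] ≠ 0 :=
  zetaDen_ne_zero_of_norm_lt_one hϖ (neg_one_lt_re_antidiagonal_of_mem_band hs)
    fun W hW w hw => norm_latticeTerm_antidiagonal_lt_one hϖ (hgen W hW w hw) hs

theorem analyticAt_zetaDen_antidiagonal (hϖ : IsUniformizer ϖ) (s : ℂ) :
    AnalyticAt ℂ (fun s => zetaDen ![f, g] 𝒲 ![s, -s]) s :=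
  AnalyticAt.comp (g := zetaDen ![f, g] 𝒲) (f := fun s : ℂ => ![s, -s])
    (analyticAt_zetaDen hϖ 𝒲 _) (analyticAt_antidiagonal s)

theorem exists_zetaDen_antidiagonal_ne_zero (hϖ : IsUniformizer ϖ) (hf : f ≠ 0) (hg : g ≠ 0)
    (hgen : ∀ W ∈ 𝒲, ∀ w ∈ W, w ≠ 0) : ∃ s : ℂ, zetaDen ![f, g] 𝒲 ![s, -s] ≠ 0 :=
  ⟨0, zetaDen_ne_zero_of_norm_lt_one hϖ (Fin.forall_fin_two.2 (by simp)) fun W hW w hw =>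
    norm_latticeTerm_lt_one hϖ (Fin.forall_fin_two.2 ⟨hf, hg⟩) (hgen W hW w hw)
      (Fin.forall_fin_two.2 (by simp))⟩

end Antidiagonal

section QuotientZeta

variable [Fintype (ResTorus K n)]

/-- The zeta function `Z(s, f/g)`, as the meromorphic normal form of the restriction of
`zetaNum / zetaDen` to the line `s₂ = -s₁`. -/
def quotientZeta (f g : MvPolynomial (Fin n) (RingInt K)) (𝒲 : Finset (Finset (Fin n → ℕ))) :
    ℂ → ℂ :=
  toMeromorphicNFOn (fun s => zetaNum ![f, g] 𝒲 ![s, -s] / zetaDen ![f, g] 𝒲 ![s, -s]) univ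

theorem analyticAt_zetaNum_antidiagonal (hϖ : IsUniformizer ϖ) (s : ℂ) :
    AnalyticAt ℂ (fun s => zetaNum ![f, g] 𝒲 ![s, -s]) s :=
  AnalyticAt.comp (g := zetaNum ![f, g] 𝒲) (f := fun s : ℂ => ![s, -s])
    (analyticAt_zetaNum hϖ 𝒲 _) (analyticAt_antidiagonal s)

theorem quotientZeta_eventuallyEq (hϖ : IsUniformizer ϖ)
    (hs : zetaDen ![f, g] 𝒲 ![s, -s] ≠ 0) :
    quotientZeta f g 𝒲 =ᶠ[nhds s]
      fun s => zetaNum ![f, g] 𝒲 ![s, -s] / zetaDen ![f, g] 𝒲 ![s, -s] :=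
  toMeromorphicNFOn_univ_eventuallyEq
    (fun t _ => (analyticAt_zetaNum_antidiagonal hϖ t).meromorphicAt.div
      (analyticAt_zetaDen_antidiagonal hϖ t).meromorphicAt)
    ((analyticAt_zetaNum_antidiagonal hϖ s).div (analyticAt_zetaDen_antidiagonal hϖ s) hs)

theorem quotientZeta_eq_div (hϖ : IsUniformizer ϖ) (hs : zetaDen ![f, g] 𝒲 ![s, -s] ≠ 0) :
    quotientZeta f g 𝒲 s = zetaNum ![f, g] 𝒲 ![s, -s] / zetaDen ![f, g] 𝒲 ![s, -s] :=
  (quotientZeta_eventuallyEq hϖ hs).eq_of_nhds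

theorem analyticAt_quotientZeta (hϖ : IsUniformizer ϖ) (hs : zetaDen ![f, g] 𝒲 ![s, -s] ≠ 0) :
    AnalyticAt ℂ (quotientZeta f g 𝒲) s :=
  ((analyticAt_zetaNum_antidiagonal hϖ s).div (analyticAt_zetaDen_antidiagonal hϖ s) hs).congr
    (quotientZeta_eventuallyEq hϖ hs).symm

theorem exists_polynomial_quotientZeta_eq (hϖ : IsUniformizer ϖ) (hf : f ≠ 0) (hg : g ≠ 0)
    (hgen : ∀ W ∈ 𝒲, ∀ w ∈ W, w ≠ 0) :
    ∃ P Q : Polynomial ℂ, Q ≠ 0 ∧ ∀ s : ℂ, Q.eval ((resCard K : ℂ) ^ (-s)) ≠ 0 →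
      quotientZeta f g 𝒲 s =
        P.eval ((resCard K : ℂ) ^ (-s)) / Q.eval ((resCard K : ℂ) ^ (-s)) := by
  obtain ⟨P, Q, hQ, hPQ⟩ := exists_polynomial_div_eq hϖ (zetaNum_mem_laurent hϖ hf hg 𝒲)
    (zetaDen_mem_laurent hϖ hf hg 𝒲) (exists_zetaDen_antidiagonal_ne_zero hϖ hf hg hgen)
  refine ⟨P, Q, hQ, fun s hs => ?_⟩
  obtain ⟨hden, hdiv⟩ := hPQ s hs
  rw [quotientZeta_eq_div hϖ hden, hdiv]

theorem quotientZeta_insert_empty_eq_sum (hϖ : IsUniformizer ϖ) (hf : f ≠ 0) (hg : g ≠ 0)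
    (h𝒲 : ∅ ∉ 𝒲) (hneg : 1 - (resCard K : ℂ) ^ (-1 - s) ≠ 0)
    (hpos : 1 - (resCard K : ℂ) ^ (-1 + s) ≠ 0)
    (hgen : ∀ W ∈ 𝒲, ∀ w ∈ W, denomFactor f g w s ≠ 0) :
    quotientZeta f g (insert ∅ 𝒲) s =
      LFactor f g ∅ s + ∑ W ∈ 𝒲, LFactor f g W s * SFactor f g W s := by
  have hden : zetaDen ![f, g] (insert ∅ 𝒲) ![s, -s] ≠ 0 := by
    refine zetaDen_ne_zero_iff.2 ⟨Fin.forall_fin_two.2 ⟨hneg, by simpa using hpos⟩, ?_⟩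
    simpa [← denomFactor_eq] using hgen
  rw [quotientZeta_eq_div hϖ hden, div_eq_iff hden, mul_comm, ← zetaDen_mul_sum hden,
    Finset.sum_insert h𝒲, coneNum_empty (Fin.forall_fin_two.2 ⟨hf, hg⟩), Finset.prod_empty,
    div_one, mul_one]
  simp only [torusFactor_eq_LFactor hϖ _ hneg hpos, coneNum_div_eq_SFactor]

theorem differentiableOn_quotientZeta (hϖ : IsUniformizer ϖ)
    (hgen : ∀ W ∈ 𝒲, ∀ w ∈ W, w ∈ facetNormals (newtonPolyhedron (f * g))) :
    DifferentiableOn ℂ (quotientZeta f g 𝒲) (band f g) := fun _ hs =>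
  (analyticAt_quotientZeta hϖ
    (zetaDen_antidiagonal_ne_zero hϖ hgen hs)).differentiableAt.differentiableWithinAt

theorem mem_candidatePoles_of_meromorphicOrderAt_neg (hϖ : IsUniformizer ϖ)
    (hgen : ∀ W ∈ 𝒲, ∀ w ∈ W, w ∈ facetNormals (newtonPolyhedron (f * g)))
    (hs : meromorphicOrderAt (quotientZeta f g 𝒲) s < 0) : s ∈ candidatePoles f g :=
  mem_candidatePoles hϖ hgen <| of_not_not fun hden =>
    hs.not_ge (analyticAt_quotientZeta hϖ hden).meromorphicOrderAt_nonneg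

variable [ProperSpace K] [MeasurableSpace K] [BorelSpace K] {μ : Measure (Fin n → K)}
  [μ.IsAddHaarMeasure]

theorem isQuotientZeta_quotientZeta (hϖ : IsUniformizer ϖ) (hμ : μ {x | ∀ j, ‖x j‖ ≤ 1} = 1)
    (hnd : NonDegenerate ![f, g]) (h𝒲 : IsConePartition 𝒲)
    (hsub : ∀ W ∈ 𝒲, IsSubordinate ![f, g] W) (hgen : ∀ W ∈ 𝒲, ∀ w ∈ W, w ≠ 0) :
    IsQuotientZeta μ f g (quotientZeta f g 𝒲) := by
  refine ⟨meromorphicNFOn_toMeromorphicNFOn _ _, zetaNum ![f, g] 𝒲, zetaDen ![f, g] 𝒲,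
    fun s _ => analyticAt_zetaNum hϖ 𝒲 s, fun s _ => analyticAt_zetaDen hϖ 𝒲 s, fun s hs => ?_,
    exists_zetaDen_antidiagonal_ne_zero hϖ (hnd.ne_zero 0) (hnd.ne_zero 1) hgen,
    fun s hs => quotientZeta_eq_div hϖ hs⟩
  exact zetaDen_mul_zetaIntegral hϖ hμ hnd h𝒲 hsub (fun i => neg_one_lt_zero.trans (hs i))
    fun W hW w hw => norm_latticeTerm_lt_one hϖ hnd.ne_zero (hgen W hW w hw) fun i => (hs i).le

theorem integrableOn_and_quotientZeta_eq_integral (hϖ : IsUniformizer ϖ)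
    (hμ : μ {x | ∀ j, ‖x j‖ ≤ 1} = 1) (hnd : NonDegenerate ![f, g]) (h𝒲 : IsConePartition 𝒲)
    (hsub : ∀ W ∈ 𝒲, IsSubordinate ![f, g] W)
    (hgen : ∀ W ∈ 𝒲, ∀ w ∈ W, w ∈ facetNormals (newtonPolyhedron (f * g))) (hs : s ∈ band f g) :
    IntegrableOn (fun x : Fin n → K =>
        ((‖MvPolynomial.aeval x f / MvPolynomial.aeval x g‖ : ℝ) : ℂ) ^ s)
        (zetaDomain ![f, g]) μ ∧
      quotientZeta f g 𝒲 s = ∫ x in zetaDomain ![f, g],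
        ((‖MvPolynomial.aeval x f / MvPolynomial.aeval x g‖ : ℝ) : ℂ) ^ s ∂μ := by
  have hre := neg_one_lt_re_antidiagonal_of_mem_band hs
  have hlt : ∀ W ∈ 𝒲, ∀ w ∈ W, ‖latticeTerm ![f, g] ![s, -s] (toReal w)‖ < 1 :=
    fun W hW w hw => norm_latticeTerm_antidiagonal_lt_one hϖ (hgen W hW w hw) hs
  have hden := zetaDen_antidiagonal_ne_zero hϖ hgen hs
  simp only [← prod_norm_cpow_antidiagonal]
  refine ⟨(integral_zetaDomain_eq_sum hϖ hμ hnd h𝒲 hsub hre hlt).1, ?_⟩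
  rw [quotientZeta_eq_div hϖ hden, ← zetaDen_mul_zetaIntegral hϖ hμ hnd h𝒲 hsub hre hlt,
    mul_div_cancel_left₀ _ hden]
  rfl

end QuotientZeta

end LocalField

end NewtonZeta

end

theorem theorem2_general {K : Type*} [NontriviallyNormedField K] [IsUltrametricDist K]
    [LocallyCompactSpace K] [MeasurableSpace K] [BorelSpace K]
    (hnorm : ∀ ϖ : NewtonZeta.RingInt K, Irreducible ϖ → ‖(ϖ : K)‖ = (NewtonZeta.resCard K : ℝ)⁻¹)
    {n : ℕ} (μ : Measure (Fin n → K)) [μ.IsAddHaarMeasure]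
    (hμ : μ {x | ∀ j, ‖x j‖ ≤ 1} = 1)
    (f g : MvPolynomial (Fin n) (NewtonZeta.RingInt K))
    (hfg : NewtonZeta.NonDegenerate ![f, g])
    (F : NewtonZeta.SimplicialSubdivision (NewtonZeta.newtonPolyhedron (f * g))) :
    ∃ Z : ℂ → ℂ, NewtonZeta.IsQuotientZeta μ f g Z ∧
      (∃ P Q : Polynomial ℂ, Q ≠ 0 ∧ ∀ s : ℂ,
        Q.eval ((NewtonZeta.resCard K : ℂ) ^ (-s)) ≠ 0 →
          Z s = P.eval ((NewtonZeta.resCard K : ℂ) ^ (-s)) /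
            Q.eval ((NewtonZeta.resCard K : ℂ) ^ (-s))) ∧
      (∀ s : ℂ, 1 - (NewtonZeta.resCard K : ℂ) ^ (-1 - s) ≠ 0 →
        1 - (NewtonZeta.resCard K : ℂ) ^ (-1 + s) ≠ 0 →
        (∀ W ∈ F.cones, ∀ w ∈ W, NewtonZeta.denomFactor f g w s ≠ 0) →
          Z s = NewtonZeta.LFactor f g ∅ s +
            ∑ W ∈ F.cones, NewtonZeta.LFactor f g W s * NewtonZeta.SFactor f g W s) ∧
      DifferentiableOn ℂ Z (NewtonZeta.band f g) ∧
      (∀ s ∈ NewtonZeta.band f g,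
        IntegrableOn (fun x : Fin n → K =>
          ((‖MvPolynomial.aeval x f / MvPolynomial.aeval x g‖ : ℝ) : ℂ) ^ s)
          (NewtonZeta.zetaDomain ![f, g]) μ ∧
        Z s = ∫ x in NewtonZeta.zetaDomain ![f, g],
          ((‖MvPolynomial.aeval x f / MvPolynomial.aeval x g‖ : ℝ) : ℂ) ^ s ∂μ) ∧
      (∀ s : ℂ, meromorphicOrderAt Z s < 0 → s ∈ NewtonZeta.candidatePoles f g) := by
  open NewtonZeta in
  classical
  have : ProperSpace K := .of_locallyCompactSpace K
  obtain ⟨ϖ, hϖ⟩ := exists_isUniformizer hnorm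
  have := hϖ.finite
  have : Fintype (ResTorus K n) := Fintype.ofFinite _
  have hf : f ≠ 0 := hfg.ne_zero 0
  have hg : g ≠ 0 := hfg.ne_zero 1
  have hcones := isConePartition_insert_empty F
  have hsub := isSubordinate_of_mem_insert_empty hf hg F
  have hgen := mem_facetNormals_of_mem_insert_empty F
  have hgen_ne : ∀ W ∈ insert ∅ F.cones, ∀ w ∈ W, w ≠ 0 := fun W hW w hw => (hgen W hW w hw).1
  exact ⟨quotientZeta f g (insert ∅ F.cones),
    isQuotientZeta_quotientZeta hϖ hμ hfg hcones hsub hgen_ne,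
    exists_polynomial_quotientZeta_eq hϖ hf hg hgen_ne,
    fun _ hneg hpos =>
      quotientZeta_insert_empty_eq_sum hϖ hf hg (empty_notMem_cones F) hneg hpos,
    differentiableOn_quotientZeta hϖ hgen,
    fun _ => integrableOn_and_quotientZeta_eq_integral hϖ hμ hfg hcones hsub hgen,
    fun _ => mem_candidatePoles_of_meromorphicOrderAt_neg hϖ hgen⟩

theorem theorem2 {K : Type*} [NontriviallyNormedField K] [IsUltrametricDist K]
    [LocallyCompactSpace K] [MeasurableSpace K] [BorelSpace K]
    -- the absolute value of the local field `K` is the normalized one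
    (hnorm : ∀ ϖ : NewtonZeta.RingInt K, Irreducible ϖ → ‖(ϖ : K)‖ = (NewtonZeta.resCard K : ℝ)⁻¹)
    {n : ℕ} (hn : 2 ≤ n)
    -- the Haar measure on `Kⁿ` for which `𝒪ⁿ` has measure one
    (μ : Measure (Fin n → K)) [μ.IsAddHaarMeasure]
    (hμ : μ {x | ∀ j, ‖x j‖ ≤ 1} = 1)
    (f g : MvPolynomial (Fin n) (NewtonZeta.RingInt K))
    (hf : ∀ c, f ≠ MvPolynomial.C c) (hg : ∀ c, g ≠ MvPolynomial.C c)
    (hf' : NewtonZeta.reduction f ≠ 0) (hg' : NewtonZeta.reduction g ≠ 0)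
    (hfg : NewtonZeta.NonDegenerate ![f, g])
    (F : NewtonZeta.SimplicialSubdivision (NewtonZeta.newtonPolyhedron (f * g))) :
    ∃ Z : ℂ → ℂ, NewtonZeta.IsQuotientZeta μ f g Z ∧
      -- (i) rationality in `q ^ (-s)` and the explicit formula
      (∃ P Q : Polynomial ℂ, Q ≠ 0 ∧ ∀ s : ℂ,
        Q.eval ((NewtonZeta.resCard K : ℂ) ^ (-s)) ≠ 0 →
          Z s = P.eval ((NewtonZeta.resCard K : ℂ) ^ (-s)) /
            Q.eval ((NewtonZeta.resCard K : ℂ) ^ (-s))) ∧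
      (∀ s : ℂ, 1 - (NewtonZeta.resCard K : ℂ) ^ (-1 - s) ≠ 0 →
        1 - (NewtonZeta.resCard K : ℂ) ^ (-1 + s) ≠ 0 →
        (∀ W ∈ F.cones, ∀ w ∈ W, NewtonZeta.denomFactor f g w s ≠ 0) →
          Z s = NewtonZeta.LFactor f g ∅ s +
            ∑ W ∈ F.cones, NewtonZeta.LFactor f g W s * NewtonZeta.SFactor f g W s) ∧
      -- (ii) holomorphy on the band, and the integral there
      DifferentiableOn ℂ Z (NewtonZeta.band f g) ∧
      (∀ s ∈ NewtonZeta.band f g,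
        IntegrableOn (fun x : Fin n → K =>
          ((‖MvPolynomial.aeval x f / MvPolynomial.aeval x g‖ : ℝ) : ℂ) ^ s)
          (NewtonZeta.zetaDomain ![f, g]) μ ∧
        Z s = ∫ x in NewtonZeta.zetaDomain ![f, g],
          ((‖MvPolynomial.aeval x f / MvPolynomial.aeval x g‖ : ℝ) : ℂ) ^ s ∂μ) ∧
      -- (iii) the poles
      (∀ s : ℂ, meromorphicOrderAt Z s < 0 → s ∈ NewtonZeta.candidatePoles f g) := by
  exact theorem2_general hnorm μ hμ f g hfg F
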